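/- Let $\mathcal L$ be the first-order language with equality that has a function symbol for (every definition of) each primitive recursive function. Let $\mathsf{HA}$ be the intuitionistic $\mathcal L$-theory axiomatized by Robinson's $\mathsf Q$, the defining equations of the primitive recursive functions, and induction for all $\mathcal L$-formulas, and let $\mathsf{PA}$ be the classical theory with the same non-logical axioms. Let $T$ be Kleene's T-predicate and $U$ the result-extracting function, both given by primitive recursive function symbols ($T(z,x,u)$ abbreviates $T(z,x,u)=0$: $u$ codes a computation of the $z$-th partial recursive function on input $x$, and $U(u)$ is its value), and let $\mathsf{ECT}_0$ (extended Church's thesis) be the schema $$\forall\vec v\Bigl(\forall x\bigl(\phi(x,\vec v)\to\exists y\,\psi(x,y,\vec v)\bigr)\to\exists z\,\forall x\bigl(\phi(x,\vec v)\to\exists u\,(T(z,x,u)\land\psi(x,U(u),\vec v))\bigr)\Bigr),$$ where $\psi$ is any $\mathcal L$-formula and $\phi$ is any almost negative $\mathcal L$-formula, i.e. $\phi$ contains no $\lor$, and contains $\exists$ only immediately in front of atomic formulas. A Kripke model for $\mathcal L$ consists of a nonempty partial order $(K,\le)$ and, for each node $k\in K$, a classical $\mathcal L$-structure $\mathfrak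 M_k$, such that $\mathfrak M_k$ is a substructure of $\mathfrak M_{k'}$ whenever $k\le k'$. Forcing is defined as usual, a Kripke model forces a theory if all its nodes force all axioms of the theory, and a Kripke model is rooted, with root $r$, if $r\le k$ for every node $k$. Let $\mathbf{Th}_{\Pi_2}(\mathsf{PA})$ be the set of all sentences $\forall\vec x\,\exists\vec y\,\theta(\vec x,\vec y)$ with $\theta$ quantifier-free that are provable in $\mathsf{PA}$ (in classical logic). Then for every $\mathcal L$-structure $\mathfrak M$ the following are equivalent: 1. there is a rooted Kripke model of $\mathsf{HA}+\mathsf{ECT}_0$ whose root $r$ satisfies $\mathfrak M_r=\mathfrak M$ (up to isomorphism); 2. $\mathfrak M\models\mathbf{Th}_{\Pi_2}(\mathsf{PA})$. -/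

import Mathlib

open FirstOrder

universe u

/-! ### First-order formulas with all connectives primitive

Formulas are well-scoped: `Fml L n` is the type of `L`-formulas with free variables among
`0, …, n - 1`; a quantifier binds the variable `0` of its scope and the variable `i` of the
quantified formula is `i + 1` inside the scope.  All of `∧, ∨, →, ∀, ∃` are primitive since they
are not interdefinable intuitionistically.  Negation is `φ → ⊥`. -/

inductive Fml (L : FirstOrder.Language) : ℕ → Type _
  | falsum {n : ℕ} : Fml L n
  | eq {n : ℕ} (s t : L.Term (Fin n)) : Fml L n
  | rel {n k : ℕ} (R : L.Relations k) (ts : Fin k → L.Term (Fin n)) : Fml L n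
  | and {n : ℕ} (φ ψ : Fml L n) : Fml L n
  | or {n : ℕ} (φ ψ : Fml L n) : Fml L n
  | imp {n : ℕ} (φ ψ : Fml L n) : Fml L n
  | all {n : ℕ} (φ : Fml L (n + 1)) : Fml L n
  | ex {n : ℕ} (φ : Fml L (n + 1)) : Fml L n

namespace Fml

variable {L : FirstOrder.Language}

/-- Negation. -/
def neg {n : ℕ} (φ : Fml L n) : Fml L n := φ.imp falsum

/-- Lifting of a substitution under a quantifier. -/
def up {n m : ℕ} (σ : Fin n → L.Term (Fin m)) : Fin (n + 1) → L.Term (Fin (m + 1)) :=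
  Matrix.vecCons (Language.Term.var 0) (fun i => (σ i).relabel Fin.succ)

/-- Simultaneous capture-free substitution of terms for the free variables. -/
def subst : {n m : ℕ} → Fml L n → (Fin n → L.Term (Fin m)) → Fml L m
  | _, _, falsum, _ => falsum
  | _, _, eq s t, σ => eq (s.subst σ) (t.subst σ)
  | _, _, rel R ts, σ => rel R (fun i => (ts i).subst σ)
  | _, _, and φ ψ, σ => and (φ.subst σ) (ψ.subst σ)
  | _, _, or φ ψ, σ => or (φ.subst σ) (ψ.subst σ)
  | _, _, imp φ ψ, σ => imp (φ.subst σ) (ψ.subst σ)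
  | _, _, all φ, σ => all (φ.subst (up σ))
  | _, _, ex φ, σ => ex (φ.subst (up σ))

/-- `φ(t)`: the term `t` is substituted for variable `0`, the other variables are kept. -/
def inst {n : ℕ} (φ : Fml L (n + 1)) (t : L.Term (Fin n)) : Fml L n :=
  φ.subst (Matrix.vecCons t Language.Term.var)

/-- The same formula, regarded as a formula in which the new variable `0` does not occur. -/
def weaken {n : ℕ} (φ : Fml L n) : Fml L (n + 1) :=
  φ.subst (fun i => Language.Term.var i.succ)

/-- A sentence, regarded as a formula with `n` (dummy) free variables. -/
def ofSentence (n : ℕ) (φ : Fml L 0) : Fml L n := φ.subst (fun i => i.elim0)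

/-- Universal closure. -/
def alls : {n : ℕ} → Fml L n → Fml L 0
  | 0, φ => φ
  | _ + 1, φ => alls (all φ)

/-- Atomic formulas. -/
def IsAtomic : {n : ℕ} → Fml L n → Prop
  | _, falsum => True
  | _, eq _ _ => True
  | _, rel _ _ => True
  | _, _ => False

/-- Quantifier-free formulas. -/
def IsQF : {n : ℕ} → Fml L n → Prop
  | _, falsum => True
  | _, eq _ _ => True
  | _, rel _ _ => True
  | _, and φ ψ => IsQF φ ∧ IsQF ψ
  | _, or φ ψ => IsQF φ ∧ IsQF ψ
  | _, imp φ ψ => IsQF φ ∧ IsQF ψ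
  | _, all _ => False
  | _, ex _ => False

/-- Almost negative formulas: no `∨`, and `∃` only immediately in front of atomic formulas. -/
def IsAlmostNegative : {n : ℕ} → Fml L n → Prop
  | _, falsum => True
  | _, eq _ _ => True
  | _, rel _ _ => True
  | _, and φ ψ => IsAlmostNegative φ ∧ IsAlmostNegative ψ
  | _, or _ _ => False
  | _, imp φ ψ => IsAlmostNegative φ ∧ IsAlmostNegative ψ
  | _, all φ => IsAlmostNegative φ
  | _, ex φ => IsAtomic φ

/-- `∃ y₁ … y_k ψ` with `ψ` quantifier-free. -/
inductive IsSigma1 : {n : ℕ} → Fml L n → Prop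
  | qf {n : ℕ} {φ : Fml L n} : IsQF φ → IsSigma1 φ
  | ex {n : ℕ} {φ : Fml L (n + 1)} : IsSigma1 φ → IsSigma1 (ex φ)

/-- `∀ x₁ … x_m ∃ y₁ … y_k ψ` with `ψ` quantifier-free. -/
inductive IsPi2 : {n : ℕ} → Fml L n → Prop
  | sigma {n : ℕ} {φ : Fml L n} : IsSigma1 φ → IsPi2 φ
  | all {n : ℕ} {φ : Fml L (n + 1)} : IsPi2 φ → IsPi2 (all φ)

/-- Classical (Tarskian) satisfaction in a structure under an assignment. -/
def Realize (M : Type*) [L.Structure M] : {n : ℕ} → Fml L n → (Fin n → M) → Prop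
  | _, falsum, _ => False
  | _, eq s t, v => s.realize v = t.realize v
  | _, rel R ts, v => Language.Structure.RelMap R (fun i => (ts i).realize v)
  | _, and φ ψ, v => Realize M φ v ∧ Realize M ψ v
  | _, or φ ψ, v => Realize M φ v ∨ Realize M ψ v
  | _, imp φ ψ, v => Realize M φ v → Realize M ψ v
  | _, all φ, v => ∀ a : M, Realize M φ (Matrix.vecCons a v)
  | _, ex φ, v => ∃ a : M, Realize M φ (Matrix.vecCons a v)

end Fml

/-- `M ⊨ φ` for every sentence `φ` of the theory `T`. -/
def ModelsTheory {L : FirstOrder.Language} (M : Type*) [L.Structure M] (T : Set (Fml L 0)) : Prop :=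
  ∀ φ ∈ T, φ.Realize M (fun i => i.elim0)

/-- `T ⊢_c φ`: derivability in a Hilbert system for classical first-order logic with equality.
The number of free variables that may occur is tracked by `n`; the axiom `nonempty` expresses that
domains are not empty. -/
inductive ProvableC {L : FirstOrder.Language} (T : Set (Fml L 0)) : {n : ℕ} → Fml L n → Prop
  | ax {n : ℕ} {φ : Fml L 0} : φ ∈ T → ProvableC T (φ.ofSentence n)
  | mp {n : ℕ} {φ ψ : Fml L n} : ProvableC T (φ.imp ψ) → ProvableC T φ → ProvableC T ψ
  | imp_K {n : ℕ} (φ ψ : Fml L n) : ProvableC T (φ.imp (ψ.imp φ))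
  | imp_S {n : ℕ} (φ ψ χ : Fml L n) :
      ProvableC T ((φ.imp (ψ.imp χ)).imp ((φ.imp ψ).imp (φ.imp χ)))
  | and_intro {n : ℕ} (φ ψ : Fml L n) : ProvableC T (φ.imp (ψ.imp (φ.and ψ)))
  | and_left {n : ℕ} (φ ψ : Fml L n) : ProvableC T ((φ.and ψ).imp φ)
  | and_right {n : ℕ} (φ ψ : Fml L n) : ProvableC T ((φ.and ψ).imp ψ)
  | or_inl {n : ℕ} (φ ψ : Fml L n) : ProvableC T (φ.imp (φ.or ψ))
  | or_inr {n : ℕ} (φ ψ : Fml L n) : ProvableC T (ψ.imp (φ.or ψ))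
  | or_elim {n : ℕ} (φ ψ χ : Fml L n) :
      ProvableC T ((φ.imp χ).imp ((ψ.imp χ).imp ((φ.or ψ).imp χ)))
  | exfalso {n : ℕ} (φ : Fml L n) : ProvableC T (Fml.falsum.imp φ)
  | dne {n : ℕ} (φ : Fml L n) : ProvableC T (φ.neg.neg.imp φ)
  | all_elim {n : ℕ} (φ : Fml L (n + 1)) (t : L.Term (Fin n)) :
      ProvableC T (φ.all.imp (φ.inst t))
  | ex_intro {n : ℕ} (φ : Fml L (n + 1)) (t : L.Term (Fin n)) :
      ProvableC T ((φ.inst t).imp φ.ex)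
  | all_rule {n : ℕ} {ψ : Fml L n} {φ : Fml L (n + 1)} :
      ProvableC T (ψ.weaken.imp φ) → ProvableC T (ψ.imp φ.all)
  | ex_rule {n : ℕ} {ψ : Fml L n} {φ : Fml L (n + 1)} :
      ProvableC T (φ.imp ψ.weaken) → ProvableC T (φ.ex.imp ψ)
  | nonempty {n : ℕ} :
      ProvableC T (Fml.ex (n := n) (Fml.eq (Language.Term.var 0) (Language.Term.var 0)))
  | eq_refl {n : ℕ} (t : L.Term (Fin n)) : ProvableC T (Fml.eq t t)
  | eq_subst {n : ℕ} (φ : Fml L (n + 1)) (s t : L.Term (Fin n)) :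
      ProvableC T ((Fml.eq s t).imp ((φ.inst s).imp (φ.inst t)))

/-- `Th_{Π₂}(T)`: the `Π₂` sentences that are classically provable in `T`. -/
def ThPi2 {L : FirstOrder.Language} (T : Set (Fml L 0)) : Set (Fml L 0) :=
  {φ | φ.IsPi2 ∧ ProvableC T φ}

/-! ### Kripke models -/

/-- A Kripke model for the language `L`: a nonempty partial order of nodes, and at each node a
classical structure, such that for `k ≤ k'` the domain of `k` is a subset of the domain of `k'`
and the positive atomic diagram is preserved.  All domains are subsets of one ambient type. -/
structure KripkeModel (L : FirstOrder.Language) where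
  Node : Type u
  Ambient : Type u
  [order : PartialOrder Node]
  [nonempty_node : Nonempty Node]
  dom : Node → Set Ambient
  [str : ∀ k, L.Structure (dom k)]
  nonempty_dom : ∀ k, (dom k).Nonempty
  dom_mono : ∀ {k k' : Node}, k ≤ k' → dom k ⊆ dom k'
  map_fun : ∀ {k k' : Node} (h : k ≤ k') {n : ℕ} (f : L.Functions n) (a : Fin n → dom k),
    Set.inclusion (dom_mono h) (Language.Structure.funMap f a) =
      Language.Structure.funMap f (fun i => Set.inclusion (dom_mono h) (a i))
  map_rel : ∀ {k k' : Node} (h : k ≤ k') {n : ℕ} (R : L.Relations n) (a : Fin n → dom k),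
    Language.Structure.RelMap R a →
      Language.Structure.RelMap R (fun i => Set.inclusion (dom_mono h) (a i))

namespace KripkeModel

variable {L : FirstOrder.Language}

attribute [instance] KripkeModel.order KripkeModel.nonempty_node KripkeModel.str

/-- `k ⊩ φ[v]`, where the free variables of `φ` are interpreted by elements of the domain at
`k`. -/
def Forces (K : KripkeModel.{u} L) : {n : ℕ} → Fml L n → (k : K.Node) → (Fin n → K.dom k) → Prop
  | _, .falsum, _, _ => False
  | _, .eq s t, _, v => s.realize v = t.realize v
  | _, .rel R ts, _, v => Language.Structure.RelMap R (fun i => (ts i).realize v)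
  | _, .and φ ψ, k, v => K.Forces φ k v ∧ K.Forces ψ k v
  | _, .or φ ψ, k, v => K.Forces φ k v ∨ K.Forces ψ k v
  | _, .imp φ ψ, k, v => ∀ (k' : K.Node) (h : k ≤ k'),
      K.Forces φ k' (fun i => Set.inclusion (K.dom_mono h) (v i)) →
        K.Forces ψ k' (fun i => Set.inclusion (K.dom_mono h) (v i))
  | _, .all φ, k, v => ∀ (k' : K.Node) (h : k ≤ k') (a : K.dom k'),
      K.Forces φ k' (Matrix.vecCons a (fun i => Set.inclusion (K.dom_mono h) (v i)))
  | _, .ex φ, k, v => ∃ a : K.dom k, K.Forces φ k (Matrix.vecCons a v)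

/-- `K ⊩ T`: every node forces every axiom of `T`. -/
def ForcesTheory (K : KripkeModel.{u} L) (T : Set (Fml L 0)) : Prop :=
  ∀ φ ∈ T, ∀ k : K.Node, K.Forces φ k (fun i => i.elim0)

/-- `r` is the root of `K`. -/
def IsRoot (K : KripkeModel.{u} L) (r : K.Node) : Prop := ∀ k : K.Node, r ≤ k

end KripkeModel

/-! ### The language of primitive recursive arithmetic -/

/-- Symbols (definitions) of primitive recursive functions, by arity.  The recursion scheme is
`h(0, x⃗) = f(x⃗)`, `h(S y, x⃗) = g(y, h(y, x⃗), x⃗)` for `h = prec f g`. -/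
inductive PR : ℕ → Type
  | zero : PR 0
  | succ : PR 1
  | proj {n : ℕ} (i : Fin n) : PR n
  | comp {m n : ℕ} (f : PR m) (g : Fin m → PR n) : PR n
  | prec {n : ℕ} (f : PR n) (g : PR (n + 2)) : PR (n + 1)

/-- The language with a function symbol for every primitive recursive function; equality is the
only predicate. -/
def Lpr : FirstOrder.Language.{0, 0} := ⟨PR, fun _ => Empty⟩

namespace PR

/-- The term `f(t₁, …, t_m)`. -/
def app {m : ℕ} {α : Type} (f : PR m) (ts : Fin m → Lpr.Term α) : Lpr.Term α :=
  @Language.Term.func Lpr α m f ts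

/-! Composition with particular symbols; in what follows an element of `PR n` plays the role of a
term in the variables `proj 0, …, proj (n - 1)`. -/

def c1 {n : ℕ} (f : PR 1) (a : PR n) : PR n := comp f ![a]
def c2 {n : ℕ} (f : PR 2) (a b : PR n) : PR n := comp f ![a, b]
def c3 {n : ℕ} (f : PR 3) (a b c : PR n) : PR n := comp f ![a, b, c]

/-- The constant function `0` of any arity. -/
def zeroN {n : ℕ} : PR n := comp zero (fun i => i.elim0)

/-- `x + y`, by recursion on `y`. -/
def add : PR 2 := c2 (prec (proj 0) (c1 succ (proj 1))) (proj 1) (proj 0)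

/-- `x * y`, by recursion on `y`. -/
def mul : PR 2 := c2 (prec zeroN (c2 add (proj 1) (proj 2))) (proj 1) (proj 0)

/-- The predecessor, with value `0` at `0`. -/
def pred : PR 1 := prec zero (proj 0)

/-- Truncated subtraction `x ∸ y`, by recursion on `y`. -/
def sub : PR 2 := c2 (prec (proj 0) (c1 pred (proj 1))) (proj 1) (proj 0)

/-- `|x - y|`, which is `0` iff `x = y`. -/
def dist : PR 2 := c2 add sub (c2 sub (proj 1) (proj 0))

/-- `cond(x, a, b)` is `a` if `x = 0`, and `b` otherwise. -/
def cond : PR 3 := prec (proj 0) (proj 3)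

/-- `0 + 1 + ⋯ + x`. -/
def tri : PR 1 := prec zero (c2 add (proj 1) (c1 succ (proj 0)))

/-- The Cantor pairing function `⟨x, y⟩ = tri (x + y) + y`. -/
def pair : PR 2 := c2 add (c1 tri add) (proj 1)

/-- The largest `r` with `tri r ≤ x`. -/
def triRoot : PR 1 :=
  prec zero
    (c3 cond (c2 dist (c1 succ (proj 0)) (c1 tri (c1 succ (proj 1))))
      (c1 succ (proj 1)) (proj 1))

/-- Second projection of the pairing function. -/
def snd : PR 1 := c2 sub (proj 0) (c1 tri triRoot)

/-- First projection of the pairing function. -/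
def fst : PR 1 := c2 sub triRoot snd

/-! #### Kleene's T-predicate

Every number `e = ⟨t, ⟨a, b⟩⟩` is an index of a unary partial recursive function `{e}`:
* `t = 0`: `{e}(x) = a`;
* `t = 1`: `{e}(x) = x + 1`;
* `t = 2`: `{e}(⟨x, y⟩) = x`;
* `t = 3`: `{e}(⟨x, y⟩) = y`;
* `t = 4`: `{e}(x) = ⟨{a}(x), {b}(x)⟩`;
* `t = 5`: `{e}(x) = {a}({b}(x))`;
* `t = 6`: `{e}(⟨p, 0⟩) = {a}(p)` and `{e}(⟨p, m + 1⟩) = {b}(⟨p, ⟨m, {e}(⟨p, m⟩)⟩⟩)`;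
* `t ≥ 7`: `{e}(⟨p, m⟩)` is the least `k ≥ m` with `{a}(⟨p, k⟩) = 0` (and `{a}(⟨p, i⟩)` defined
  for `m ≤ i < k`), that is, `{e}(⟨p, m⟩) = m` if `{a}(⟨p, m⟩) = 0` and
  `{e}(⟨p, m⟩) = {e}(⟨p, m + 1⟩)` if `{a}(⟨p, m⟩) > 0`.

The computation of `{e}(x) = y` is the finite tree of all the calls of these clauses.  Its code is
`⟨e, ⟨x, ⟨y, ⟨l, r⟩⟩⟩⟩ + 1`, where `l` and `r` are the codes of the first and the second immediate
subcomputation, and `0` stands for an absent one.  Truth values are coded so that `0` is "true";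
hence a sum is a conjunction. -/

/-- The index `e` at the root of a computation. -/
def cIdx : PR 1 := c1 fst pred

/-- The argument `x` at the root of a computation. -/
def cArg : PR 1 := c1 fst (c1 snd pred)

/-- The value `y` at the root of a computation. -/
def cVal : PR 1 := c1 fst (c1 snd (c1 snd pred))

/-- The first subcomputation. -/
def cL : PR 1 := c1 fst (c1 snd (c1 snd (c1 snd pred)))

/-- The second subcomputation. -/
def cR : PR 1 := c1 snd (c1 snd (c1 snd (c1 snd pred)))

/-- `iterSnd(k, h)`: the second projection, applied `k` times to `h`. -/
def iterSnd : PR 2 := prec (proj 0) (c1 snd (proj 1))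

/-- `lookup(z, h, i)` for `i < z`: the entry number `i` of a list
`h = ⟨h_{z-1}, ⟨h_{z-2}, … ⟨h_0, 0⟩ … ⟩⟩`. -/
def lookup : PR 3 :=
  c1 fst (c2 iterSnd (c2 sub (c1 pred (proj 0)) (proj 2)) (proj 1))

/-- Sum of three and of two values, that is, conjunction. -/
def and2 {n : ℕ} (a b : PR n) : PR n := c2 add a b
def and3 {n : ℕ} (a b c : PR n) : PR n := and2 a (and2 b c)

section Step

/-! In this section `proj 0` is a number `z` that is to be tested for being the code of a
computation, and `proj 1` is the list of the results of the test for all smaller numbers. -/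

/-- "`c` is a computation (according to the list) with index `e` and argument `x`". -/
def sub' (c e x : PR 2) : PR 2 :=
  and3 (c3 lookup (proj 0) (proj 1) c) (c2 dist (c1 cIdx c) e) (c2 dist (c1 cArg c) x)

def zE : PR 2 := c1 cIdx (proj 0)
def zX : PR 2 := c1 cArg (proj 0)
def zY : PR 2 := c1 cVal (proj 0)
def zL : PR 2 := c1 cL (proj 0)
def zR : PR 2 := c1 cR (proj 0)
/-- The tag `t` of the index. -/
def zT : PR 2 := c1 fst zE
/-- The component `a` of the index. -/
def zA : PR 2 := c1 fst (c1 snd zE)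
/-- The component `b` of the index. -/
def zB : PR 2 := c1 snd (c1 snd zE)
/-- The value of the first subcomputation. -/
def zLY : PR 2 := c1 cVal zL
/-- The value of the second subcomputation. -/
def zRY : PR 2 := c1 cVal zR

/-- "`z` has no subcomputations and value `v`". -/
def leaf (v : PR 2) : PR 2 := and3 (c2 dist zY v) zL zR

def stepPair : PR 2 := and3 (sub' zL zA zX) (sub' zR zB zX) (c2 dist zY (c2 pair zLY zRY))

def stepComp : PR 2 := and3 (sub' zL zB zX) (sub' zR zA zLY) (c2 dist zY zRY)

def stepPrec : PR 2 :=
  c3 cond (c1 snd zX)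
    (and3 (sub' zL zA (c1 fst zX)) zR (c2 dist zY zLY))
    (and3 (sub' zL zE (c2 pair (c1 fst zX) (c1 pred (c1 snd zX))))
      (sub' zR zB (c2 pair (c1 fst zX) (c2 pair (c1 pred (c1 snd zX)) zLY)))
      (c2 dist zY zRY))

def stepMin : PR 2 :=
  and2 (sub' zL zA zX)
    (c3 cond zLY
      (and2 zR (c2 dist zY (c1 snd zX)))
      (and2 (sub' zR zE (c2 pair (c1 fst zX) (c1 succ (c1 snd zX)))) (c2 dist zY zRY)))

/-- The test for a number `z > 0`, by cases on the tag. -/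
def stepPos : PR 2 :=
  c3 cond zT (leaf zA) <|
  c3 cond (c1 pred zT) (leaf (c1 succ zX)) <|
  c3 cond (c1 pred (c1 pred zT)) (leaf (c1 fst zX)) <|
  c3 cond (c1 pred (c1 pred (c1 pred zT))) (leaf (c1 snd zX)) <|
  c3 cond (c1 pred (c1 pred (c1 pred (c1 pred zT)))) stepPair <|
  c3 cond (c1 pred (c1 pred (c1 pred (c1 pred (c1 pred zT))))) stepComp <|
  c3 cond (c1 pred (c1 pred (c1 pred (c1 pred (c1 pred (c1 pred zT)))))) stepPrec <|
  stepMin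

/-- The test for any number; `0` is not the code of a computation. -/
def step : PR 2 := c3 cond (proj 0) (c1 succ zeroN) stepPos

end Step

/-- The list of the results of the test for all numbers smaller than `z`. -/
def history : PR 1 := prec zero (c2 pair (c2 step (proj 0) (proj 1)) (proj 1))

/-- `isComp(z) = 0` iff `z` is the code of a computation. -/
def isComp : PR 1 := c2 step (proj 0) history

/-- Kleene's T-predicate: `T(e, x, z) = 0` iff `z` is the code of a computation of `{e}(x)`. -/
def kleeneT : PR 3 :=
  and3 (c1 isComp (proj 2))
    (c2 dist (c1 cIdx (proj 2)) (proj 0)) (c2 dist (c1 cArg (proj 2)) (proj 1))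

/-- The result-extracting function. -/
def kleeneU : PR 1 := cVal

end PR

/-! ### Arithmetical theories -/

section Theories

/-- Variables, zero, successor, sum and product as terms. -/
def tv {n : ℕ} (i : Fin n) : Lpr.Term (Fin n) := Language.Term.var i
def tZero {n : ℕ} : Lpr.Term (Fin n) := PR.zero.app (fun i => i.elim0)
def tSucc {n : ℕ} (t : Lpr.Term (Fin n)) : Lpr.Term (Fin n) := PR.succ.app ![t]
def tAdd {n : ℕ} (s t : Lpr.Term (Fin n)) : Lpr.Term (Fin n) := PR.add.app ![s, t]
def tMul {n : ℕ} (s t : Lpr.Term (Fin n)) : Lpr.Term (Fin n) := PR.mul.app ![s, t]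

/-- Axioms of Robinson arithmetic. -/
inductive AxQ : Fml Lpr 0 → Prop
  | succ_ne_zero : AxQ (Fml.alls (n := 1) (Fml.eq (tSucc (tv 0)) tZero).neg)
  | succ_inj : AxQ (Fml.alls (n := 2)
      ((Fml.eq (tSucc (tv 0)) (tSucc (tv 1))).imp (Fml.eq (tv 0) (tv 1))))
  | zero_or_succ : AxQ (Fml.alls (n := 1)
      ((Fml.eq (tv 0) tZero).or (Fml.ex (Fml.eq (tv 1) (tSucc (tv 0))))))
  | add_zero : AxQ (Fml.alls (n := 1) (Fml.eq (tAdd (tv 0) tZero) (tv 0)))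
  | add_succ : AxQ (Fml.alls (n := 2)
      (Fml.eq (tAdd (tv 0) (tSucc (tv 1))) (tSucc (tAdd (tv 0) (tv 1)))))
  | mul_zero : AxQ (Fml.alls (n := 1) (Fml.eq (tMul (tv 0) tZero) tZero))
  | mul_succ : AxQ (Fml.alls (n := 2)
      (Fml.eq (tMul (tv 0) (tSucc (tv 1))) (tAdd (tMul (tv 0) (tv 1)) (tv 0))))

/-- Defining equations of the primitive recursive functions. -/
inductive AxPR : Fml Lpr 0 → Prop
  | proj {n : ℕ} (i : Fin n) :
      AxPR (Fml.alls (Fml.eq ((PR.proj i).app tv) (tv i)))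
  | comp {m n : ℕ} (f : PR m) (g : Fin m → PR n) :
      AxPR (Fml.alls (n := n)
        (Fml.eq ((PR.comp f g).app tv) (f.app (fun j => (g j).app tv))))
  | prec_zero {n : ℕ} (f : PR n) (g : PR (n + 2)) :
      AxPR (Fml.alls (n := n)
        (Fml.eq ((PR.prec f g).app (Matrix.vecCons tZero tv)) (f.app tv)))
  | prec_succ {n : ℕ} (f : PR n) (g : PR (n + 2)) :
      AxPR (Fml.alls (n := n + 1)
        (Fml.eq ((PR.prec f g).app (Matrix.vecCons (tSucc (tv 0)) (fun i => tv i.succ)))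
          (g.app (Matrix.vecCons (tv 0) (Matrix.vecCons ((PR.prec f g).app tv) (fun i => tv i.succ))))))

/-- The induction axiom for `φ(x, y⃗)`, where `x` is the variable `0`:
`∀ y⃗ (φ(0) ∧ ∀ x (φ(x) → φ(S x)) → ∀ x φ(x))`. -/
def indAxiom {n : ℕ} (φ : Fml Lpr (n + 1)) : Fml Lpr 0 :=
  Fml.alls
    (((φ.inst tZero).and
      (Fml.all (φ.imp (φ.subst (Matrix.vecCons (tSucc (tv 0)) (fun i => tv i.succ)))))).imp
        (Fml.all φ))

/-- The non-logical axioms common to `HA` (over intuitionistic logic) and `PA` (over classical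
logic). -/
def arithAxioms : Set (Fml Lpr 0) :=
  {σ | AxQ σ ∨ AxPR σ ∨ ∃ (n : ℕ) (φ : Fml Lpr (n + 1)), σ = indAxiom φ}

/-- Axioms of Heyting arithmetic. -/
def HA : Set (Fml Lpr 0) := arithAxioms

/-- Axioms of Peano arithmetic. -/
def PA : Set (Fml Lpr 0) := arithAxioms

/-- The instance of extended Church's thesis for `φ(x, v⃗)` (with `x` the variable `0`) and
`ψ(x, y, v⃗)` (with `y` the variable `0` and `x` the variable `1`):
`∀ v⃗ (∀ x (φ(x, v⃗) → ∃ y ψ(x, y, v⃗)) →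
  ∃ z ∀ x (φ(x, v⃗) → ∃ u (T(z, x, u) = 0 ∧ ψ(x, U(u), v⃗))))`. -/
def ectAxiom {n : ℕ} (φ : Fml Lpr (n + 1)) (ψ : Fml Lpr (n + 2)) : Fml Lpr 0 :=
  Fml.alls
    ((Fml.all (φ.imp (Fml.ex ψ))).imp
      (Fml.ex (Fml.all
        ((φ.subst (Matrix.vecCons (tv 0) (fun i => tv i.succ.succ))).imp
          (Fml.ex
            ((Fml.eq (PR.kleeneT.app ![tv 2, tv 1, tv 0]) tZero).and
              (ψ.subst (Matrix.vecCons (PR.kleeneU.app ![tv 0])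
                (Matrix.vecCons (tv 1) (fun i => tv i.succ.succ.succ))))))))))

/-- The extended Church's thesis: all instances with `φ` almost negative. -/
def ECT0 : Set (Fml Lpr 0) :=
  {σ | ∃ (n : ℕ) (φ : Fml Lpr (n + 1)) (ψ : Fml Lpr (n + 2)),
    φ.IsAlmostNegative ∧ σ = ectAxiom φ ψ}

end Theories

/-! ### Tarskian semantics and syntactic substitution. -/

namespace Fml

variable {L : FirstOrder.Language}

section Semantics

/-! From Kripke models to `Th_{Π₂}(PA)`. In a rooted model of `HA`, take a formula `A` with
parameters at the root and let `B` be the set of nodes that force it. Read absurdity as `B`, and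
doubly negate disjunctions and existentials relative to `B` (the Friedman–Gödel translation,
`SForces`). Translated formulas are `B`-stable, so classical logic is sound for them
(`sforces_of_provableC`). Each translated formula is again expressed by a formula that has the
parameters of `A`, so the induction schema of `HA` yields the translated induction schema
(`sforces_arithAxioms`); the root makes these parameters available at every node. If `PA` proves `∀
x ∃ y θ`, take for `A` the instance of `∃ y θ` at given elements of the root: its translation
collapses to `A` itself (`mem_of_sforces_isSigma1`), so the root forces `A`, and for `Σ₁` formulas
forcing at a node is truth in its structure.

From `Th_{Π₂}(PA)` to Kripke models. Let `M` satisfy the `Π₂` consequences of `PA`. By compactness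
the universal formulas true in `M` are consistent with `PA`: a refutation would make a `Π₂` sentence
provable that fails in `M` (`not_der_falsum`). Hence `M` embeds into some `N ⊨ PA` so that a
computation with index and argument in `M` that halts in `N` already halts in `M`
(`exists_embedding_paModel`).

Now interpret formulas by Kleene realizability inside `N`, where a sequent holds if one index from
`M` transforms realizers uniformly in all values of the free names. `HA` is realized, induction by
primitive recursion (`valid_indAxiom`). `ECT₀` is realized because an almost negative formula that
has a realizer has one computable from its parameters (`exists_canonical_realizer`,
`valid_ectAxiom`).

The formulas over `M` that have a realizer in `M` form a theory (`rootWorld`) that is closed under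
this consequence relation, since values of computations from `M` stay in `M`. It has the disjunction
and existence properties, since a realizer names the true disjunct or the witness. In the Kripke
model of all prime Henkin theories above it, forcing is membership (`forces_canonicalModel`), so all
axioms are forced, and the root structure is `M`.

The Henkin construction is carried out over an abstract interpretation, `Doctrine`. It is applied
twice: to realizability for the Kripke model, and to classical provability for the completeness
argument that produces `N`. -/

theorem realize_up {M : Type*} [L.Structure M] {n m : ℕ} (σ : Fin n → L.Term (Fin m)) (a : M)
    (v : Fin m → M) :
    (fun i => (up σ i).realize (Matrix.vecCons a v)) =
      Matrix.vecCons a (fun i => (σ i).realize v) := by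
  funext i
  refine Fin.cases ?_ (fun i => ?_) i
  · simp [up]
  · simp only [up, Matrix.cons_val_succ, Language.Term.realize_relabel]
    rfl

theorem realize_vecCons {M : Type*} [L.Structure M] {n m : ℕ} (t : L.Term (Fin m))
    (σ : Fin n → L.Term (Fin m)) (v : Fin m → M) :
    (fun i => (Matrix.vecCons t σ i : L.Term (Fin m)).realize v) =
      Matrix.vecCons (t.realize v) (fun i => (σ i).realize v) := by
  funext i
  refine Fin.cases ?_ (fun i => ?_) i <;> simp

theorem realize_subst {M : Type*} [L.Structure M] {n m : ℕ} (φ : Fml L n)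
    (σ : Fin n → L.Term (Fin m)) (v : Fin m → M) :
    (φ.subst σ).Realize M v ↔ φ.Realize M (fun i => (σ i).realize v) := by
  induction φ generalizing m with
  | falsum => rfl
  | eq s t => simp [subst, Realize]
  | rel R ts => simp [subst, Realize]
  | and φ ψ ih₁ ih₂ => simp [subst, Realize, ih₁, ih₂]
  | or φ ψ ih₁ ih₂ => simp [subst, Realize, ih₁, ih₂]
  | imp φ ψ ih₁ ih₂ => simp [subst, Realize, ih₁, ih₂]
  | all φ ih => simp only [subst, Realize, ih, realize_up]
  | ex φ ih => simp only [subst, Realize, ih, realize_up]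

theorem realize_inst {M : Type*} [L.Structure M] {n : ℕ} (φ : Fml L (n + 1))
    (t : L.Term (Fin n)) (v : Fin n → M) :
    (φ.inst t).Realize M v ↔ φ.Realize M (Matrix.vecCons (t.realize v) v) := by
  rw [inst, realize_subst, realize_vecCons]
  rfl

theorem realize_alls {M : Type*} [L.Structure M] {n : ℕ} (φ : Fml L n) (w : Fin 0 → M) :
    φ.alls.Realize M w ↔ ∀ v, φ.Realize M v := by
  induction n with
  | zero => exact ⟨fun h v => by rwa [Subsingleton.elim v w], fun h => h w⟩
  | succ n ih =>
    rw [alls, ih]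
    exact ⟨fun h v => by
      have := h (Matrix.vecTail v) (Matrix.vecHead v)
      rwa [Matrix.cons_head_tail] at this, fun h v a => h _⟩

theorem realize_equiv {M N : Type*} [L.Structure M] [L.Structure N] (e : M ≃[L] N) {n : ℕ}
    (φ : Fml L n) (v : Fin n → M) : φ.Realize N (fun i => e (v i)) ↔ φ.Realize M v := by
  have hc : ∀ {n : ℕ} (a : M) (v : Fin n → M),
      Matrix.vecCons (e a) (fun i => e (v i)) = fun i => e (Matrix.vecCons a v i) := by
    intro n a v
    funext i
    refine Fin.cases ?_ (fun i => ?_) i <;> simp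
  have ht : ∀ {n : ℕ} (t : L.Term (Fin n)) (v : Fin n → M),
      t.realize (fun i => e (v i)) = e (t.realize v) := fun t v =>
    Language.HomClass.realize_term e
  induction φ with
  | falsum => rfl
  | eq s t => simp [Realize, ht]
  | rel R ts => simp [Realize, ht, ← Language.StrongHomClass.map_rel e, Function.comp_def]
  | and φ ψ ih₁ ih₂ => simp [Realize, ih₁, ih₂]
  | or φ ψ ih₁ ih₂ => simp [Realize, ih₁, ih₂]
  | imp φ ψ ih₁ ih₂ => simp [Realize, ih₁, ih₂]
  | all φ ih =>
    simp only [Realize, ← ih, ← hc]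
    exact e.toEquiv.surjective.forall
  | ex φ ih =>
    simp only [Realize, ← ih, ← hc]
    exact e.toEquiv.surjective.exists

end Semantics

section Substitution

theorem term_subst_subst {α β γ : Type} (t : L.Term α) (σ : α → L.Term β) (τ : β → L.Term γ) :
    (t.subst σ).subst τ = t.subst (fun i => (σ i).subst τ) := by
  induction t with
  | var i => rfl
  | func f ts ih => simp [Language.Term.subst, ih]

theorem term_subst_var {α : Type} (t : L.Term α) : t.subst Language.Term.var = t := by
  induction t with
  | var i => rfl
  | func f ts ih => simp [Language.Term.subst, ih]

theorem term_relabel_eq_subst {α β : Type} (t : L.Term α) (g : α → β) :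
    t.relabel g = t.subst (fun i => Language.Term.var (g i)) := by
  induction t with
  | var i => rfl
  | func f ts ih => simp [Language.Term.subst, ih]

theorem up_subst_up {n m k : ℕ} (σ : Fin n → L.Term (Fin m)) (τ : Fin m → L.Term (Fin k)) :
    (fun i => (up σ i).subst (up τ)) = up (fun i => (σ i).subst τ) := by
  funext i
  refine Fin.cases rfl (fun i => ?_) i
  simp only [up, Matrix.cons_val_succ, term_relabel_eq_subst, term_subst_subst]
  rfl

theorem up_var {n : ℕ} :
    up (Language.Term.var : Fin n → L.Term (Fin n)) = Language.Term.var := by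
  funext i
  refine Fin.cases rfl (fun i => rfl) i

theorem subst_subst {n m k : ℕ} (φ : Fml L n) (σ : Fin n → L.Term (Fin m))
    (τ : Fin m → L.Term (Fin k)) :
    (φ.subst σ).subst τ = φ.subst (fun i => (σ i).subst τ) := by
  induction φ generalizing m k with
  | falsum => rfl
  | eq s t => simp [subst, term_subst_subst]
  | rel R ts => simp [subst, term_subst_subst]
  | and φ ψ ih₁ ih₂ => simp [subst, ih₁, ih₂]
  | or φ ψ ih₁ ih₂ => simp [subst, ih₁, ih₂]
  | imp φ ψ ih₁ ih₂ => simp [subst, ih₁, ih₂]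
  | all φ ih => simp only [subst, ih, up_subst_up]
  | ex φ ih => simp only [subst, ih, up_subst_up]

theorem subst_var {n : ℕ} (φ : Fml L n) : φ.subst Language.Term.var = φ := by
  induction φ with
  | falsum => rfl
  | eq s t => simp [subst, term_subst_var]
  | rel R ts => simp [subst, term_subst_var]
  | and φ ψ ih₁ ih₂ => simp [subst, ih₁, ih₂]
  | or φ ψ ih₁ ih₂ => simp [subst, ih₁, ih₂]
  | imp φ ψ ih₁ ih₂ => simp [subst, ih₁, ih₂]
  | all φ ih => simp only [subst, up_var, ih]
  | ex φ ih => simp only [subst, up_var, ih]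

theorem vecCons_subst {n m k : ℕ} (t : L.Term (Fin m)) (σ : Fin n → L.Term (Fin m))
    (τ : Fin m → L.Term (Fin k)) :
    (fun i => (Matrix.vecCons t σ i : L.Term (Fin m)).subst τ) =
      Matrix.vecCons (t.subst τ) (fun i => (σ i).subst τ) := by
  funext i
  refine Fin.cases ?_ (fun i => ?_) i <;> simp

theorem up_subst_vecCons {n m k : ℕ} (σ : Fin n → L.Term (Fin m)) (t : L.Term (Fin k))
    (τ : Fin m → L.Term (Fin k)) :
    (fun i => (up σ i).subst (Matrix.vecCons t τ)) =
      Matrix.vecCons t (fun i => (σ i).subst τ) := by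
  rw [up, vecCons_subst]
  congr 1
  funext i
  rw [term_relabel_eq_subst, term_subst_subst]
  rfl

theorem inst_subst {n m : ℕ} (φ : Fml L (n + 1)) (t : L.Term (Fin n))
    (σ : Fin n → L.Term (Fin m)) :
    (φ.inst t).subst σ = (φ.subst (up σ)).inst (t.subst σ) := by
  rw [inst, inst, subst_subst, subst_subst, vecCons_subst, up_subst_vecCons]
  congr 2
  funext i
  rw [term_subst_var]
  rfl

theorem weaken_subst {n m : ℕ} (φ : Fml L n) (σ : Fin n → L.Term (Fin m)) :
    φ.weaken.subst (up σ) = (φ.subst σ).weaken := by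
  rw [weaken, weaken, subst_subst, subst_subst]
  congr 1
  funext i
  rw [← term_relabel_eq_subst]
  rfl

theorem subst_up_inst {n m : ℕ} (φ : Fml L (n + 1)) (σ : Fin n → L.Term (Fin m))
    (t : L.Term (Fin m)) : (φ.subst (up σ)).inst t = φ.subst (Matrix.vecCons t σ) := by
  rw [inst, subst_subst, up_subst_vecCons]
  congr 2
  funext i
  exact term_subst_var _

theorem weaken_all_inst {n : ℕ} (φ : Fml L (n + 1)) :
    (φ.subst (up (fun i => Language.Term.var i.succ))).inst (Language.Term.var 0) = φ := by
  rw [subst_up_inst]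
  conv_rhs => rw [← subst_var φ]
  congr 1
  funext i
  refine Fin.cases rfl (fun i => rfl) i

theorem isQF_subst {n m : ℕ} {φ : Fml L n} (h : φ.IsQF) (σ : Fin n → L.Term (Fin m)) :
    (φ.subst σ).IsQF := by
  induction φ generalizing m with
  | falsum => trivial
  | eq s t => trivial
  | rel R ts => trivial
  | and φ ψ ih₁ ih₂ => exact ⟨ih₁ h.1 σ, ih₂ h.2 σ⟩
  | or φ ψ ih₁ ih₂ => exact ⟨ih₁ h.1 σ, ih₂ h.2 σ⟩
  | imp φ ψ ih₁ ih₂ => exact ⟨ih₁ h.1 σ, ih₂ h.2 σ⟩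
  | all φ ih => exact h.elim
  | ex φ ih => exact h.elim

end Substitution

theorem isPi2_alls {n : ℕ} {φ : Fml L n} (h : φ.IsPi2) : φ.alls.IsPi2 := by
  induction n with
  | zero => exact h
  | succ n ih => exact ih h.all

end Fml

theorem realize_tZero {M : Type*} [Lpr.Structure M] {n : ℕ} (v : Fin n → M) :
    (tZero : Lpr.Term (Fin n)).realize v =
      Language.Structure.funMap (L := Lpr) PR.zero (fun i => i.elim0) :=
  congrArg _ (funext fun i => i.elim0)

theorem realize_tSucc {M : Type*} [Lpr.Structure M] {n : ℕ} (t : Lpr.Term (Fin n))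
    (v : Fin n → M) :
    (tSucc t).realize v = Language.Structure.funMap (L := Lpr) PR.succ ![t.realize v] := by
  refine congrArg _ (funext fun i => ?_)
  rw [Subsingleton.elim i 0]
  rfl

/-! ### Forcing: monotonicity, substitution, quantifier-free and `Σ₁` formulas. -/

namespace KripkeModel

section General

variable {L : FirstOrder.Language} (K : KripkeModel.{u} L)

/-- The assignment `v`, transported to a later node. -/
def lift {k k' : K.Node} (h : k ≤ k') {n : ℕ} (v : Fin n → K.dom k) : Fin n → K.dom k' :=
  fun i => Set.inclusion (K.dom_mono h) (v i)

theorem lift_vecCons {k k' : K.Node} (h : k ≤ k') {n : ℕ} (a : K.dom k) (v : Fin n → K.dom k) :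
    K.lift h (Matrix.vecCons a v) =
      Matrix.vecCons (Set.inclusion (K.dom_mono h) a) (K.lift h v) := by
  funext i
  refine Fin.cases ?_ (fun i => ?_) i <;> simp [lift]

theorem realize_lift {k k' : K.Node} (h : k ≤ k') {n : ℕ} (t : L.Term (Fin n))
    (v : Fin n → K.dom k) :
    t.realize (K.lift h v) = Set.inclusion (K.dom_mono h) (t.realize v) := by
  induction t with
  | var i => rfl
  | func f ts ih =>
    simp only [Language.Term.realize, ih]
    exact (K.map_fun h f _).symm

theorem forces_mono {n : ℕ} (φ : Fml L n) {k k' : K.Node} (h : k ≤ k') (v : Fin n → K.dom k)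
    (hf : K.Forces φ k v) : K.Forces φ k' (K.lift h v) := by
  induction φ generalizing k k' with
  | falsum => exact hf
  | eq s t =>
    simp only [Forces] at hf ⊢
    rw [realize_lift, realize_lift, hf]
  | rel R ts =>
    simp only [Forces] at hf ⊢
    simp only [realize_lift]
    exact K.map_rel h R _ hf
  | and φ ψ ih₁ ih₂ => exact ⟨ih₁ h v hf.1, ih₂ h v hf.2⟩
  | or φ ψ ih₁ ih₂ => exact hf.imp (ih₁ h v) (ih₂ h v)
  | imp φ ψ ih₁ ih₂ => exact fun k₂ h₂ => hf k₂ (h.trans h₂)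
  | all φ ih => exact fun k₂ h₂ a => hf k₂ (h.trans h₂) a
  | ex φ ih =>
    obtain ⟨a, ha⟩ := hf
    refine ⟨Set.inclusion (K.dom_mono h) a, ?_⟩
    rw [← lift_vecCons]
    exact ih h _ ha

theorem forces_subst {n m : ℕ} (φ : Fml L n) (σ : Fin n → L.Term (Fin m)) (k : K.Node)
    (v : Fin m → K.dom k) :
    K.Forces (φ.subst σ) k v ↔ K.Forces φ k (fun i => (σ i).realize v) := by
  have hl : ∀ {n m : ℕ} (σ : Fin n → L.Term (Fin m)) {k k' : K.Node} (h : k ≤ k')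
      (v : Fin m → K.dom k),
      (fun i => (σ i).realize (K.lift h v)) = K.lift h (fun i => (σ i).realize v) :=
    fun σ _ _ h v => funext fun i => K.realize_lift h _ v
  induction φ generalizing m k with
  | falsum => rfl
  | eq s t => simp [Fml.subst, Forces]
  | rel R ts => simp [Fml.subst, Forces]
  | and φ ψ ih₁ ih₂ => simp [Fml.subst, Forces, ih₁, ih₂]
  | or φ ψ ih₁ ih₂ => simp [Fml.subst, Forces, ih₁, ih₂]
  | imp φ ψ ih₁ ih₂ =>
    simp only [Fml.subst, Forces, ih₁, ih₂]
    refine forall_congr' fun k' => forall_congr' fun h => ?_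
    change (K.Forces φ k' (fun i => (σ i).realize (K.lift h v)) →
      K.Forces ψ k' (fun i => (σ i).realize (K.lift h v))) ↔ _
    rw [hl]
    rfl
  | all φ ih =>
    simp only [Fml.subst, Forces, ih, Fml.realize_up]
    refine forall_congr' fun k' => forall_congr' fun h => forall_congr' fun a => ?_
    change K.Forces φ k' (Matrix.vecCons a (fun i => (σ i).realize (K.lift h v))) ↔ _
    rw [hl]
    rfl
  | ex φ ih => simp only [Fml.subst, Forces, ih, Fml.realize_up]

theorem forces_alls {n : ℕ} (φ : Fml L n) (k : K.Node) (w : Fin 0 → K.dom k) :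
    K.Forces φ.alls k w ↔ ∀ k', k ≤ k' → ∀ v : Fin n → K.dom k', K.Forces φ k' v := by
  induction n with
  | zero =>
    constructor
    · intro h k' hk v
      rw [Subsingleton.elim v (K.lift hk w)]
      exact K.forces_mono φ hk w h
    · exact fun h => h k le_rfl w
  | succ n ih =>
    rw [Fml.alls, ih]
    constructor
    · intro h k' hk v
      have := h k' hk (Matrix.vecTail v) k' le_rfl (Matrix.vecHead v)
      have e : Matrix.vecCons (Matrix.vecHead v) (Matrix.vecTail v) = v := Matrix.cons_head_tail v
      rw [← e]
      exact this
    · exact fun h k' hk v k₂ hk₂ a => h k₂ (hk.trans hk₂) _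

end General

variable (K : KripkeModel.{u} Lpr)

/-- Equality is the only predicate and inclusions of domains are injective, so the truth value of a
quantifier-free formula never changes along the order (`key`). An implication is then decided at the
node itself. -/
theorem forces_iff_realize_of_isQF {n : ℕ} {φ : Fml Lpr n} (hφ : φ.IsQF) (k : K.Node)
    (v : Fin n → K.dom k) : K.Forces φ k v ↔ φ.Realize (K.dom k) v := by
  have key : ∀ {n : ℕ} {φ : Fml Lpr n}, φ.IsQF → ∀ (k k' : K.Node) (h : k ≤ k')
      (v : Fin n → K.dom k), φ.Realize (K.dom k') (K.lift h v) ↔ φ.Realize (K.dom k) v := by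
    intro n φ hφ
    induction φ with
    | falsum => exact fun _ _ _ _ => Iff.rfl
    | eq s t =>
      intro k k' h v
      simp only [Fml.Realize, realize_lift]
      exact (Set.inclusion_injective _).eq_iff
    | rel R ts => exact nomatch R
    | and φ ψ ih₁ ih₂ => exact fun k k' h v => and_congr (ih₁ hφ.1 k k' h v) (ih₂ hφ.2 k k' h v)
    | or φ ψ ih₁ ih₂ => exact fun k k' h v => or_congr (ih₁ hφ.1 k k' h v) (ih₂ hφ.2 k k' h v)
    | imp φ ψ ih₁ ih₂ => exact fun k k' h v => imp_congr (ih₁ hφ.1 k k' h v) (ih₂ hφ.2 k k' h v)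
    | all φ ih => exact hφ.elim
    | ex φ ih => exact hφ.elim
  induction φ generalizing k with
  | falsum => rfl
  | eq s t => rfl
  | rel R ts => exact nomatch R
  | and φ ψ ih₁ ih₂ => exact and_congr (ih₁ hφ.1 k v) (ih₂ hφ.2 k v)
  | or φ ψ ih₁ ih₂ => exact or_congr (ih₁ hφ.1 k v) (ih₂ hφ.2 k v)
  | imp φ ψ ih₁ ih₂ =>
    constructor
    · intro h h₁
      exact (ih₂ hφ.2 k v).1 (h k le_rfl ((ih₁ hφ.1 k v).2 h₁))
    · intro h k' hk h₁
      refine (ih₂ hφ.2 k' _).2 ((key hφ.2 k k' hk v).2 (h ?_))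
      exact (key hφ.1 k k' hk v).1 ((ih₁ hφ.1 k' _).1 h₁)
  | all φ ih => exact hφ.elim
  | ex φ ih => exact hφ.elim

theorem forces_iff_realize_of_isSigma1 {n : ℕ} {φ : Fml Lpr n} (hφ : φ.IsSigma1) (k : K.Node)
    (v : Fin n → K.dom k) : K.Forces φ k v ↔ φ.Realize (K.dom k) v := by
  induction hφ with
  | qf h => exact K.forces_iff_realize_of_isQF h k v
  | ex h ih => exact exists_congr fun a => ih _

/-- Forcing of the Friedman–Gödel translation of a formula, relative to a set `B` of nodes at which
the absurdity is regarded as forced. -/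
def SForces (B : K.Node → Prop) :
    {n : ℕ} → Fml Lpr n → (k : K.Node) → (Fin n → K.dom k) → Prop
  | _, .falsum, k, _ => B k
  | _, .eq s t, k, v => s.realize v = t.realize v ∨ B k
  | _, .rel _ _, k, _ => B k
  | _, .and φ ψ, k, v => SForces B φ k v ∧ SForces B ψ k v
  | _, .or φ ψ, k, v => ∀ (k' : K.Node) (h : k ≤ k'), (∀ (k'' : K.Node) (h' : k' ≤ k''),
      (SForces B φ k'' (K.lift (h.trans h') v) ∨ SForces B ψ k'' (K.lift (h.trans h') v)) →
        B k'') → B k'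
  | _, .imp φ ψ, k, v => ∀ (k' : K.Node) (h : k ≤ k'),
      SForces B φ k' (K.lift h v) → SForces B ψ k' (K.lift h v)
  | _, .all φ, k, v => ∀ (k' : K.Node) (h : k ≤ k') (a : K.dom k'),
      SForces B φ k' (Matrix.vecCons a (K.lift h v))
  | _, .ex φ, k, v => ∀ (k' : K.Node) (h : k ≤ k'), (∀ (k'' : K.Node) (h' : k' ≤ k''),
      (∃ a, SForces B φ k'' (Matrix.vecCons a (K.lift (h.trans h') v))) → B k'') → B k'

/-! ### Soundness of the Friedman–Gödel translation, and the `Π₂` theory of the root. -/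

section SForces

variable {K} {B : K.Node → Prop}

theorem sforces_mono (hB : ∀ {k k'}, k ≤ k' → B k → B k') {n : ℕ} (φ : Fml Lpr n)
    {k k' : K.Node} (h : k ≤ k') (v : Fin n → K.dom k) (hf : K.SForces B φ k v) :
    K.SForces B φ k' (K.lift h v) := by
  induction φ generalizing k k' with
  | falsum => exact hB h hf
  | eq s t =>
    refine hf.imp (fun e => ?_) (hB h)
    rw [realize_lift, realize_lift, e]
  | rel R ts => exact hB h hf
  | and φ ψ ih₁ ih₂ => exact ⟨ih₁ h v hf.1, ih₂ h v hf.2⟩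
  | or φ ψ ih₁ ih₂ => exact fun k₂ h₂ => hf k₂ (h.trans h₂)
  | imp φ ψ ih₁ ih₂ => exact fun k₂ h₂ => hf k₂ (h.trans h₂)
  | all φ ih => exact fun k₂ h₂ a => hf k₂ (h.trans h₂) a
  | ex φ ih => exact fun k₂ h₂ => hf k₂ (h.trans h₂)

/-- Every translated formula is stable relative to `B`. -/
theorem sforces_stable (hB : ∀ {k k'}, k ≤ k' → B k → B k') {n : ℕ} (φ : Fml Lpr n)
    {k : K.Node} (v : Fin n → K.dom k)
    (hf : ∀ (k' : K.Node) (h : k ≤ k'), (∀ (k'' : K.Node) (h' : k' ≤ k''),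
      K.SForces B φ k'' (K.lift (h.trans h') v) → B k'') → B k') :
    K.SForces B φ k v := by
  induction φ generalizing k with
  | falsum => exact hf k le_rfl fun _ _ h => h
  | eq s t =>
    -- An equation between elements is decided once and for all, so no double negation is needed in
    -- its translation: if it fails here, a later node where the translation holds lies in `B`.
    by_cases e : s.realize v = t.realize v
    · exact Or.inl e
    · refine Or.inr (hf k le_rfl fun k' hk h => ?_)
      rcases h with h | h
      · rw [realize_lift, realize_lift] at h
        exact absurd (Set.inclusion_injective _ h) e
      · exact h
  | rel R ts => exact nomatch R
  | and φ ψ ih₁ ih₂ =>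
    exact ⟨ih₁ v fun k₁ h₁ H => hf k₁ h₁ fun k₂ h₂ H₂ => H k₂ h₂ H₂.1,
      ih₂ v fun k₁ h₁ H => hf k₁ h₁ fun k₂ h₂ H₂ => H k₂ h₂ H₂.2⟩
  | or φ ψ ih₁ ih₂ =>
    intro k₁ h₁ H
    exact hf k₁ h₁ fun k₂ h₂ H₂ => H₂ k₂ le_rfl fun k₃ h₃ H₃ => H k₃ (h₂.trans h₃) H₃
  | imp φ ψ ih₁ ih₂ =>
    intro k₁ h₁ H₁
    refine ih₂ _ fun k₂ h₂ H₂ => hf k₂ (h₁.trans h₂) fun k₃ h₃ H₃ => H₂ k₃ h₃ ?_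
    exact H₃ k₃ le_rfl (sforces_mono hB φ (h₂.trans h₃) _ H₁)
  | all φ ih =>
    intro k₁ h₁ a
    refine ih _ fun k₂ h₂ H₂ => hf k₂ (h₁.trans h₂) fun k₃ h₃ H₃ => H₂ k₃ h₃ ?_
    rw [lift_vecCons]
    exact H₃ k₃ le_rfl _
  | ex φ ih =>
    intro k₁ h₁ H
    exact hf k₁ h₁ fun k₂ h₂ H₂ => H₂ k₂ le_rfl fun k₃ h₃ H₃ => H k₃ (h₂.trans h₃) H₃

theorem sforces_of_mem (hB : ∀ {k k'}, k ≤ k' → B k → B k') {n : ℕ} (φ : Fml Lpr n)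
    {k : K.Node} (v : Fin n → K.dom k) (h : B k) : K.SForces B φ k v :=
  sforces_stable hB φ v fun _ h' _ => hB h' h

theorem sforces_subst {n m : ℕ} (φ : Fml Lpr n) (σ : Fin n → Lpr.Term (Fin m)) (k : K.Node)
    (v : Fin m → K.dom k) :
    K.SForces B (φ.subst σ) k v ↔ K.SForces B φ k (fun i => (σ i).realize v) := by
  have hl : ∀ {n m : ℕ} (σ : Fin n → Lpr.Term (Fin m)) {k k' : K.Node} (h : k ≤ k')
      (v : Fin m → K.dom k),
      (fun i => (σ i).realize (K.lift h v)) = K.lift h (fun i => (σ i).realize v) :=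
    fun σ _ _ h v => funext fun i => K.realize_lift h _ v
  induction φ generalizing m k with
  | falsum => rfl
  | eq s t => simp [Fml.subst, SForces]
  | rel R ts => simp [Fml.subst, SForces]
  | and φ ψ ih₁ ih₂ => simp [Fml.subst, SForces, ih₁, ih₂]
  | or φ ψ ih₁ ih₂ => simp only [Fml.subst, SForces, ih₁, ih₂, hl]
  | imp φ ψ ih₁ ih₂ => simp only [Fml.subst, SForces, ih₁, ih₂, hl]
  | all φ ih => simp only [Fml.subst, SForces, ih, Fml.realize_up, hl]
  | ex φ ih => simp only [Fml.subst, SForces, ih, Fml.realize_up, hl]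

theorem sforces_inst {n : ℕ} (φ : Fml Lpr (n + 1)) (t : Lpr.Term (Fin n)) (k : K.Node)
    (v : Fin n → K.dom k) :
    K.SForces B (φ.inst t) k v ↔ K.SForces B φ k (Matrix.vecCons (t.realize v) v) := by
  rw [Fml.inst, sforces_subst, Fml.realize_vecCons]
  rfl

theorem sforces_weaken {n : ℕ} (φ : Fml Lpr n) (k : K.Node) (a : K.dom k)
    (v : Fin n → K.dom k) :
    K.SForces B φ.weaken k (Matrix.vecCons a v) ↔ K.SForces B φ k v := by
  rw [Fml.weaken, sforces_subst]
  rfl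

/-- Intuitionistic steps are sound as for ordinary forcing; stability under double `B`-negation pays
for `dne` and for the elimination of the weakened disjunctions and existentials. -/
theorem sforces_of_provableC (hB : ∀ {k k'}, k ≤ k' → B k → B k') {T : Set (Fml Lpr 0)}
    (hT : ∀ φ ∈ T, ∀ (k : K.Node) v, K.SForces B φ k v) {n : ℕ} {φ : Fml Lpr n}
    (h : ProvableC T φ) (k : K.Node) (v : Fin n → K.dom k) : K.SForces B φ k v := by
  induction h generalizing k with
  | ax h => exact (sforces_subst _ _ k v).2 (hT _ h k _)
  | mp _ _ ih₁ ih₂ => exact ih₁ k v k le_rfl (ih₂ k _)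
  | imp_K φ ψ => exact fun k₁ h₁ H₁ k₂ h₂ _ => sforces_mono hB φ h₂ _ H₁
  | imp_S φ ψ χ =>
    intro k₁ h₁ H₁ k₂ h₂ H₂ k₃ h₃ H₃
    exact H₁ k₃ (h₂.trans h₃) H₃ k₃ le_rfl (H₂ k₃ h₃ H₃)
  | and_intro φ ψ => exact fun k₁ h₁ H₁ k₂ h₂ H₂ => ⟨sforces_mono hB φ h₂ _ H₁, H₂⟩
  | and_left φ ψ => exact fun k₁ h₁ H₁ => H₁.1
  | and_right φ ψ => exact fun k₁ h₁ H₁ => H₁.2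
  | or_inl φ ψ =>
    exact fun k₁ h₁ H₁ k₂ h₂ H₂ => H₂ k₂ le_rfl (Or.inl (sforces_mono hB φ h₂ _ H₁))
  | or_inr φ ψ =>
    exact fun k₁ h₁ H₁ k₂ h₂ H₂ => H₂ k₂ le_rfl (Or.inr (sforces_mono hB ψ h₂ _ H₁))
  | or_elim φ ψ χ =>
    intro k₁ h₁ H₁ k₂ h₂ H₂ k₃ h₃ H₃
    refine sforces_stable hB χ _ fun k₄ h₄ H₄ => H₃ k₄ h₄ fun k₅ h₅ H₅ => H₄ k₅ h₅ ?_
    rcases H₅ with H₅ | H₅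
    · exact H₁ k₅ (h₂.trans (h₃.trans (h₄.trans h₅))) H₅
    · exact H₂ k₅ (h₃.trans (h₄.trans h₅)) H₅
  | exfalso φ => exact fun k₁ h₁ H₁ => sforces_of_mem hB φ _ H₁
  | dne φ => exact fun k₁ h₁ H₁ => sforces_stable hB φ _ H₁
  | all_elim φ t =>
    intro k₁ h₁ H₁
    exact (sforces_inst φ t k₁ _).2 (H₁ k₁ le_rfl _)
  | ex_intro φ t =>
    intro k₁ h₁ H₁ k₂ h₂ H₂
    refine H₂ k₂ le_rfl ⟨_, (sforces_inst φ t k₂ _).1 (sforces_mono hB _ h₂ _ H₁)⟩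
  | all_rule _ ih =>
    intro k₁ h₁ H₁ k₂ h₂ a
    exact ih k₂ (Matrix.vecCons a (K.lift (h₁.trans h₂) v)) k₂ le_rfl
      ((sforces_weaken _ k₂ a _).2 (sforces_mono hB _ h₂ _ H₁))
  | ex_rule _ ih =>
    intro k₁ h₁ H₁
    refine sforces_stable hB _ _ fun k₂ h₂ H₂ => H₁ k₂ h₂ fun k₃ h₃ ⟨a, H₃⟩ => H₂ k₃ h₃ ?_
    exact (sforces_weaken _ k₃ a _).1
      (ih k₃ (Matrix.vecCons a (K.lift (h₁.trans (h₂.trans h₃)) v)) k₃ le_rfl H₃)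
  | nonempty =>
    intro k₁ h₁ H₁
    obtain ⟨a, ha⟩ := K.nonempty_dom k₁
    exact H₁ k₁ le_rfl ⟨⟨a, ha⟩, Or.inl rfl⟩
  | eq_refl t => exact Or.inl rfl
  | eq_subst φ s t =>
    intro k₁ h₁ H₁ k₂ h₂ H₂
    rcases H₁ with H₁ | H₁
    · rw [sforces_inst] at H₂ ⊢
      have : t.realize (K.lift h₂ (K.lift h₁ v)) = s.realize (K.lift h₂ (K.lift h₁ v)) := by
        rw [K.realize_lift h₂ t, K.realize_lift h₂ s, H₁]
      rw [this]
      exact H₂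
    · exact sforces_of_mem hB _ _ (hB h₂ H₁)

/-- Quantifier-free formulas are decidable at every node, so the double negations contribute nothing
outside `B`. -/
theorem sforces_iff_of_isQF (hB : ∀ {k k'}, k ≤ k' → B k → B k') {n : ℕ} {φ : Fml Lpr n}
    (hφ : φ.IsQF) (k : K.Node) (v : Fin n → K.dom k) :
    K.SForces B φ k v ↔ K.Forces φ k v ∨ B k := by
  induction φ generalizing k with
  | falsum => simp [SForces, Forces]
  | eq s t => rfl
  | rel R ts => exact nomatch R
  | and φ ψ ih₁ ih₂ =>
    simp only [SForces, Forces, ih₁ hφ.1, ih₂ hφ.2]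
    tauto
  | or φ ψ ih₁ ih₂ =>
    constructor
    · intro h
      by_contra! hc
      refine hc.2 (h k le_rfl fun k₁ h₁ H₁ => ?_)
      rcases H₁ with H₁ | H₁
      · rcases (ih₁ hφ.1 k₁ _).1 H₁ with H | H
        · refine absurd (Or.inl ?_) hc.1
          by_contra hn
          -- A disjunct that fails at `k` has its negation forced at `k`, so it cannot become forced
          -- at `k₁`.
          have := (K.forces_iff_realize_of_isQF (φ := φ.neg) ⟨hφ.1, trivial⟩ k v).2
            (fun h' => hn ((K.forces_iff_realize_of_isQF hφ.1 k v).2 h'))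
          exact this k₁ h₁ H
        · exact H
      · rcases (ih₂ hφ.2 k₁ _).1 H₁ with H | H
        · refine absurd (Or.inr ?_) hc.1
          by_contra hn
          have := (K.forces_iff_realize_of_isQF (φ := ψ.neg) ⟨hφ.2, trivial⟩ k v).2
            (fun h' => hn ((K.forces_iff_realize_of_isQF hφ.2 k v).2 h'))
          exact this k₁ h₁ H
        · exact H
    · rintro (h | h)
      · exact fun k₁ h₁ H₁ => H₁ k₁ le_rfl
          (h.imp (fun h => (ih₁ hφ.1 k₁ _).2 (Or.inl (K.forces_mono φ h₁ v h)))
            (fun h => (ih₂ hφ.2 k₁ _).2 (Or.inl (K.forces_mono ψ h₁ v h))))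
      · exact sforces_of_mem hB _ _ h
  | imp φ ψ ih₁ ih₂ =>
    constructor
    · intro h
      by_cases h₁ : K.Forces φ k v
      · rcases (ih₂ hφ.2 k v).1 (h k le_rfl ((ih₁ hφ.1 k v).2 (Or.inl h₁))) with H | H
        · refine Or.inl fun k₁ h₁ _ => K.forces_mono ψ h₁ v H
        · exact Or.inr H
      · refine Or.inl ((K.forces_iff_realize_of_isQF (φ := φ.imp ψ) hφ k v).2 fun h' => ?_)
        exact absurd ((K.forces_iff_realize_of_isQF hφ.1 k v).2 h') h₁
    · rintro (h | h)
      · intro k₁ h₁ H₁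
        rcases (ih₁ hφ.1 k₁ _).1 H₁ with H | H
        · exact (ih₂ hφ.2 k₁ _).2 (Or.inl (h k₁ h₁ H))
        · exact sforces_of_mem hB _ _ H
      · exact sforces_of_mem hB _ _ h
  | all φ ih => exact hφ.elim
  | ex φ ih => exact hφ.elim

theorem sforces_alls {n : ℕ} {φ : Fml Lpr n} {k : K.Node} (w : Fin 0 → K.dom k)
    (h : ∀ k', k ≤ k' → ∀ v : Fin n → K.dom k', K.SForces B φ k' v) :
    K.SForces B φ.alls k w := by
  induction n with
  | zero => exact h k le_rfl w
  | succ n ih => exact ih fun k' hk v k₂ hk₂ a => h k₂ (hk.trans hk₂) _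

/-- The translation of a formula is a formula, with the parameters `a` of a formula `A` that
defines `B`. -/
theorem exists_forces_iff_sforces {r : K.Node} (hr : K.IsRoot r) {m : ℕ} (A : Fml Lpr m)
    (a : Fin m → K.dom r) (hA : ∀ k, B k ↔ K.Forces A k (K.lift (hr k) a)) {n : ℕ}
    (φ : Fml Lpr n) {c : ℕ} (σ : Fin n → Fin c) (α : Fin m → Fin c) :
    ∃ χ : Fml Lpr c, ∀ (k : K.Node) (u : Fin c → K.dom k), (∀ i, u (α i) = K.lift (hr k) a i) →
      (K.Forces χ k u ↔ K.SForces B φ k (fun i => u (σ i))) := by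
  have base : ∀ {c : ℕ} (α : Fin m → Fin c), ∃ χ : Fml Lpr c, ∀ (k : K.Node)
      (u : Fin c → K.dom k), (∀ i, u (α i) = K.lift (hr k) a i) → (K.Forces χ k u ↔ B k) := by
    intro c α
    -- In the combined context, `α` locates the parameters of `A` and `σ` the variables of the
    -- translated formula.
    refine ⟨A.subst (fun i => Language.Term.var (α i)), fun k u hu => ?_⟩
    rw [forces_subst, hA]
    exact iff_of_eq (congrArg _ (funext hu))
  induction φ generalizing c with
  | falsum => exact base α
  | eq s t =>
    obtain ⟨χ, hχ⟩ := base α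
    refine ⟨(Fml.eq (s.relabel σ) (t.relabel σ)).or χ, fun k u hu => ?_⟩
    simp only [Forces, SForces, hχ k u hu, Language.Term.realize_relabel]
    rfl
  | rel R ts => exact nomatch R
  | and φ ψ ih₁ ih₂ =>
    obtain ⟨χ₁, h₁⟩ := ih₁ σ α
    obtain ⟨χ₂, h₂⟩ := ih₂ σ α
    refine ⟨χ₁.and χ₂, fun k u hu => ?_⟩
    simp only [Forces, SForces, h₁ k u hu, h₂ k u hu]
  | or φ ψ ih₁ ih₂ =>
    obtain ⟨χ, hχ⟩ := base α
    obtain ⟨χ₁, h₁⟩ := ih₁ σ α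
    obtain ⟨χ₂, h₂⟩ := ih₂ σ α
    refine ⟨((χ₁.or χ₂).imp χ).imp χ, fun k u hu => ?_⟩
    have hu' : ∀ k' (h : k ≤ k') i, K.lift h u (α i) = K.lift (hr k') a i :=
      fun k' h i => congrArg (Set.inclusion (K.dom_mono h)) (hu i)
    refine forall_congr' fun k₁ => forall_congr' fun l₁ => imp_congr ?_ (hχ k₁ _ (hu' _ l₁))
    refine forall_congr' fun k₂ => forall_congr' fun l₂ =>
      imp_congr ?_ (hχ k₂ _ (hu' _ (l₁.trans l₂)))
    exact or_congr (h₁ k₂ _ (hu' _ (l₁.trans l₂))) (h₂ k₂ _ (hu' _ (l₁.trans l₂)))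
  | imp φ ψ ih₁ ih₂ =>
    obtain ⟨χ₁, h₁⟩ := ih₁ σ α
    obtain ⟨χ₂, h₂⟩ := ih₂ σ α
    refine ⟨χ₁.imp χ₂, fun k u hu => ?_⟩
    have hu' : ∀ k' (h : k ≤ k') i, K.lift h u (α i) = K.lift (hr k') a i :=
      fun k' h i => congrArg (Set.inclusion (K.dom_mono h)) (hu i)
    exact forall_congr' fun k₁ => forall_congr' fun l₁ =>
      imp_congr (h₁ k₁ _ (hu' _ l₁)) (h₂ k₁ _ (hu' _ l₁))
  | all φ ih =>
    obtain ⟨χ, h⟩ := ih (Matrix.vecCons 0 fun i => (σ i).succ) fun i => (α i).succ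
    refine ⟨χ.all, fun k u hu => ?_⟩
    have hu' : ∀ k' (h : k ≤ k') i, K.lift h u (α i) = K.lift (hr k') a i :=
      fun k' h i => congrArg (Set.inclusion (K.dom_mono h)) (hu i)
    refine forall_congr' fun k₁ => forall_congr' fun l₁ => forall_congr' fun b => ?_
    refine (h k₁ (Matrix.vecCons b (K.lift l₁ u)) fun i => hu' _ l₁ i).trans ?_
    refine iff_of_eq (congrArg _ (funext fun i => ?_))
    refine Fin.cases rfl (fun i => rfl) i
  | ex φ ih =>
    obtain ⟨χ, hχ⟩ := base α
    obtain ⟨χ₁, h⟩ := ih (Matrix.vecCons 0 fun i => (σ i).succ) fun i => (α i).succ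
    refine ⟨(χ₁.ex.imp χ).imp χ, fun k u hu => ?_⟩
    have hu' : ∀ k' (h : k ≤ k') i, K.lift h u (α i) = K.lift (hr k') a i :=
      fun k' h i => congrArg (Set.inclusion (K.dom_mono h)) (hu i)
    refine forall_congr' fun k₁ => forall_congr' fun l₁ => imp_congr ?_ (hχ k₁ _ (hu' _ l₁))
    refine forall_congr' fun k₂ => forall_congr' fun l₂ =>
      imp_congr ?_ (hχ k₂ _ (hu' _ (l₁.trans l₂)))
    refine exists_congr fun b => ?_
    refine (h k₂ (Matrix.vecCons b (K.lift (l₁.trans l₂) u)) fun i => hu' _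
      (l₁.trans l₂) i).trans ?_
    refine iff_of_eq (congrArg _ (funext fun i => ?_))
    refine Fin.cases rfl (fun i => rfl) i

/-- Universal axioms with a quantifier-free matrix are their own translation up to `B`. Translated
induction for `φ` is ordinary induction for the formula that expresses the translation of `φ`. -/
theorem sforces_arithAxioms (hK : K.ForcesTheory HA) {r : K.Node} (hr : K.IsRoot r) {m : ℕ}
    (A : Fml Lpr m) (a : Fin m → K.dom r) (hA : ∀ k, B k ↔ K.Forces A k (K.lift (hr k) a))
    {φ : Fml Lpr 0} (hφ : φ ∈ PA) (k : K.Node) (v : Fin 0 → K.dom k) : K.SForces B φ k v := by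
  have hB : ∀ {k k'}, k ≤ k' → B k → B k' := fun {k k'} h hk =>
    (hA k').2 (K.forces_mono A h _ ((hA k).1 hk))
  have hqf : ∀ {n : ℕ} (θ : Fml Lpr n), θ.IsQF → θ.alls ∈ HA → K.SForces B θ.alls k v :=
    fun θ h₁ h₂ => sforces_alls v fun k' hk w => (sforces_iff_of_isQF hB h₁ k' w).2
      (Or.inl ((K.forces_alls θ k _).1 (hK _ h₂ k) k' hk w))
  have hφ' : φ ∈ HA := hφ
  rcases hφ with h | h | ⟨n, φ, rfl⟩
  · cases h with
    | succ_ne_zero => exact hqf _ ⟨trivial, trivial⟩ hφ'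
    | succ_inj => exact hqf _ ⟨trivial, trivial⟩ hφ'
    | zero_or_succ =>
      refine sforces_alls v fun k₁ h₁ w k₂ h₂ H₂ => H₂ k₂ le_rfl ?_
      rcases (K.forces_alls _ k _).1 (hK _ hφ' k) k₂ (h₁.trans h₂) (K.lift h₂ w) with h | ⟨b, hb⟩
      · exact Or.inl (Or.inl h)
      · refine Or.inr fun k₃ h₃ H₃ => H₃ k₃ le_rfl ⟨Set.inclusion (K.dom_mono h₃) b, Or.inl ?_⟩
        have := K.forces_mono _ h₃ _ hb
        rw [lift_vecCons] at this
        exact this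
    | add_zero => exact hqf _ trivial hφ'
    | add_succ => exact hqf _ trivial hφ'
    | mul_zero => exact hqf _ trivial hφ'
    | mul_succ => exact hqf _ trivial hφ'
  · cases h with
    | proj i => exact hqf _ trivial hφ'
    | comp f g => exact hqf _ trivial hφ'
    | prec_zero f g => exact hqf _ trivial hφ'
    | prec_succ f g => exact hqf _ trivial hφ'
  · refine sforces_alls v fun k₁ h₁ w k₂ h₂ H k₃ h₃ b => ?_
    -- Context of `χ`: the induction variable, then the `n` side variables of `φ`, then the `m`
    -- parameters of `A`.
    obtain ⟨χ, hχ⟩ := exists_forces_iff_sforces hr A a hA φ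
      (c := n + m + 1) (Matrix.vecCons 0 fun i => (Fin.castAdd m i).succ)
      (fun i => (Fin.natAdd n i).succ)
    have hu : ∀ (k' : K.Node) (h : k₂ ≤ k') (b : K.dom k'),
        K.Forces χ k' (Matrix.vecCons b (K.lift h (Fin.append (K.lift h₂ w) (K.lift (hr k₂) a)))) ↔
          K.SForces B φ k' (Matrix.vecCons b (K.lift h (K.lift h₂ w))) := by
      intro k' h b
      refine (hχ k' _ fun i => ?_).trans (iff_of_eq (congrArg _ (funext fun i => ?_)))
      · simp only [Matrix.cons_val_succ, lift, Fin.append_right]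
      · refine Fin.cases rfl (fun i => ?_) i
        simp only [Matrix.cons_val_succ, lift, Fin.append_left]
    have hi := (K.forces_alls _ k₂ _).1 (hK (indAxiom χ) (Or.inr (Or.inr ⟨_, χ, rfl⟩)) k₂)
      k₂ le_rfl (Fin.append (K.lift h₂ w) (K.lift (hr k₂) a)) k₂ le_rfl ?_ k₃ h₃ b
    · exact (hu k₃ h₃ b).1 hi
    · constructor
      · rw [Fml.inst, forces_subst, Fml.realize_vecCons]
        refine (hu k₂ le_rfl _).2 ?_
        have := (sforces_inst φ tZero k₂ _).1 H.1
        rw [realize_tZero] at this ⊢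
        exact this
      · intro k₄ h₄ b k₅ h₅ H₅
        change K.Forces _ k₅ (K.lift h₅ (Matrix.vecCons b (K.lift h₄ _))) at H₅
        change K.Forces _ k₅ (K.lift h₅ (Matrix.vecCons b (K.lift h₄ _)))
        rw [lift_vecCons] at H₅ ⊢
        have h2 := (hu k₅ (h₄.trans h₅) _).1 H₅
        have h3 := H.2 k₄ h₄ b k₅ h₅ (by rw [lift_vecCons]; exact h2)
        rw [lift_vecCons, sforces_subst, Fml.realize_vecCons, realize_tSucc] at h3
        rw [forces_subst, Fml.realize_vecCons, realize_tSucc]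
        exact (hu k₅ (h₄.trans h₅) _).2 h3

/-- Friedman's trick: once `B` contains every later node that forces `φ`, the outer double negations
of the translation strip off one by one and end in `B`. -/
theorem mem_of_sforces_isSigma1 (hB : ∀ {k k'}, k ≤ k' → B k → B k') {n : ℕ} {φ : Fml Lpr n}
    (hφ : φ.IsSigma1) (k : K.Node) (v : Fin n → K.dom k)
    (h : ∀ (k' : K.Node) (hk : k ≤ k'), K.Forces φ k' (K.lift hk v) → B k')
    (hs : K.SForces B φ k v) : B k := by
  induction hφ generalizing k with
  | qf hq => exact ((sforces_iff_of_isQF hB hq k v).1 hs).elim (h k le_rfl) id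
  | ex hq ih =>
    refine hs k le_rfl fun k₁ h₁ ⟨b, hb⟩ => ih k₁ _ (fun k₂ h₂ H₂ => ?_) hb
    rw [lift_vecCons] at H₂
    exact h k₂ (h₁.trans h₂) ⟨_, H₂⟩

end SForces

theorem realize_root_of_isPi2 (hK : K.ForcesTheory HA) {r : K.Node} (hr : K.IsRoot r)
    {φ : Fml Lpr 0} (hφ : φ ∈ ThPi2 PA) (v : Fin 0 → K.dom r) : φ.Realize (K.dom r) v := by
  have key : ∀ {n : ℕ} {φ : Fml Lpr n}, φ.IsPi2 → ∀ v : Fin n → K.dom r,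
      -- All definable `B` are kept available until the universal quantifiers have been
      -- instantiated, since the right choice, the nodes forcing the remaining `Σ₁` formula, depends
      -- on the instances.
      (∀ (B : K.Node → Prop) (m : ℕ) (A : Fml Lpr m) (a : Fin m → K.dom r),
        (∀ k, B k ↔ K.Forces A k (K.lift (hr k) a)) → K.SForces B φ r v) →
      φ.Realize (K.dom r) v := by
    intro n φ h
    induction h with
    | @sigma n φ h =>
      intro v H
      rw [← K.forces_iff_realize_of_isSigma1 h]
      exact mem_of_sforces_isSigma1 (B := fun k => K.Forces φ k (K.lift (hr k) v))
        (fun h hk => K.forces_mono φ h _ hk) h r v (fun k hk h => h)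
        (H _ n φ v fun k => Iff.rfl)
    | all h ih => exact fun v H b => ih _ fun B m A a hA => H B m A a hA r le_rfl b
  refine key hφ.1 v fun B m A a hA => ?_
  refine sforces_of_provableC (fun {k k'} h hk => ?_)
    (fun ψ hψ k v => sforces_arithAxioms hK hr A a hA hψ k v) hφ.2 r v
  exact (hA k').2 (K.forces_mono A h _ ((hA k).1 hk))

end KripkeModel

/-! ### Models of Peano arithmetic -/

/-- A classical model of Peano arithmetic. -/
class PAModel (N : Type*) [Lpr.Structure N] : Prop where
  models : ModelsTheory N PA

/-- The value of a primitive recursive function in a structure. -/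
def PR.fn {N : Type*} [Lpr.Structure N] {n : ℕ} (f : PR n) (v : Fin n → N) : N :=
  Language.Structure.funMap (L := Lpr) f v

theorem PR.realize_app {N : Type*} [Lpr.Structure N] {n : ℕ} {α : Type} (f : PR n)
    (ts : Fin n → Lpr.Term α) (v : α → N) :
    (f.app ts).realize v = f.fn (fun i => (ts i).realize v) := rfl

namespace PAModel

/-! ### Definability with parameters, arranged for instance search. -/

section Definability

variable {N : Type u} [Lpr.Structure N]

/-- Functions of an environment that are given by a term with parameters. -/
class DTerm (F : (ℕ → N) → N) : Prop where
  exists_term : ∃ (n : ℕ) (t : Lpr.Term (Fin n)) (c : Fin n → ℕ ⊕ N),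
    ∀ v, F v = t.realize (fun i => Sum.elim v id (c i))

/-- Predicates on environments that are definable with parameters. -/
class Dfn (P : (ℕ → N) → Prop) : Prop where
  exists_fml : ∃ (n : ℕ) (φ : Fml Lpr n) (c : Fin n → ℕ ⊕ N),
    ∀ v, P v ↔ φ.Realize N (fun i => Sum.elim v id (c i))

instance DTerm.const (b : N) : DTerm (fun _ => b) :=
  ⟨1, Language.Term.var 0, fun _ => Sum.inr b, fun _ => rfl⟩

instance DTerm.var (k : ℕ) : DTerm (fun v : ℕ → N => v k) :=
  ⟨1, Language.Term.var 0, fun _ => Sum.inl k, fun _ => rfl⟩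

theorem DTerm.exists_common {m : ℕ} (F : Fin m → (ℕ → N) → N) (hF : ∀ i, DTerm (F i)) :
    ∃ (n : ℕ) (t : Fin m → Lpr.Term (Fin n)) (c : Fin n → ℕ ⊕ N),
      ∀ i v, F i v = (t i).realize (fun i => Sum.elim v id (c i)) := by
  induction m with
  | zero => exact ⟨0, fun i => i.elim0, fun i => i.elim0, fun i => i.elim0⟩
  | succ m ih =>
    obtain ⟨n₁, t₁, c₁, h₁⟩ := ih (fun i => F i.succ) fun i => hF _
    obtain ⟨n₂, t₂, c₂, h₂⟩ := (hF 0).exists_term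
    refine ⟨n₁ + n₂, Matrix.vecCons (t₂.relabel (Fin.natAdd n₁))
      (fun i => (t₁ i).relabel (Fin.castAdd n₂)), Fin.append c₁ c₂, fun i v => ?_⟩
    refine Fin.cases ?_ (fun i => ?_) i
    · simp [h₂, Function.comp_def]
    · simp [h₁, Function.comp_def]

theorem DTerm.fn {m : ℕ} (f : PR m) (F : Fin m → (ℕ → N) → N) (hF : ∀ i, DTerm (F i)) :
    DTerm (fun v => f.fn (fun i => F i v)) := by
  obtain ⟨n, t, c, h⟩ := DTerm.exists_common F hF
  exact ⟨n, f.app t, c, fun v => by simp only [PR.realize_app, h]⟩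

instance DTerm.fn1 (f : PR 1) (F : (ℕ → N) → N) [hF : DTerm F] :
    DTerm (fun v => f.fn ![F v]) := by
  convert DTerm.fn f ![F] (by intro i; fin_cases i; exact hF) using 3 with v
  funext i; fin_cases i; rfl

instance DTerm.fn2 (f : PR 2) (F G : (ℕ → N) → N) [hF : DTerm F] [hG : DTerm G] :
    DTerm (fun v => f.fn ![F v, G v]) := by
  convert DTerm.fn f ![F, G] (by intro i; fin_cases i; exacts [hF, hG]) using 3 with v
  funext i; fin_cases i <;> rfl

instance DTerm.fn3 (f : PR 3) (F G H : (ℕ → N) → N) [hF : DTerm F] [hG : DTerm G]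
    [hH : DTerm H] : DTerm (fun v => f.fn ![F v, G v, H v]) := by
  convert DTerm.fn f ![F, G, H] (by intro i; fin_cases i; exacts [hF, hG, hH]) using 3 with v
  funext i; fin_cases i <;> rfl

instance Dfn.eq (F G : (ℕ → N) → N) [hF : DTerm F] [hG : DTerm G] :
    Dfn (fun v => F v = G v) := by
  obtain ⟨n, t, c, h⟩ := DTerm.exists_common ![F, G] (by intro i; fin_cases i; exacts [hF, hG])
  refine ⟨n, Fml.eq (t 0) (t 1), c, fun v => ?_⟩
  have h₀ := h 0 v
  have h₁ := h 1 v
  simp only [Matrix.cons_val_zero, Matrix.cons_val_one] at h₀ h₁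
  rw [h₀, h₁]
  rfl

theorem Dfn.congr {P Q : (ℕ → N) → Prop} (h : ∀ v, P v ↔ Q v) [hQ : Dfn Q] : Dfn P := by
  obtain ⟨n, φ, c, hφ⟩ := hQ.exists_fml
  exact ⟨n, φ, c, fun v => (h v).trans (hφ v)⟩

theorem Dfn.exists_common {P Q : (ℕ → N) → Prop} (hP : Dfn P) (hQ : Dfn Q) :
    ∃ (n : ℕ) (φ ψ : Fml Lpr n) (c : Fin n → ℕ ⊕ N),
      (∀ v, P v ↔ φ.Realize N (fun i => Sum.elim v id (c i))) ∧
      ∀ v, Q v ↔ ψ.Realize N (fun i => Sum.elim v id (c i)) := by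
  obtain ⟨n₁, φ₁, c₁, h₁⟩ := hP.exists_fml
  obtain ⟨n₂, φ₂, c₂, h₂⟩ := hQ.exists_fml
  refine ⟨n₁ + n₂, φ₁.subst (fun i => Language.Term.var (Fin.castAdd n₂ i)),
    φ₂.subst (fun i => Language.Term.var (Fin.natAdd n₁ i)), Fin.append c₁ c₂, ?_, ?_⟩
  · intro v
    simp [h₁, Fml.realize_subst]
  · intro v
    simp [h₂, Fml.realize_subst]

instance Dfn.and (P Q : (ℕ → N) → Prop) [hP : Dfn P] [hQ : Dfn Q] :
    Dfn (fun v => P v ∧ Q v) := by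
  obtain ⟨n, φ, ψ, c, h₁, h₂⟩ := Dfn.exists_common hP hQ
  exact ⟨n, φ.and ψ, c, fun v => and_congr (h₁ v) (h₂ v)⟩

instance Dfn.or (P Q : (ℕ → N) → Prop) [hP : Dfn P] [hQ : Dfn Q] :
    Dfn (fun v => P v ∨ Q v) := by
  obtain ⟨n, φ, ψ, c, h₁, h₂⟩ := Dfn.exists_common hP hQ
  exact ⟨n, φ.or ψ, c, fun v => or_congr (h₁ v) (h₂ v)⟩

instance Dfn.imp (P Q : (ℕ → N) → Prop) [hP : Dfn P] [hQ : Dfn Q] :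
    Dfn (fun v => P v → Q v) := by
  obtain ⟨n, φ, ψ, c, h₁, h₂⟩ := Dfn.exists_common hP hQ
  exact ⟨n, φ.imp ψ, c, fun v => imp_congr (h₁ v) (h₂ v)⟩

instance Dfn.false : Dfn (fun _ : ℕ → N => False) :=
  ⟨0, Fml.falsum, fun i => i.elim0, fun _ => Iff.rfl⟩

/-- The quantified variable is entry `0` of the environment. Every occurrence of it among the
variables of the formula is merged into the new bound variable, and the other entries move down by
one. -/
theorem Dfn.exists_bound {P : (ℕ → N) → Prop} (hP : Dfn P) :
    ∃ (n : ℕ) (φ : Fml Lpr (n + 1)) (c : Fin n → ℕ ⊕ N), ∀ (a : N) (v : ℕ → N),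
      P (fun i => Nat.casesOn i a v) ↔
        φ.Realize N (Matrix.vecCons a (fun i => Sum.elim v id (c i))) := by
  classical
  obtain ⟨n, φ, c, h⟩ := hP.exists_fml
  refine ⟨n, φ.subst (fun i => if c i = Sum.inl 0 then Language.Term.var 0 else
    Language.Term.var i.succ), fun i => Sum.map Nat.pred id (c i), fun a v => ?_⟩
  rw [h, Fml.realize_subst]
  refine iff_of_eq (congrArg _ (funext fun i => ?_))
  rcases hc : c i with k | b
  · cases k with
    | zero => simp
    | succ k => simp [hc]
  · simp [hc]

instance Dfn.all (P : N → (ℕ → N) → Prop) [hP : Dfn (fun v => P (v 0) (fun i => v (i + 1)))] :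
    Dfn (fun v => ∀ a, P a v) := by
  obtain ⟨n, φ, c, h⟩ := hP.exists_bound
  exact ⟨n, φ.all, c, fun v => forall_congr' fun a => h a v⟩

instance Dfn.ex (P : N → (ℕ → N) → Prop) [hP : Dfn (fun v => P (v 0) (fun i => v (i + 1)))] :
    Dfn (fun v => ∃ a, P a v) := by
  obtain ⟨n, φ, c, h⟩ := hP.exists_bound
  exact ⟨n, φ.ex, c, fun v => exists_congr fun a => h a v⟩

instance Dfn.not (P : (ℕ → N) → Prop) [hP : Dfn P] : Dfn (fun v => ¬ P v) := Dfn.imp P _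

end Definability

/-! ### Arithmetic in a model of `PA`: order, truncated subtraction, Cantor pairing. -/

section Arithmetic

variable {N : Type u} [Lpr.Structure N]

scoped instance : Zero N := ⟨PR.zero.fn fun i => i.elim0⟩
scoped instance : One N := ⟨PR.succ.fn ![0]⟩
scoped instance : Add N := ⟨fun a b => PR.add.fn ![a, b]⟩
scoped instance : Sub N := ⟨fun a b => PR.sub.fn ![a, b]⟩

theorem add_def (a b : N) : a + b = PR.add.fn ![a, b] := rfl
theorem sub_def (a b : N) : a - b = PR.sub.fn ![a, b] := rfl

theorem fn_zero (v : Fin 0 → N) : PR.zero.fn v = 0 :=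
  congrArg _ (funext fun i => i.elim0)

instance DTerm.add (F G : (ℕ → N) → N) [DTerm F] [DTerm G] : DTerm (fun v => F v + G v) :=
  DTerm.fn2 PR.add F G

instance DTerm.sub (F G : (ℕ → N) → N) [DTerm F] [DTerm G] : DTerm (fun v => F v - G v) :=
  DTerm.fn2 PR.sub F G

/-- The predecessor, with value `0` at `0`. -/
def pred (a : N) : N := PR.pred.fn ![a]

/-- The triangular number `0 + 1 + ⋯ + a`. -/
def tri (a : N) : N := PR.tri.fn ![a]

/-- The largest `r` with `tri r ≤ a`. -/
def triRoot (a : N) : N := PR.triRoot.fn ![a]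

/-- The Cantor pairing function. -/
def pr (a b : N) : N := PR.pair.fn ![a, b]

/-- First projection of the pairing function. -/
def fst (a : N) : N := PR.fst.fn ![a]

/-- Second projection of the pairing function. -/
def snd (a : N) : N := PR.snd.fn ![a]

instance DTerm.tri (F : (ℕ → N) → N) [DTerm F] : DTerm (fun v => tri (F v)) :=
  DTerm.fn1 PR.tri F

instance DTerm.triRoot (F : (ℕ → N) → N) [DTerm F] : DTerm (fun v => triRoot (F v)) :=
  DTerm.fn1 PR.triRoot F

instance DTerm.fst (F : (ℕ → N) → N) [DTerm F] : DTerm (fun v => fst (F v)) :=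
  DTerm.fn1 PR.fst F

instance DTerm.snd (F : (ℕ → N) → N) [DTerm F] : DTerm (fun v => snd (F v)) :=
  DTerm.fn1 PR.snd F

instance DTerm.pr (F G : (ℕ → N) → N) [DTerm F] [DTerm G] : DTerm (fun v => pr (F v) (G v)) :=
  DTerm.fn2 PR.pair F G

variable [PAModel N]

theorem realize_of_mem {n : ℕ} {φ : Fml Lpr n} (h : φ.alls ∈ PA) (v : Fin n → N) :
    φ.Realize N v :=
  (Fml.realize_alls φ _).1 (PAModel.models (N := N) _ h) v

theorem fn_proj {n : ℕ} (i : Fin n) (v : Fin n → N) : (PR.proj i).fn v = v i :=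
  realize_of_mem (Or.inr (Or.inl (AxPR.proj i))) v

theorem fn_comp {m n : ℕ} (f : PR m) (g : Fin m → PR n) (v : Fin n → N) :
    (PR.comp f g).fn v = f.fn (fun j => (g j).fn v) :=
  realize_of_mem (Or.inr (Or.inl (AxPR.comp f g))) v

theorem fn_c1 {n : ℕ} (f : PR 1) (a : PR n) (v : Fin n → N) :
    (PR.c1 f a).fn v = f.fn ![a.fn v] := by
  rw [PR.c1, fn_comp]
  congr 1; funext i; fin_cases i; rfl

theorem fn_c2 {n : ℕ} (f : PR 2) (a b : PR n) (v : Fin n → N) :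
    (PR.c2 f a b).fn v = f.fn ![a.fn v, b.fn v] := by
  rw [PR.c2, fn_comp]
  congr 1; funext i; fin_cases i <;> rfl

theorem fn_c3 {n : ℕ} (f : PR 3) (a b c : PR n) (v : Fin n → N) :
    (PR.c3 f a b c).fn v = f.fn ![a.fn v, b.fn v, c.fn v] := by
  rw [PR.c3, fn_comp]
  congr 1; funext i; fin_cases i <;> rfl

theorem fn_zeroN {n : ℕ} (v : Fin n → N) : (PR.zeroN : PR n).fn v = 0 := by
  rw [PR.zeroN, fn_comp, fn_zero]

theorem fn_prec_zero {n : ℕ} (f : PR n) (g : PR (n + 2)) (v : Fin n → N) :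
    (PR.prec f g).fn (Matrix.vecCons 0 v) = f.fn v := by
  have := realize_of_mem (Or.inr (Or.inl (AxPR.prec_zero f g))) v
  simp only [Fml.Realize, PR.realize_app, Fml.realize_vecCons, realize_tZero] at this
  exact this

theorem fn_prec_succ' {n : ℕ} (f : PR n) (g : PR (n + 2)) (a : N) (v : Fin n → N) :
    (PR.prec f g).fn (Matrix.vecCons (PR.succ.fn ![a]) v) =
      g.fn (Matrix.vecCons a (Matrix.vecCons ((PR.prec f g).fn (Matrix.vecCons a v)) v)) := by
  have := realize_of_mem (Or.inr (Or.inl (AxPR.prec_succ f g))) (Matrix.vecCons a v)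
  simp only [Fml.Realize, PR.realize_app, Fml.realize_vecCons, realize_tSucc] at this
  exact this

theorem add_zero' (a : N) : a + 0 = a := by
  rw [add_def, PR.add, fn_c2, fn_proj, fn_proj]
  exact (fn_prec_zero _ _ ![a]).trans (fn_proj _ _)

theorem add_succ' (a b : N) : a + PR.succ.fn ![b] = PR.succ.fn ![a + b] := by
  rw [add_def, add_def, PR.add, fn_c2, fn_proj, fn_proj, fn_c2, fn_proj, fn_proj]
  refine (fn_prec_succ' _ _ b ![a]).trans ?_
  rw [fn_c1, fn_proj]
  rfl

theorem succ_eq (a : N) : PR.succ.fn ![a] = a + 1 := by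
  have : (1 : N) = PR.succ.fn ![0] := rfl
  rw [this, add_succ', add_zero']

theorem fn_prec_succ {n : ℕ} (f : PR n) (g : PR (n + 2)) (a : N) (v : Fin n → N) :
    (PR.prec f g).fn (Matrix.vecCons (a + 1) v) =
      g.fn (Matrix.vecCons a (Matrix.vecCons ((PR.prec f g).fn (Matrix.vecCons a v)) v)) := by
  rw [← succ_eq, fn_prec_succ']

theorem add_succ (a b : N) : a + (b + 1) = (a + b) + 1 := by
  rw [← succ_eq, ← succ_eq, add_succ']

theorem succ_ne_zero (a : N) : a + 1 ≠ 0 := by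
  have := realize_of_mem (Or.inl AxQ.succ_ne_zero) ![a]
  simp only [Fml.neg, Fml.Realize, realize_tZero, realize_tSucc] at this
  rw [← succ_eq]
  exact this

theorem succ_inj {a b : N} (h : a + 1 = b + 1) : a = b := by
  have := realize_of_mem (Or.inl AxQ.succ_inj) ![a, b]
  simp only [Fml.Realize, realize_tSucc] at this
  rw [← succ_eq, ← succ_eq] at h
  exact this h

theorem zero_or_succ (a : N) : a = 0 ∨ ∃ b, a = b + 1 := by
  have := realize_of_mem (Or.inl AxQ.zero_or_succ) ![a]
  simp only [Fml.Realize, realize_tSucc, realize_tZero] at this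
  refine this.imp id fun ⟨b, hb⟩ => ⟨b, ?_⟩
  rw [← succ_eq]
  exact hb

/-- The form in which the induction schema is used throughout; the definability side condition is
left to instance search. -/
theorem induct {P : N → Prop} [hP : Dfn (fun v => P (v 0))] (h₀ : P 0)
    (hs : ∀ a, P a → P (a + 1)) (a : N) : P a := by
  obtain ⟨n, φ, c, h⟩ := hP.exists_bound
  have e : ∀ a, P a ↔ φ.Realize N (Matrix.vecCons a fun i => Sum.elim (fun _ => 0) id (c i)) :=
    fun a => h a fun _ => 0
  have := realize_of_mem (Or.inr (Or.inr ⟨n, φ, rfl⟩))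
    (fun i => Sum.elim (fun _ => (0 : N)) id (c i))
  simp only [Fml.Realize, Fml.realize_inst, realize_tZero, Fml.realize_subst, Fml.realize_vecCons,
    realize_tSucc] at this
  refine (e a).2 (this ⟨(e 0).1 h₀, fun b hb => ?_⟩ a)
  have := (e _).1 (hs b ((e b).2 hb))
  rw [← succ_eq] at this
  exact this

theorem zero_add' (a : N) : 0 + a = a :=
  induct (P := fun a : N => 0 + a = a) (add_zero' 0) (fun a h => by rw [add_succ, h]) a

theorem succ_add (a b : N) : (a + 1) + b = (a + b) + 1 :=
  induct (P := fun b => (a + 1) + b = (a + b) + 1) (by rw [add_zero', add_zero'])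
    (fun b h => by rw [add_succ, h, add_succ]) b

theorem add_comm' (a b : N) : a + b = b + a :=
  induct (P := fun b => a + b = b + a) (by rw [add_zero', zero_add'])
    (fun b h => by rw [add_succ, h, succ_add]) b

theorem add_assoc' (a b c : N) : a + b + c = a + (b + c) :=
  induct (P := fun c => a + b + c = a + (b + c)) (by rw [add_zero', add_zero'])
    (fun c h => by rw [add_succ, h, add_succ, add_succ]) c

theorem add_right_cancel' {a b c : N} : a + c = b + c → a = b :=
  induct (P := fun c => a + c = b + c → a = b) (by rw [add_zero', add_zero']; exact id)
    (fun c h h' => h (succ_inj (by rwa [add_succ, add_succ] at h'))) c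

theorem eq_zero_of_add {a b : N} (h : a + b = 0) : b = 0 := by
  rcases zero_or_succ b with rfl | ⟨c, rfl⟩
  · rfl
  · rw [add_succ] at h
    exact absurd h (succ_ne_zero _)

scoped instance : AddCancelCommMonoid N where
  add_assoc := add_assoc'
  zero_add := zero_add'
  add_zero := add_zero'
  add_comm := add_comm'
  add_left_cancel a b c h := add_right_cancel' (c := a) (by rwa [add_comm', add_comm' c a])
  nsmul := nsmulRec

scoped instance : PartialOrder N where
  le a b := ∃ c, b = a + c
  le_refl a := ⟨0, (add_zero a).symm⟩
  le_trans a b c := by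
    rintro ⟨d, rfl⟩ ⟨e, rfl⟩
    exact ⟨d + e, add_assoc _ _ _⟩
  le_antisymm a b := by
    rintro ⟨d, rfl⟩ ⟨e, h⟩
    rw [add_assoc, left_eq_add] at h
    rw [add_comm] at h
    rw [eq_zero_of_add h, add_zero]

theorem le_total' (a b : N) : a ≤ b ∨ b ≤ a := by
  refine induct (P := fun b => (∃ c, b = a + c) ∨ (∃ c, a = b + c)) (Or.inr ⟨a, (zero_add a).symm⟩)
    (fun b h => ?_) b
  rcases h with ⟨c, rfl⟩ | ⟨c, rfl⟩
  · exact Or.inl ⟨c + 1, add_assoc _ _ _⟩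
  · rcases zero_or_succ c with rfl | ⟨d, rfl⟩
    · exact Or.inl ⟨1, by rw [add_zero]⟩
    · exact Or.inr ⟨d, by rw [add_assoc, add_comm 1 d]⟩

noncomputable scoped instance : LinearOrder N where
  le_total := le_total'
  toDecidableLE := Classical.decRel _

scoped instance : CanonicallyOrderedAdd N where
  exists_add_of_le h := h
  le_add_self _ b := ⟨b, add_comm _ _⟩
  le_self_add _ b := ⟨b, rfl⟩

scoped instance : IsOrderedCancelAddMonoid N where
  add_le_add_left a b h c := by
    obtain ⟨d, rfl⟩ := h
    exact ⟨d, add_right_comm _ _ _⟩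
  le_of_add_le_add_left a b c h := by
    obtain ⟨d, h⟩ := h
    rw [add_assoc] at h
    exact ⟨d, add_left_cancel h⟩

theorem lt_iff_succ_le {a b : N} : a < b ↔ a + 1 ≤ b := by
  constructor
  · intro h
    obtain ⟨c, rfl⟩ := h.le
    rcases zero_or_succ c with rfl | ⟨d, rfl⟩
    · rw [add_zero] at h
      exact absurd h (lt_irrefl _)
    · exact ⟨d, by rw [add_assoc, add_comm 1 d]⟩
  · intro h
    refine lt_of_le_of_ne ((le_self_add).trans h) ?_
    rintro rfl
    obtain ⟨c, hc⟩ := h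
    rw [add_assoc, left_eq_add, add_comm] at hc
    exact succ_ne_zero _ hc

theorem lt_succ_iff {a b : N} : a < b + 1 ↔ a ≤ b := by
  rw [lt_iff_succ_le, add_le_add_iff_right]

theorem pos_iff_exists {a : N} : a ≠ 0 ↔ ∃ b, a = b + 1 := by
  constructor
  · intro h
    exact (zero_or_succ a).resolve_left h
  · rintro ⟨b, rfl⟩
    exact succ_ne_zero b

theorem pred_zero : pred (0 : N) = 0 := by
  rw [pred, PR.pred]
  exact (fn_prec_zero _ _ ![]).trans (fn_zero _)

theorem pred_succ (a : N) : pred (a + 1) = a := by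
  rw [pred, PR.pred]
  exact (fn_prec_succ _ _ a ![]).trans (fn_proj _ _)

theorem sub_zero' (a : N) : a - 0 = a := by
  rw [sub_def, PR.sub, fn_c2, fn_proj, fn_proj]
  exact (fn_prec_zero _ _ ![a]).trans (fn_proj _ _)

theorem sub_succ (a b : N) : a - (b + 1) = pred (a - b) := by
  rw [sub_def, sub_def, PR.sub, fn_c2, fn_proj, fn_proj, fn_c2, fn_proj, fn_proj]
  refine (fn_prec_succ _ _ b ![a]).trans ?_
  rw [fn_c1, fn_proj]
  rfl

theorem add_sub_self (a b : N) : a + b - b = a := by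
  refine induct (P := fun b : N => ∀ a, a + b - b = a) (fun a => ?_) (fun b ih a => ?_) b a
  · rw [add_zero, sub_zero']
  · rw [sub_succ, add_comm b, ← add_assoc, ih, pred_succ]

theorem sub_add_self (a b : N) : a - (a + b) = 0 := by
  refine induct (P := fun b : N => a - (a + b) = 0) ?_ (fun b ih => ?_) b
  · rw [add_zero]
    have := add_sub_self 0 a
    rwa [zero_add] at this
  · rw [← add_assoc, sub_succ, ih, pred_zero]

scoped instance : OrderedSub N where
  tsub_le_iff_right a b c := by
    rcases le_total b a with h | h
    · obtain ⟨d, rfl⟩ := h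
      rw [add_comm b d, add_sub_self, add_le_add_iff_right]
    · obtain ⟨d, rfl⟩ := h
      rw [sub_add_self]
      refine iff_of_true (zero_le) ?_
      rw [add_left_comm]
      exact le_self_add

instance Dfn.le (F G : (ℕ → N) → N) [DTerm F] [DTerm G] : Dfn (fun v => F v ≤ G v) :=
  Dfn.congr (Q := fun v => F v - G v = 0) fun _ => tsub_eq_zero_iff_le.symm

instance Dfn.lt (F G : (ℕ → N) → N) [DTerm F] [DTerm G] : Dfn (fun v => F v < G v) :=
  Dfn.congr (Q := fun v => ¬ G v ≤ F v) fun _ => not_le.symm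

theorem fn_dist_eq_zero {a b : N} : PR.dist.fn ![a, b] = 0 ↔ a = b := by
  rw [PR.dist, fn_c2, fn_c2, fn_proj, fn_proj, ← add_def, add_eq_zero]
  change a - b = 0 ∧ b - a = 0 ↔ _
  rw [tsub_eq_zero_iff_le, tsub_eq_zero_iff_le, le_antisymm_iff]

open Classical in
theorem fn_cond (a b c : N) : PR.cond.fn ![a, b, c] = if a = 0 then b else c := by
  rw [PR.cond]
  split_ifs with h
  · subst h
    exact (fn_prec_zero _ _ ![b, c]).trans (fn_proj _ _)
  · obtain ⟨d, rfl⟩ := pos_iff_exists.1 h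
    exact (fn_prec_succ _ _ d ![b, c]).trans (fn_proj _ _)

theorem tri_zero : tri (0 : N) = 0 := by
  rw [tri, PR.tri]
  exact (fn_prec_zero _ _ ![]).trans (fn_zero _)

theorem tri_succ (a : N) : tri (a + 1) = tri a + (a + 1) := by
  rw [tri, PR.tri]
  refine (fn_prec_succ _ _ a ![]).trans ?_
  rw [fn_c2, fn_c1, fn_proj, fn_proj]
  exact congrArg (tri a + ·) (succ_eq a)

theorem tri_mono {a b : N} (h : a ≤ b) : tri a ≤ tri b := by
  obtain ⟨c, rfl⟩ := h
  refine induct (P := fun c : N => tri a ≤ tri (a + c)) ?_ (fun c ih => ?_) c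
  · rw [add_zero]
  · rw [← add_assoc, tri_succ]
    exact ih.trans le_self_add

theorem triRoot_zero : triRoot (0 : N) = 0 := by
  rw [triRoot, PR.triRoot]
  exact (fn_prec_zero _ _ ![]).trans (fn_zero _)

open Classical in
theorem triRoot_succ (a : N) :
    triRoot (a + 1) = if a + 1 = tri (triRoot a + 1) then triRoot a + 1 else triRoot a := by
  have h : triRoot (a + 1) = PR.cond.fn ![PR.dist.fn ![a + 1, tri (triRoot a + 1)],
      triRoot a + 1, triRoot a] := by
    rw [triRoot, PR.triRoot]
    refine (fn_prec_succ _ _ a ![]).trans ?_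
    simp only [fn_c3, fn_c2, fn_c1, fn_proj]
    change PR.cond.fn ![PR.dist.fn ![PR.succ.fn ![a], tri (PR.succ.fn ![triRoot a])],
      PR.succ.fn ![triRoot a], triRoot a] = _
    rw [succ_eq, succ_eq]
  rw [h, fn_cond]
  simp only [fn_dist_eq_zero]

/-- The root grows by one exactly when the argument reaches the next triangular number, and this
keeps the argument between two consecutive ones. -/
theorem triRoot_spec (a : N) : tri (triRoot a) ≤ a ∧ a < tri (triRoot a + 1) := by
  refine induct (P := fun a : N => tri (triRoot a) ≤ a ∧ a < tri (triRoot a + 1)) ?_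
    (fun a ih => ?_) a
  · rw [triRoot_zero, tri_zero, tri_succ, tri_zero, zero_add, zero_add]
    refine ⟨le_rfl, lt_iff_succ_le.2 ?_⟩
    rw [zero_add]
  · rw [triRoot_succ]
    split_ifs with h
    · rw [← h]
      refine ⟨le_rfl, ?_⟩
      rw [tri_succ, ← h, ← add_assoc]
      exact lt_succ_iff.2 le_self_add
    · exact ⟨ih.1.trans le_self_add, lt_of_le_of_ne (lt_iff_succ_le.1 ih.2) h⟩

theorem triRoot_eq {a r : N} (h₁ : tri r ≤ a) (h₂ : a < tri (r + 1)) : triRoot a = r := by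
  obtain ⟨h₃, h₄⟩ := triRoot_spec a
  refine le_antisymm ?_ ?_
  · by_contra! h
    exact absurd (h₂.trans_le ((tri_mono (lt_iff_succ_le.1 h)).trans h₃)) (lt_irrefl _)
  · by_contra! h
    exact absurd (h₄.trans_le ((tri_mono (lt_iff_succ_le.1 h)).trans h₁)) (lt_irrefl _)

theorem pr_eq (a b : N) : pr a b = tri (a + b) + b := by
  rw [pr, PR.pair, fn_c2, fn_c1, fn_proj]
  rfl

theorem snd_eq (a : N) : snd a = a - tri (triRoot a) := by
  rw [snd, PR.snd, fn_c2, fn_c1, fn_proj]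
  rfl

theorem fst_eq (a : N) : fst a = triRoot a - snd a := by
  rw [fst, PR.fst, fn_c2]
  rfl

theorem triRoot_pr (a b : N) : triRoot (pr a b) = a + b := by
  rw [pr_eq]
  refine triRoot_eq le_self_add ?_
  rw [tri_succ, add_lt_add_iff_left, lt_succ_iff]
  exact le_add_self

@[simp] theorem snd_pr (a b : N) : snd (pr a b) = b := by
  rw [snd_eq, triRoot_pr, pr_eq, add_comm, add_sub_self]

@[simp] theorem fst_pr (a b : N) : fst (pr a b) = a := by
  rw [fst_eq, snd_pr, triRoot_pr, add_sub_self]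

@[simp] theorem pr_fst_snd (a : N) : pr (fst a) (snd a) = a := by
  obtain ⟨h₁, h₂⟩ := triRoot_spec a
  -- The gap between `tri r` and `tri (r + 1)` is `r + 1`, so the offset of `a` above `tri r` is at
  -- most `r`; hence the subtraction in `fst` is not truncated.
  have h₃ : snd a ≤ triRoot a := by
    rw [snd_eq, tsub_le_iff_right, add_comm]
    rwa [tri_succ, ← add_assoc, lt_succ_iff] at h₂
  have e₁ : snd a + tri (triRoot a) = a := by
    rw [snd_eq]
    exact tsub_add_cancel_of_le h₁
  have e₂ : fst a + snd a = triRoot a := by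
    rw [fst_eq]
    exact tsub_add_cancel_of_le h₃
  rw [pr_eq, e₂, add_comm, e₁]

theorem le_pr_left (a b : N) : a ≤ pr a b := by
  have h : ∀ c : N, c ≤ tri c := fun c => by
    rcases zero_or_succ c with rfl | ⟨d, rfl⟩
    · exact zero_le
    · rw [tri_succ]
      exact le_add_self
  rw [pr_eq]
  exact le_self_add.trans ((h _).trans le_self_add)

theorem le_pr_right (a b : N) : b ≤ pr a b := by
  rw [pr_eq]
  exact le_add_self

end Arithmetic

end PAModel

namespace PAModel

/-! ### Kleene's T-predicate in a model of `PA`. -/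

section Computations

variable {N : Type u} [Lpr.Structure N]

/-- The index at the root of a computation. -/
def idx (u : N) : N := PR.cIdx.fn ![u]

/-- The argument at the root of a computation. -/
def arg (u : N) : N := PR.cArg.fn ![u]

/-- The value at the root of a computation. -/
def val (u : N) : N := PR.cVal.fn ![u]

/-- The first subcomputation. -/
def cl (u : N) : N := PR.cL.fn ![u]

/-- The second subcomputation. -/
def cr (u : N) : N := PR.cR.fn ![u]

/-- The list of the results of the tests for all smaller numbers. -/
def hist (u : N) : N := PR.history.fn ![u]

/-- `u` is the code of a computation. -/
def IsC (u : N) : Prop := PR.isComp.fn ![u] = 0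

instance DTerm.idx (F : (ℕ → N) → N) [DTerm F] : DTerm (fun v => idx (F v)) :=
  DTerm.fn1 PR.cIdx F

instance DTerm.arg (F : (ℕ → N) → N) [DTerm F] : DTerm (fun v => arg (F v)) :=
  DTerm.fn1 PR.cArg F

instance DTerm.val (F : (ℕ → N) → N) [DTerm F] : DTerm (fun v => val (F v)) :=
  DTerm.fn1 PR.cVal F

instance DTerm.hist (F : (ℕ → N) → N) [DTerm F] : DTerm (fun v => hist (F v)) :=
  DTerm.fn1 PR.history F

instance Dfn.isC (F : (ℕ → N) → N) [DTerm F] : Dfn (fun v => IsC (F v)) :=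
  Dfn.eq (fun v => PR.isComp.fn ![F v]) (fun _ => 0)

/-- The partial recursive function with index `e` has the value `y` at `x`. -/
def Ev (e x y : N) : Prop := ∃ u, PR.kleeneT.fn ![e, x, u] = 0 ∧ PR.kleeneU.fn ![u] = y

theorem DTerm.shift (F : (ℕ → N) → N) [hF : DTerm F] :
    DTerm (fun v => F (fun i => v (i + 1))) := by
  obtain ⟨n, t, c, h⟩ := hF.exists_term
  refine ⟨n, t, fun i => Sum.map Nat.succ id (c i), fun v => ?_⟩
  rw [h]
  congr 1
  funext i
  rcases hc : c i with k | b <;> simp [hc]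

instance Dfn.ev (F G H : (ℕ → N) → N) [DTerm F] [DTerm G] [DTerm H] :
    Dfn (fun v => Ev (F v) (G v) (H v)) := by
  have := DTerm.shift F
  have := DTerm.shift G
  have := DTerm.shift H
  exact Dfn.ex (fun u v => PR.kleeneT.fn ![F v, G v, u] = 0 ∧ PR.kleeneU.fn ![u] = H v)

variable [PAModel N]

theorem one_ne_zero' : (1 : N) ≠ 0 := by
  rw [← zero_add (1 : N)]
  exact succ_ne_zero 0

theorem pred_one : pred (1 : N) = 0 := by
  rw [← zero_add (1 : N)]
  exact pred_succ 0

theorem idx_eq (u : N) : idx u = fst (pred u) := by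
  rw [idx, PR.cIdx, fn_c1]; rfl

theorem arg_eq (u : N) : arg u = fst (snd (pred u)) := by
  rw [arg, PR.cArg, fn_c1, fn_c1]; rfl

theorem val_eq (u : N) : val u = fst (snd (snd (pred u))) := by
  rw [val, PR.cVal, fn_c1, fn_c1, fn_c1]; rfl

theorem cl_eq (u : N) : cl u = fst (snd (snd (snd (pred u)))) := by
  rw [cl, PR.cL, fn_c1, fn_c1, fn_c1, fn_c1]; rfl

theorem cr_eq (u : N) : cr u = snd (snd (snd (snd (pred u)))) := by
  rw [cr, PR.cR, fn_c1, fn_c1, fn_c1, fn_c1]; rfl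

theorem fst_le (a : N) : fst a ≤ a := by
  conv_rhs => rw [← pr_fst_snd a]
  exact le_pr_left _ _

theorem snd_le (a : N) : snd a ≤ a := by
  conv_rhs => rw [← pr_fst_snd a]
  exact le_pr_right _ _

theorem pred_lt {u : N} (h : u ≠ 0) : pred u < u := by
  obtain ⟨b, rfl⟩ := pos_iff_exists.1 h
  rw [pred_succ]
  exact lt_succ_iff.2 le_rfl

theorem cl_lt {u : N} (h : u ≠ 0) : cl u < u := by
  rw [cl_eq]
  exact ((fst_le _).trans ((snd_le _).trans ((snd_le _).trans (snd_le _)))).trans_lt (pred_lt h)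

theorem cr_lt {u : N} (h : u ≠ 0) : cr u < u := by
  rw [cr_eq]
  exact ((snd_le _).trans ((snd_le _).trans ((snd_le _).trans (snd_le _)))).trans_lt (pred_lt h)

theorem iterSnd_zero (h : N) : PR.iterSnd.fn ![0, h] = h := by
  rw [PR.iterSnd]
  exact (fn_prec_zero _ _ ![h]).trans (fn_proj _ _)

theorem iterSnd_succ (k h : N) : PR.iterSnd.fn ![k + 1, h] = snd (PR.iterSnd.fn ![k, h]) := by
  rw [PR.iterSnd]
  refine (fn_prec_succ _ _ k ![h]).trans ?_
  rw [fn_c1, fn_proj]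
  rfl

theorem iterSnd_succ' (k h : N) : PR.iterSnd.fn ![k + 1, h] = PR.iterSnd.fn ![k, snd h] := by
  refine induct (P := fun k : N => PR.iterSnd.fn ![k + 1, h] = PR.iterSnd.fn ![k, snd h]) ?_
    (fun k ih => ?_) k
  · rw [iterSnd_succ, iterSnd_zero, iterSnd_zero]
  · rw [iterSnd_succ, ih, iterSnd_succ]

theorem hist_succ (z : N) : hist (z + 1) = pr (PR.isComp.fn ![z]) (hist z) := by
  rw [hist, PR.history]
  refine (fn_prec_succ _ _ z ![]).trans ?_
  rw [fn_c2, fn_c2, fn_proj, fn_proj, PR.isComp, fn_c2, fn_proj]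
  rfl

/-- The newest test result stands at the head of the list, so dropping `d` entries recovers the
earlier history. -/
theorem iterSnd_hist (i d : N) : PR.iterSnd.fn ![d, hist (i + 1 + d)] = hist (i + 1) := by
  refine induct (P := fun d : N => PR.iterSnd.fn ![d, hist (i + 1 + d)] = hist (i + 1)) ?_
    (fun d ih => ?_) d
  · rw [iterSnd_zero, add_zero]
  · rw [iterSnd_succ', ← add_assoc, hist_succ, snd_pr, ih]

theorem lookup_hist {z i : N} (h : i < z) :
    PR.lookup.fn ![z, hist z, i] = PR.isComp.fn ![i] := by
  obtain ⟨d, rfl⟩ := lt_iff_succ_le.1 h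
  rw [PR.lookup, fn_c1, fn_c2, fn_c2, fn_c1, fn_proj, fn_proj, fn_proj]
  change fst (PR.iterSnd.fn ![pred (i + 1 + d) - i, hist (i + 1 + d)]) = _
  rw [add_right_comm, pred_succ, add_comm i d, add_sub_self, add_comm d i, add_right_comm,
    iterSnd_hist, hist_succ, fst_pr]

/-- `c` is the code of a computation with index `e` and argument `x`. -/
def IsSub (c e x : N) : Prop := IsC c ∧ idx c = e ∧ arg c = x

theorem fn_and2 {n : ℕ} (a b : PR n) (v : Fin n → N) :
    (PR.and2 a b).fn v = 0 ↔ a.fn v = 0 ∧ b.fn v = 0 := by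
  rw [PR.and2, fn_c2, ← add_def, add_eq_zero]

theorem fn_and3 {n : ℕ} (a b c : PR n) (v : Fin n → N) :
    (PR.and3 a b c).fn v = 0 ↔ a.fn v = 0 ∧ b.fn v = 0 ∧ c.fn v = 0 := by
  rw [PR.and3, fn_and2, fn_and2]

/-- The strict bound is essential: the history only records test results for numbers below `u`. -/
theorem fn_sub' {u : N} (c e x : PR 2) (h : c.fn ![u, hist u] < u) :
    (PR.sub' c e x).fn ![u, hist u] = 0 ↔
      IsSub (c.fn ![u, hist u]) (e.fn ![u, hist u]) (x.fn ![u, hist u]) := by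
  rw [PR.sub', fn_and3, fn_c3, fn_c2, fn_c2, fn_dist_eq_zero, fn_dist_eq_zero, fn_proj, fn_proj]
  change PR.lookup.fn ![u, hist u, (c.fn ![u, hist u])] = 0 ∧ _ ↔ _
  rw [lookup_hist h, fn_c1, fn_c1]
  rfl

open Classical in
/-- The condition on a nonzero number to be the code of a computation, in terms of its
components. -/
def StepOK (t e a b x y l r : N) : Prop :=
  if t = 0 then y = a ∧ l = 0 ∧ r = 0
  else if pred t = 0 then y = x + 1 ∧ l = 0 ∧ r = 0
  else if pred (pred t) = 0 then y = fst x ∧ l = 0 ∧ r = 0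
  else if pred (pred (pred t)) = 0 then y = snd x ∧ l = 0 ∧ r = 0
  else if pred (pred (pred (pred t))) = 0 then
    IsSub l a x ∧ IsSub r b x ∧ y = pr (val l) (val r)
  else if pred (pred (pred (pred (pred t)))) = 0 then
    IsSub l b x ∧ IsSub r a (val l) ∧ y = val r
  else if pred (pred (pred (pred (pred (pred t))))) = 0 then
    if snd x = 0 then IsSub l a (fst x) ∧ r = 0 ∧ y = val l
    else IsSub l e (pr (fst x) (pred (snd x))) ∧
      IsSub r b (pr (fst x) (pr (pred (snd x)) (val l))) ∧ y = val r
  else IsSub l a x ∧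
    if val l = 0 then r = 0 ∧ y = snd x
    else IsSub r e (pr (fst x) (snd x + 1)) ∧ y = val r

open Classical in
theorem fn_cond_eq_zero {n : ℕ} (a b c : PR n) (v : Fin n → N) :
    (PR.c3 PR.cond a b c).fn v = 0 ↔ if a.fn v = 0 then b.fn v = 0 else c.fn v = 0 := by
  rw [fn_c3, fn_cond]
  split_ifs <;> rfl

/-- Unwinds the course-of-values recursion: subcomputations have smaller codes, so the table
look-ups can be replaced by the predicate itself. -/
theorem isC_iff (u : N) : IsC u ↔ u ≠ 0 ∧ StepOK (fst (idx u)) (idx u) (fst (snd (idx u)))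
    (snd (snd (idx u))) (arg u) (val u) (cl u) (cr u) := by
  have h0 : IsC u ↔ PR.step.fn ![u, hist u] = 0 := by
    rw [IsC, PR.isComp, fn_c2, fn_proj]
    rfl
  rw [h0, PR.step, fn_cond_eq_zero, fn_proj, fn_c1, succ_eq]
  by_cases hu : u = 0
  · subst hu
    simp [fn_zeroN, one_ne_zero']
  · have hE : PR.zE.fn ![u, hist u] = idx u := by rw [PR.zE, fn_c1, fn_proj]; rfl
    have hX : PR.zX.fn ![u, hist u] = arg u := by rw [PR.zX, fn_c1, fn_proj]; rfl
    have hY : PR.zY.fn ![u, hist u] = val u := by rw [PR.zY, fn_c1, fn_proj]; rfl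
    have hL : PR.zL.fn ![u, hist u] = cl u := by rw [PR.zL, fn_c1, fn_proj]; rfl
    have hR : PR.zR.fn ![u, hist u] = cr u := by rw [PR.zR, fn_c1, fn_proj]; rfl
    have hT : PR.zT.fn ![u, hist u] = fst (idx u) := by rw [PR.zT, fn_c1, hE]; rfl
    have hA : PR.zA.fn ![u, hist u] = fst (snd (idx u)) := by rw [PR.zA, fn_c1, fn_c1, hE]; rfl
    have hB : PR.zB.fn ![u, hist u] = snd (snd (idx u)) := by rw [PR.zB, fn_c1, fn_c1, hE]; rfl
    have hLY : PR.zLY.fn ![u, hist u] = val (cl u) := by rw [PR.zLY, fn_c1, hL]; rfl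
    have hRY : PR.zRY.fn ![u, hist u] = val (cr u) := by rw [PR.zRY, fn_c1, hR]; rfl
    have hleaf : ∀ w : PR 2, (PR.leaf w).fn ![u, hist u] = 0 ↔
        val u = w.fn ![u, hist u] ∧ cl u = 0 ∧ cr u = 0 := fun w => by
      rw [PR.leaf, fn_and3, fn_c2, fn_dist_eq_zero, hY, hL, hR]
    have hsL : ∀ e x : PR 2, (PR.sub' PR.zL e x).fn ![u, hist u] = 0 ↔
        IsSub (cl u) (e.fn ![u, hist u]) (x.fn ![u, hist u]) := fun e x => by
      rw [fn_sub' _ _ _ (by rw [hL]; exact cl_lt hu), hL]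
    have hsR : ∀ e x : PR 2, (PR.sub' PR.zR e x).fn ![u, hist u] = 0 ↔
        IsSub (cr u) (e.fn ![u, hist u]) (x.fn ![u, hist u]) := fun e x => by
      rw [fn_sub' _ _ _ (by rw [hR]; exact cr_lt hu), hR]
    have hpred : ∀ a : N, PR.pred.fn ![a] = pred a := fun _ => rfl
    have hfst : ∀ a : N, PR.fst.fn ![a] = fst a := fun _ => rfl
    have hsnd : ∀ a : N, PR.snd.fn ![a] = snd a := fun _ => rfl
    have hpair : ∀ a b : N, PR.pair.fn ![a, b] = pr a b := fun _ _ => rfl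
    rw [Matrix.cons_val_zero, if_neg hu, PR.stepPos]
    simp only [fn_cond_eq_zero, hleaf, PR.stepPair, PR.stepComp, PR.stepPrec, PR.stepMin,
      fn_and3, fn_and2, hsL, hsR, fn_c1, fn_c2, fn_dist_eq_zero, hE, hX, hY, hR, hT, hA, hB,
      hLY, hRY, hpred, hfst, hsnd, hpair, succ_eq, StepOK, ne_eq, hu, not_false_eq_true, true_and]

/-- The code of a computation with given components. -/
def compCode (e x y l r : N) : N := pr e (pr x (pr y (pr l r))) + 1

theorem isC_compCode (e x y l r : N) : IsC (compCode e x y l r) ↔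
    StepOK (fst e) e (fst (snd e)) (snd (snd e)) x y l r := by
  rw [isC_iff]
  simp [compCode, idx_eq, arg_eq, val_eq, cl_eq, cr_eq, pred_succ, one_ne_zero']

theorem idx_compCode (e x y l r : N) :
    idx (compCode e x y l r) = e := by simp [compCode, idx_eq, pred_succ]
theorem arg_compCode (e x y l r : N) :
    arg (compCode e x y l r) = x := by simp [compCode, arg_eq, pred_succ]
theorem val_compCode (e x y l r : N) :
    val (compCode e x y l r) = y := by simp [compCode, val_eq, pred_succ]

theorem kleeneT_eq_zero (e x u : N) : PR.kleeneT.fn ![e, x, u] = 0 ↔ IsSub u e x := by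
  rw [PR.kleeneT, fn_and3, fn_c2, fn_c2, fn_dist_eq_zero, fn_dist_eq_zero, fn_c1, fn_c1, fn_c1,
    fn_proj, fn_proj, fn_proj]
  rfl

theorem ev_iff {e x y : N} : Ev e x y ↔ ∃ u, IsSub u e x ∧ val u = y := by
  simp only [Ev, kleeneT_eq_zero]
  rfl

theorem Ev.of_step {e x y l r : N}
    (h : StepOK (fst e) e (fst (snd e)) (snd (snd e)) x y l r) : Ev e x y :=
  ev_iff.2 ⟨compCode e x y l r, ⟨(isC_compCode _ _ _ _ _).2 h, idx_compCode _ _ _ _ _, arg_compCode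
    _ _ _ _ _⟩,
    val_compCode _ _ _ _ _⟩

/-- Course-of-values induction on the code of the first computation only; the second one is
arbitrary. Both obey the same clause, since they share index and argument, and their subcomputations
are compared by induction. -/
theorem IsSub.val_unique {u w e x : N} (hu : IsSub u e x) (hw : IsSub w e x) :
    val u = val w := by
  obtain ⟨hu, rfl, rfl⟩ := hu
  obtain ⟨hw, h₁, h₂⟩ := hw
  have key : ∀ b : N, ∀ u, u < b → IsC u → ∀ w, IsC w → idx w = idx u → arg w = arg u →
      val u = val w := by
    refine induct (P := fun b : N => ∀ u, u < b → IsC u → ∀ w, IsC w → idx w = idx u →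
      arg w = arg u → val u = val w) (fun u hu => absurd hu (not_lt.2 zero_le)) ?_
    intro b ih u hub hu w hw h₁ h₂
    obtain ⟨u0, hu⟩ := (isC_iff u).1 hu
    obtain ⟨w0, hw⟩ := (isC_iff w).1 hw
    rw [h₁, h₂] at hw
    have sub : ∀ {c d e x : N}, c < u → IsSub c e x → IsSub d e x → val c = val d :=
      fun hc h h' => ih _ (hc.trans_le (lt_succ_iff.1 hub)) h.1 _ h'.1
        (h'.2.1.trans h.2.1.symm) (h'.2.2.trans h.2.2.symm)
    have hl := cl_lt u0
    have hr := cr_lt u0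
    unfold StepOK at hu hw
    split_ifs at hu hw with c₁ c₂ c₃ c₄ c₅ c₆ c₇ c₈ c₉ c₁₀ c₁₁
    · rw [hu.1, hw.1]
    · rw [hu.1, hw.1]
    · rw [hu.1, hw.1]
    · rw [hu.1, hw.1]
    · rw [hu.2.2, hw.2.2, sub hl hu.1 hw.1, sub hr hu.2.1 hw.2.1]
    · rw [hu.2.2, hw.2.2]
      have e := sub hl hu.1 hw.1
      -- The argument of the second call contains the value of the first, so the first values must
      -- be identified before the second calls can be compared.
      rw [← e] at hw
      exact sub hr hu.2.1 hw.2.1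
    · rw [hu.2.2, hw.2.2, sub hl hu.1 hw.1]
    · rw [hu.2.2, hw.2.2]
      have e := sub hl hu.1 hw.1
      rw [← e] at hw
      exact sub hr hu.2.1 hw.2.1
    · rw [hu.2.2, hw.2.2]
    -- Minimization stopping in one computation and continuing in the other is impossible, as the
    -- test values agree.
    · exact absurd ((sub hl hu.1 hw.1).symm.trans c₉) (by assumption)
    · exact absurd ((sub hl hu.1 hw.1).trans (by assumption)) c₉
    · rw [hu.2.2, hw.2.2, sub hr hu.2.1 hw.2.1]
  exact key (u + 1) u (lt_succ_iff.2 le_rfl) hu w hw h₁ h₂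

theorem Ev.unique {e x y y' : N} (h : Ev e x y) (h' : Ev e x y') : y = y' := by
  obtain ⟨u, hu, rfl⟩ := ev_iff.1 h
  obtain ⟨w, hw, rfl⟩ := ev_iff.1 h'
  exact hu.val_unique hw

/-- The tags of indices. -/
def tag : ℕ → N
  | 0 => 0
  | k + 1 => tag k + 1

theorem ev_const (a x : N) : Ev (pr (tag 0) (pr a 0)) x a :=
  Ev.of_step (l := 0) (r := 0) (by simp [StepOK, tag])

theorem ev_succ (x : N) : Ev (pr (tag 1) 0) x (x + 1) :=
  Ev.of_step (l := 0) (r := 0) (by simp [StepOK, tag, one_ne_zero', pred_one])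

theorem ev_fst (x : N) : Ev (pr (tag 2) 0) x (fst x) :=
  Ev.of_step (l := 0) (r := 0) (by simp [StepOK, tag, one_ne_zero', pred_one, pred_succ])

theorem ev_snd (x : N) : Ev (pr (tag 3) 0) x (snd x) :=
  Ev.of_step (l := 0) (r := 0) (by simp [StepOK, tag, one_ne_zero', pred_one, pred_succ])

theorem ev_pair {a b x y z : N} (h₁ : Ev a x y) (h₂ : Ev b x z) :
    Ev (pr (tag 4) (pr a b)) x (pr y z) := by
  obtain ⟨u, hu, rfl⟩ := ev_iff.1 h₁
  obtain ⟨w, hw, rfl⟩ := ev_iff.1 h₂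
  exact Ev.of_step (l := u) (r := w) (by simp [StepOK, tag, one_ne_zero', pred_one, pred_succ, hu,
    hw])

theorem ev_comp {a b x y z : N} (h₁ : Ev b x y) (h₂ : Ev a y z) :
    Ev (pr (tag 5) (pr a b)) x z := by
  obtain ⟨u, hu, rfl⟩ := ev_iff.1 h₁
  obtain ⟨w, hw, rfl⟩ := ev_iff.1 h₂
  exact Ev.of_step (l := u) (r := w) (by simp [StepOK, tag, one_ne_zero', pred_one, pred_succ, hu,
    hw])

theorem ev_prec_zero {a b p y : N} (h : Ev a p y) : Ev (pr (tag 6) (pr a b)) (pr p 0) y := by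
  obtain ⟨u, hu, rfl⟩ := ev_iff.1 h
  exact Ev.of_step (l := u) (r := 0) (by simp [StepOK, tag, one_ne_zero', pred_one, pred_succ, hu])

theorem ev_prec_succ {a b p m y z : N} (h₁ : Ev (pr (tag 6) (pr a b)) (pr p m) y)
    (h₂ : Ev b (pr p (pr m y)) z) : Ev (pr (tag 6) (pr a b)) (pr p (m + 1)) z := by
  obtain ⟨u, hu, rfl⟩ := ev_iff.1 h₁
  obtain ⟨w, hw, rfl⟩ := ev_iff.1 h₂
  refine Ev.of_step (l := u) (r := w) ?_
  simp only [tag, zero_add] at hu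
  simp [StepOK, tag, one_ne_zero', pred_one, pred_succ, hu, hw]

theorem ev_min_zero {a p m : N} (h : Ev a (pr p m) 0) : Ev (pr (tag 7) (pr a 0)) (pr p m) m := by
  obtain ⟨u, hu, hv⟩ := ev_iff.1 h
  exact Ev.of_step (l := u) (r := 0) (by simp [StepOK, tag, one_ne_zero', pred_succ, hu, hv])

theorem ev_min_succ {a p m y z : N} (h₁ : Ev a (pr p m) y) (hy : y ≠ 0)
    (h₂ : Ev (pr (tag 7) (pr a 0)) (pr p (m + 1)) z) : Ev (pr (tag 7) (pr a 0)) (pr p m) z := by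
  obtain ⟨u, hu, rfl⟩ := ev_iff.1 h₁
  obtain ⟨w, hw, rfl⟩ := ev_iff.1 h₂
  refine Ev.of_step (l := u) (r := w) ?_
  simp only [tag, zero_add] at hw
  simp [StepOK, tag, one_ne_zero', pred_succ, hu, hw, hy]

end Computations

end PAModel

namespace PAModel

variable {N : Type u} [Lpr.Structure N]

/-- The partial function with the graph `R` has an index in `S`. -/
def Computable (S : Lpr.Substructure N) (R : N → N → Prop) : Prop :=
  ∃ e ∈ S, ∀ x y, R x y → Ev e x y

/-- The total function `F` has an index in `S`. -/
def Rec (S : Lpr.Substructure N) (F : N → N) : Prop := ∃ e ∈ S, ∀ x, Ev e x (F x)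

/-! ### Computable functions with an index in a substructure. -/

section Indices

variable {S : Lpr.Substructure N}

theorem fn_mem {n : ℕ} (f : PR n) {v : Fin n → N} (h : ∀ i, v i ∈ S) : f.fn v ∈ S :=
  S.fun_mem f v h

theorem zero_mem : (0 : N) ∈ S := fn_mem PR.zero fun i => i.elim0

theorem pr_mem {a b : N} (ha : a ∈ S) (hb : b ∈ S) : pr a b ∈ S :=
  fn_mem PR.pair fun i => by fin_cases i <;> assumption

theorem fst_mem {a : N} (ha : a ∈ S) : fst a ∈ S :=
  fn_mem PR.fst fun i => by fin_cases i; assumption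

theorem snd_mem {a : N} (ha : a ∈ S) : snd a ∈ S :=
  fn_mem PR.snd fun i => by fin_cases i; assumption

theorem Rec.computable {F : N → N} (hF : Rec S F) : Computable S fun x y => y = F x := by
  obtain ⟨e, he, hF⟩ := hF
  exact ⟨e, he, fun x y h => h ▸ hF x⟩

theorem Computable.mono {R R' : N → N → Prop} (hR : Computable S R)
    (h : ∀ x y, R' x y → R x y) : Computable S R' := by
  obtain ⟨e, he, hR⟩ := hR
  exact ⟨e, he, fun x y hxy => hR x y (h x y hxy)⟩

theorem Computable.of_mem {e : N} (he : e ∈ S) : Computable S fun x y => Ev e x y :=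
  ⟨e, he, fun _ _ h => h⟩

variable [PAModel N]

theorem tag_mem (k : ℕ) : (tag k : N) ∈ S := by
  induction k with
  | zero => exact zero_mem
  | succ k ih =>
    rw [tag, ← succ_eq]
    exact fn_mem PR.succ fun i => by fin_cases i; exact ih

theorem Rec.const {a : N} (ha : a ∈ S) : Rec S fun _ => a :=
  ⟨_, pr_mem (tag_mem 0) (pr_mem ha zero_mem), ev_const a⟩

theorem Rec.fst' : Rec S (fst : N → N) := ⟨_, pr_mem (tag_mem 2) zero_mem, ev_fst⟩

theorem Rec.snd' : Rec S (snd : N → N) := ⟨_, pr_mem (tag_mem 3) zero_mem, ev_snd⟩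

theorem Rec.comp {F G : N → N} (hF : Rec S F) (hG : Rec S G) : Rec S fun x => F (G x) := by
  obtain ⟨e, he, hF⟩ := hF
  obtain ⟨d, hd, hG⟩ := hG
  exact ⟨_, pr_mem (tag_mem 5) (pr_mem he hd), fun x => ev_comp (hG x) (hF _)⟩

theorem Rec.pair {F G : N → N} (hF : Rec S F) (hG : Rec S G) :
    Rec S fun x => pr (F x) (G x) := by
  obtain ⟨e, he, hF⟩ := hF
  obtain ⟨d, hd, hG⟩ := hG
  exact ⟨_, pr_mem (tag_mem 4) (pr_mem he hd), fun x => ev_pair (hF x) (hG x)⟩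

theorem Rec.id' : Rec S fun x : N => x := by
  have := Rec.pair (S := S) Rec.fst' Rec.snd'
  simpa only [pr_fst_snd] using this

theorem Rec.fst {F : N → N} (hF : Rec S F) : Rec S fun x => fst (F x) := Rec.fst'.comp hF

theorem Rec.snd {F : N → N} (hF : Rec S F) : Rec S fun x => snd (F x) := Rec.snd'.comp hF

/-- Every primitive recursive function is computable. -/
theorem Rec.fn {n : ℕ} (f : PR n) {G : Fin n → N → N} (hG : ∀ i, Rec S (G i)) :
    Rec S fun x => f.fn fun i => G i x := by
  induction f with
  | zero =>
    simp only [fn_zero]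
    exact Rec.const zero_mem
  | succ =>
    have h : ∀ x, PR.succ.fn (fun i => G i x) = G 0 x + 1 := fun x => by
      rw [← succ_eq]
      congr 1; funext i; fin_cases i; rfl
    simp only [h]
    exact Rec.comp (F := fun x => x + 1) ⟨_, pr_mem (tag_mem 1) zero_mem, ev_succ⟩ (hG 0)
  | proj i =>
    simp only [fn_proj]
    exact hG i
  | comp f g ihf ihg =>
    simp only [fn_comp]
    exact ihf fun j => ihg j hG
  -- The recursion clause of the indices has a single parameter: the whole input `x` is passed as
  -- that parameter, and the side arguments are recomputed from it.
  | @prec n f g ihf ihg =>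
    obtain ⟨a, ha, hA⟩ := ihf fun i => hG i.succ
    obtain ⟨b, hb, hB⟩ := ihg (G := Matrix.vecCons (fun x => PAModel.fst (PAModel.snd x))
      (Matrix.vecCons (fun x => PAModel.snd (PAModel.snd x)) fun i x =>
        G i.succ (PAModel.fst x))) (by
      refine Fin.cases Rec.snd'.fst (Fin.cases Rec.snd'.snd fun i => ?_)
      exact (hG i.succ).comp Rec.fst')
    obtain ⟨c, hc, hC⟩ := Rec.id'.pair (hG 0)
    refine ⟨_, pr_mem (tag_mem 5) (pr_mem (pr_mem (tag_mem 6) (pr_mem ha hb)) hc),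
      fun x => ev_comp (hC x) ?_⟩
    have key : ∀ m : N, Ev (pr (tag 6) (pr a b)) (pr x m)
        ((PR.prec f g).fn (Matrix.vecCons m fun i => G i.succ x)) := by
      have hd : DTerm (fun v : ℕ → N =>
          (PR.prec f g).fn (Matrix.vecCons (v 0) fun i => G i.succ x)) := by
        convert DTerm.fn (PR.prec f g) (Matrix.vecCons (fun v => v 0) fun i _ => G i.succ x) ?_
          using 3 with v
        · funext i
          refine Fin.cases rfl (fun i => rfl) i
        · exact Fin.cases (DTerm.var 0) fun i => DTerm.const _
      refine induct (P := fun m : N => Ev (pr (tag 6) (pr a b)) (pr x m)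
        ((PR.prec f g).fn (Matrix.vecCons m fun i => G i.succ x))) ?_ fun m ih => ?_
      · rw [fn_prec_zero]
        exact ev_prec_zero (hA x)
      · rw [fn_prec_succ]
        refine ev_prec_succ ih ?_
        convert hB (pr x (pr m _)) using 2
        funext i
        refine Fin.cases ?_ (Fin.cases ?_ fun i => ?_) i <;> simp
    convert key (G 0 x) using 2
    funext i
    refine Fin.cases rfl (fun i => rfl) i

theorem Rec.fn1 (f : PR 1) {F : N → N} (hF : Rec S F) : Rec S fun x => f.fn ![F x] := by
  convert Rec.fn f (G := ![F]) (by intro i; fin_cases i; exact hF) using 3 with x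
  funext i; fin_cases i; rfl

theorem Rec.fn2 (f : PR 2) {F G : N → N} (hF : Rec S F) (hG : Rec S G) :
    Rec S fun x => f.fn ![F x, G x] := by
  convert Rec.fn f (G := ![F, G]) (by intro i; fin_cases i; exacts [hF, hG]) using 3 with x
  funext i; fin_cases i <;> rfl

theorem Rec.fn3 (f : PR 3) {F G H : N → N} (hF : Rec S F) (hG : Rec S G) (hH : Rec S H) :
    Rec S fun x => f.fn ![F x, G x, H x] := by
  convert Rec.fn f (G := ![F, G, H]) (by intro i; fin_cases i; exacts [hF, hG, hH]) using 3 with x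
  funext i; fin_cases i <;> rfl

/-- Unbounded search for a zero. -/
theorem Rec.search {F : N → N} (hF : Rec S F) :
    ∃ e ∈ S, ∀ p k, F (pr p k) = 0 → ∃ y, Ev e p y ∧ F (pr p y) = 0 := by
  obtain ⟨a, ha, hA⟩ := hF
  obtain ⟨c, hc, hC⟩ := Rec.pair (S := S) Rec.id' (Rec.const zero_mem)
  refine ⟨_, pr_mem (tag_mem 5) (pr_mem (pr_mem (tag_mem 7) (pr_mem ha zero_mem)) hc),
    fun p k hk => ?_⟩
  -- Induction on the distance `d` from the current position to the known zero `k`; the search may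
  -- stop earlier.
  have key : ∀ d : N, ∀ m, m + d = k → ∃ y, Ev (pr (tag 7) (pr a 0)) (pr p m) y ∧
      Ev a (pr p y) 0 := by
    have h₀ : ∀ m, F (pr p m) = 0 → Ev a (pr p m) 0 := fun m h => h ▸ hA (pr p m)
    refine induct (P := fun d : N => ∀ m, m + d = k → ∃ y,
      Ev (pr (tag 7) (pr a 0)) (pr p m) y ∧ Ev a (pr p y) 0) (fun m hm => ?_) fun d ih m hm => ?_
    · rw [add_zero] at hm
      subst hm
      exact ⟨m, ev_min_zero (h₀ m hk), h₀ m hk⟩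
    · by_cases h : F (pr p m) = 0
      · exact ⟨m, ev_min_zero (h₀ m h), h₀ m h⟩
      · obtain ⟨y, hy, hy'⟩ := ih (m + 1) (by rw [← hm, add_right_comm, add_assoc])
        exact ⟨y, ev_min_succ (hA _) h hy, hy'⟩
  obtain ⟨y, hy, hy'⟩ := key k 0 (zero_add k)
  exact ⟨y, ev_comp (hC p) hy, (hA _).unique hy'⟩

theorem Computable.pair {R R' : N → N → Prop} (hR : Computable S R) (hR' : Computable S R') :
    Computable S fun x y => R x (PAModel.fst y) ∧ R' x (PAModel.snd y) := by
  obtain ⟨e, he, hR⟩ := hR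
  obtain ⟨d, hd, hR'⟩ := hR'
  refine ⟨_, pr_mem (tag_mem 4) (pr_mem he hd), fun x y h => ?_⟩
  rw [← pr_fst_snd y]
  exact ev_pair (hR _ _ h.1) (hR' _ _ h.2)

theorem Computable.comp {R R' : N → N → Prop} (hR : Computable S R) (hR' : Computable S R') :
    Computable S fun x z => ∃ y, R' x y ∧ R y z := by
  obtain ⟨e, he, hR⟩ := hR
  obtain ⟨d, hd, hR'⟩ := hR'
  exact ⟨_, pr_mem (tag_mem 5) (pr_mem he hd), fun x z ⟨y, h₁, h₂⟩ =>
    ev_comp (hR' _ _ h₁) (hR _ _ h₂)⟩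

theorem Computable.comp_rec {R : N → N → Prop} {F : N → N} (hR : Computable S R)
    (hF : Rec S F) : Computable S fun x z => R (F x) z :=
  (hR.comp hF.computable).mono fun _ _ h => ⟨_, rfl, h⟩

theorem Computable.rec_comp {R : N → N → Prop} {F : N → N} (hF : Rec S F)
    (hR : Computable S R) : Computable S fun x z => ∃ y, R x y ∧ z = F y :=
  hF.computable.comp hR

/-- Application of one function to another one. -/
theorem Computable.ap {R R' : N → N → Prop} (hR : Computable S R) (hR' : Computable S R') :
    Computable S fun x z => ∃ f y, R x f ∧ R' x y ∧ Ev f y z := by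
  obtain ⟨e, he, hs⟩ := Rec.search (S := S) (F := fun x : N => PR.kleeneT.fn
    ![PAModel.fst (PAModel.fst x), PAModel.snd (PAModel.fst x), PAModel.snd x])
    (Rec.fn3 _ Rec.fst'.fst Rec.fst'.snd Rec.snd')
  have hU : Rec S fun u : N => PR.kleeneU.fn ![u] := Rec.fn1 _ Rec.id'
  refine ((Computable.rec_comp hU (Computable.of_mem he)).comp (hR.pair hR')).mono ?_
  rintro x z ⟨f, y, h₁, h₂, h₃⟩
  obtain ⟨u, hu, hz⟩ := h₃
  -- The search may find a computation other than `u`; uniqueness of values makes the result the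
  -- same.
  obtain ⟨w, hw, hw'⟩ := hs (pr f y) u (by simpa using hu)
  refine ⟨pr f y, by simpa using ⟨h₁, h₂⟩, w, hw, ?_⟩
  refine Ev.unique (e := f) (x := y) ⟨u, hu, hz⟩ ⟨w, by simpa using hw', rfl⟩

/-- The parametrization theorem. -/
theorem Computable.curry {R : N → N → Prop} (hR : Computable S R) :
    ∃ F : N → N, Rec S F ∧ ∀ p q y, R (pr p q) y → Ev (F p) q y := by
  obtain ⟨e, he, hR⟩ := hR
  -- The index of `q ↦ {e}(⟨p, q⟩)` is the composition of `e` with the pairing of the constant `p`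
  -- and the identity; this index is itself a recursive function of `p`.
  obtain ⟨i, hi, hI⟩ := Rec.id' (S := S)
  refine ⟨fun p => pr (tag 5) (pr e (pr (tag 4) (pr (pr (tag 0) (pr p 0)) i))), ?_,
    fun p q y h => ev_comp (ev_pair (ev_const p q) (hI q)) (hR _ _ h)⟩
  exact (Rec.const (tag_mem 5)).pair ((Rec.const he).pair ((Rec.const (tag_mem 4)).pair
    (((Rec.const (tag_mem 0)).pair (Rec.id'.pair (Rec.const zero_mem))).pair (Rec.const hi))))

end Indices

/-! ### Realizability -/

/-- `a` realizes `φ[v]`. -/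
def Rz : {n : ℕ} → Fml Lpr n → N → (Fin n → N) → Prop
  | _, .falsum, _, _ => False
  | _, .eq s t, _, v => s.realize v = t.realize v
  | _, .rel _ _, _, _ => False
  | _, .and φ ψ, a, v => Rz φ (fst a) v ∧ Rz ψ (snd a) v
  | _, .or φ ψ, a, v => (fst a = 0 ∧ Rz φ (snd a) v) ∨ (¬ fst a = 0 ∧ Rz ψ (snd a) v)
  | _, .imp φ ψ, a, v => ∀ b, Rz φ b v → ∃ c, Ev a b c ∧ Rz ψ c v
  | _, .all φ, a, v => ∀ m, ∃ c, Ev a m c ∧ Rz φ c (Matrix.vecCons m v)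
  | _, .ex φ, a, v => Rz φ (snd a) (Matrix.vecCons (fst a) v)

theorem rz_subst {n m : ℕ} (φ : Fml Lpr n) (σ : Fin n → Lpr.Term (Fin m)) (a : N)
    (v : Fin m → N) : Rz (φ.subst σ) a v ↔ Rz φ a (fun i => (σ i).realize v) := by
  induction φ generalizing m a with
  | falsum => rfl
  | eq s t => simp [Fml.subst, Rz]
  | rel R ts => simp [Fml.subst, Rz]
  | and φ ψ ih₁ ih₂ => simp only [Fml.subst, Rz, ih₁, ih₂]
  | or φ ψ ih₁ ih₂ => simp only [Fml.subst, Rz, ih₁, ih₂]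
  | imp φ ψ ih₁ ih₂ => simp only [Fml.subst, Rz, ih₁, ih₂]
  | all φ ih => simp only [Fml.subst, Rz, ih, Fml.realize_up]
  | ex φ ih => simp only [Fml.subst, Rz, ih, Fml.realize_up]

theorem rz_inst {n : ℕ} (φ : Fml Lpr (n + 1)) (t : Lpr.Term (Fin n)) (a : N)
    (v : Fin n → N) : Rz (φ.inst t) a v ↔ Rz φ a (Matrix.vecCons (t.realize v) v) := by
  rw [Fml.inst, rz_subst, Fml.realize_vecCons]
  rfl

theorem DTerm.realize {n : ℕ} (t : Lpr.Term (Fin n)) (V : Fin n → (ℕ → N) → N)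
    (hV : ∀ i, DTerm (V i)) : DTerm (fun v => t.realize fun i => V i v) := by
  induction t with
  | var i => exact hV i
  | func f ts ih => exact DTerm.fn f _ ih

/-- For a fixed formula, realizability is an arithmetical predicate of realizer and arguments, so
induction in `N` applies to it. Letting the arguments be arbitrary terms in the environment makes
the induction pass the binders. -/
theorem Dfn.rz {n : ℕ} (φ : Fml Lpr n) (A : (ℕ → N) → N) (V : Fin n → (ℕ → N) → N)
    (hA : DTerm A) (hV : ∀ i, DTerm (V i)) : Dfn (fun v => Rz φ (A v) fun i => V i v) := by
  have hc : ∀ {n : ℕ} (B : (ℕ → N) → N) (V : Fin n → (ℕ → N) → N) (v : ℕ → N),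
      (fun i => Matrix.vecCons B V i v) = Matrix.vecCons (B v) fun i => V i v := by
    intro n B V v
    funext i
    refine Fin.cases rfl (fun i => rfl) i
  induction φ generalizing A with
  | falsum => exact Dfn.false
  | eq s t =>
    have := DTerm.realize s V hV
    have := DTerm.realize t V hV
    exact Dfn.eq _ _
  | rel R ts => exact Dfn.false
  | and φ ψ ih₁ ih₂ =>
    have := ih₁ (fun v => fst (A v)) V inferInstance hV
    have := ih₂ (fun v => snd (A v)) V inferInstance hV
    exact Dfn.and _ _
  | or φ ψ ih₁ ih₂ =>
    have := ih₁ (fun v => snd (A v)) V inferInstance hV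
    have := ih₂ (fun v => snd (A v)) V inferInstance hV
    exact Dfn.or (fun v => fst (A v) = 0 ∧ _) (fun v => ¬ fst (A v) = 0 ∧ _)
  | imp φ ψ ih₁ ih₂ =>
    have hA' := DTerm.shift A
    have := DTerm.shift _ (hF := hA')
    have h₁ := ih₁ (fun v => v 0) (fun i v => V i fun j => v (j + 1)) inferInstance
      fun i => DTerm.shift _ (hF := hV i)
    have h₂ := ih₂ (fun v => v 0) (fun i v => V i fun j => v (j + 1 + 1)) inferInstance
      fun i => DTerm.shift _ (hF := DTerm.shift _ (hF := hV i))
    have h₃ : Dfn fun v : ℕ → N =>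
        ∃ c, Ev (A fun i => v (i + 1)) (v 0) c ∧ Rz ψ c fun i => V i fun j => v (j + 1) :=
      Dfn.ex (fun c v => Ev (A fun i => v (i + 1)) (v 0) c ∧ Rz ψ c fun i => V i fun j => v (j + 1))
    exact Dfn.all (fun b v => Rz φ b (fun i => V i v) → ∃ c, Ev (A v) b c ∧ Rz ψ c fun i => V i v)
  | all φ ih =>
    have hA' := DTerm.shift A
    have := DTerm.shift _ (hF := hA')
    have h₂ := ih (fun v => v 0) (Matrix.vecCons (fun v => v 1) fun i v =>
      V i fun j => v (j + 1 + 1))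
      inferInstance (Fin.cases (DTerm.var 1) fun i =>
        DTerm.shift _ (hF := DTerm.shift _ (hF := hV i)))
    simp only [hc] at h₂
    have h₃ : Dfn fun v : ℕ → N => ∃ c, Ev (A fun i => v (i + 1)) (v 0) c ∧
        Rz φ c (Matrix.vecCons (v 0) fun i => V i fun j => v (j + 1)) :=
      Dfn.ex (fun c v => Ev (A fun i => v (i + 1)) (v 0) c ∧
        Rz φ c (Matrix.vecCons (v 0) fun i => V i fun j => v (j + 1)))
    exact Dfn.all (fun m v => ∃ c, Ev (A v) m c ∧ Rz φ c (Matrix.vecCons m fun i => V i v))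
  | ex φ ih =>
    have := ih (fun v => snd (A v)) (Matrix.vecCons (fun v => fst (A v)) V) inferInstance
      (Fin.cases (DTerm.fst A) hV)
    simp only [hc] at this
    exact this

/-- The code of a tuple. -/
def code : {n : ℕ} → (Fin n → N) → N
  | 0, _ => 0
  | _ + 1, v => pr (v 0) (code fun i => v i.succ)

/-- Components of the code of a tuple. -/
def dec : {n : ℕ} → N → Fin n → N
  | 0, _ => fun i => i.elim0
  | _ + 1, x => Matrix.vecCons (fst x) (dec (snd x))

theorem code_vecCons {n : ℕ} (a : N) (v : Fin n → N) :
    code (Matrix.vecCons a v) = pr a (code v) := rfl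

/-- `φ` is realized uniformly in its free variables. -/
def Valid (S : Lpr.Substructure N) {n : ℕ} (φ : Fml Lpr n) : Prop :=
  ∃ e ∈ S, ∀ v, ∃ b, Ev e (code v) b ∧ Rz φ b v

theorem Valid.of_rec {S : Lpr.Substructure N} {n : ℕ} {φ : Fml Lpr n} {F : N → N} (hF : Rec S F)
    (h : ∀ v, Rz φ (F (code v)) v) : Valid S φ := by
  obtain ⟨e, he, hF⟩ := hF
  exact ⟨e, he, fun v => ⟨_, hF _, h v⟩⟩

/-! ### Realizability of the axioms of `HA` and of `ECT₀`. -/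

section Validity

variable [PAModel N] {S : Lpr.Substructure N}

theorem dec_code {n : ℕ} (v : Fin n → N) : dec (code v) = v := by
  induction n with
  | zero => exact funext fun i => i.elim0
  | succ n ih =>
    rw [code, dec, fst_pr, snd_pr, ih]
    exact Matrix.cons_head_tail v

theorem Rec.dec {n : ℕ} {F : N → N} (hF : Rec S F) (i : Fin n) :
    Rec S fun x => PAModel.dec (F x) i := by
  induction n generalizing F with
  | zero => exact i.elim0
  | succ n ih => exact Fin.cases hF.fst (fun i => ih hF.snd i) i

theorem Rec.realize {n : ℕ} (t : Lpr.Term (Fin n)) {G : Fin n → N → N}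
    (hG : ∀ i, Rec S (G i)) : Rec S fun x => t.realize fun i => G i x := by
  induction t with
  | var i => exact hG i
  | func f ts ih => exact Rec.fn f ih

theorem Valid.of_mem {n : ℕ} {φ : Fml Lpr n} {a : N} (ha : a ∈ S) (h : ∀ v, Rz φ a v) :
    Valid S φ :=
  Valid.of_rec (Rec.const ha) h

/-- Parametrization turns the uniform realizer into an index of `m ↦ {e}(⟨m, v⟩)`; the swap is
needed because the quantified variable heads the tuple. -/
theorem Valid.all {n : ℕ} {φ : Fml Lpr (n + 1)} (h : Valid S φ) : Valid S φ.all := by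
  obtain ⟨e, he, h⟩ := h
  obtain ⟨F, hF, hc⟩ :=
    ((Computable.of_mem he).comp_rec (Rec.snd'.pair Rec.fst')).curry
  refine Valid.of_rec hF fun v m => ?_
  obtain ⟨b, hb, hb'⟩ := h (Matrix.vecCons m v)
  refine ⟨b, hc _ _ _ ?_, hb'⟩
  simpa [code_vecCons] using hb

theorem Valid.alls {n : ℕ} {φ : Fml Lpr n} (h : Valid S φ) : Valid S φ.alls := by
  induction n with
  | zero => exact h
  | succ n ih => exact ih h.all

theorem exists_index : ∃ e ∈ S, ∀ x : N, Ev e x 0 := Rec.const zero_mem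

theorem valid_eq {n : ℕ} {s t : Lpr.Term (Fin n)} (h : ∀ v : Fin n → N, s.realize v = t.realize v) :
    Valid S (Fml.eq s t) :=
  Valid.of_mem zero_mem h

theorem valid_exists_fn {n : ℕ} (f : PR n) :
    Valid S (Fml.ex (Fml.eq (Language.Term.var 0) (f.app fun i => Language.Term.var i.succ))) := by
  refine Valid.of_rec ((Rec.fn f fun i => Rec.id'.dec i).pair (Rec.const zero_mem)) fun v => ?_
  simp only [Rz, dec_code, fst_pr]
  rfl

/-- The distance of the two numbers is `0` exactly when they are equal, so it serves as the tag
selecting the disjunct. -/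
theorem valid_eq_or_ne : Valid S ((Fml.eq (Language.Term.var 0) (Language.Term.var 1)).or
    (Fml.eq (Language.Term.var (0 : Fin 2)) (Language.Term.var 1)).neg) := by
  refine Valid.of_rec ((Rec.fn2 PR.dist (Rec.id'.dec (n := 2) 0) (Rec.id'.dec (n := 2) 1)).pair
    (Rec.const zero_mem)) fun v => ?_
  simp only [Rz, Fml.neg, dec_code, fst_pr, snd_pr, fn_dist_eq_zero, Language.Term.realize_var]
  by_cases h : v 0 = v 1
  · exact Or.inl ⟨h, h⟩
  · exact Or.inr ⟨h, fun _ h' => absurd h' h⟩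

theorem valid_axQ {σ : Fml Lpr 0} (h : AxQ σ) : Valid S σ := by
  obtain ⟨e, he, hE⟩ := exists_index (S := S)
  have hq : ∀ {n : ℕ} {s t : Lpr.Term (Fin n)}, AxQ (Fml.eq s t).alls →
      Valid S (Fml.eq s t).alls := fun h =>
    (valid_eq fun v => realize_of_mem (Or.inl h) v).alls
  cases h with
  | succ_ne_zero =>
    refine (Valid.of_mem zero_mem fun v b hb => ?_).alls
    exact (realize_of_mem (N := N) (Or.inl AxQ.succ_ne_zero) v hb).elim
  | succ_inj =>
    refine (Valid.of_mem he fun v b hb => ⟨0, hE b, ?_⟩).alls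
    exact realize_of_mem (N := N) (Or.inl AxQ.succ_inj) v hb
  | zero_or_succ =>
    refine (Valid.of_rec ((Rec.id'.dec (n := 1) 0).pair
      ((Rec.fn1 PR.pred (Rec.id'.dec (n := 1) 0)).pair (Rec.const zero_mem))) fun v => ?_).alls
    simp only [Rz, dec_code, fst_pr, snd_pr, realize_tZero, realize_tSucc]
    change (v 0 = 0 ∧ v 0 = 0) ∨ (¬ v 0 = 0 ∧ v 0 = PR.succ.fn ![pred (v 0)])
    rw [succ_eq]
    by_cases h : v 0 = 0
    · exact Or.inl ⟨h, h⟩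
    · obtain ⟨b, hb⟩ := pos_iff_exists.1 h
      exact Or.inr ⟨h, by rw [hb, pred_succ]⟩
  | add_zero => exact hq AxQ.add_zero
  | add_succ => exact hq AxQ.add_succ
  | mul_zero => exact hq AxQ.mul_zero
  | mul_succ => exact hq AxQ.mul_succ

theorem valid_axPR {σ : Fml Lpr 0} (h : AxPR σ) : Valid S σ := by
  have hq : ∀ {n : ℕ} {s t : Lpr.Term (Fin n)}, AxPR (Fml.eq s t).alls →
      Valid S (Fml.eq s t).alls := fun h =>
    (valid_eq fun v => realize_of_mem (Or.inr (Or.inl h)) v).alls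
  cases h with
  | proj i => exact hq (AxPR.proj i)
  | comp f g => exact hq (AxPR.comp f g)
  | prec_zero f g => exact hq (AxPR.prec_zero f g)
  | prec_succ f g => exact hq (AxPR.prec_succ f g)

/-- A realizer of the conclusion iterates the realizer of the induction step by primitive recursion,
starting from the realizer of the base case; induction in `N` shows that it is defined and correct.
-/
theorem valid_indAxiom {n : ℕ} (φ : Fml Lpr (n + 1)) : Valid S (indAxiom φ) := by
  obtain ⟨a, ha, hA⟩ := Rec.fst' (S := S)
  -- Here `x = ⟨c, ⟨m, y⟩⟩`, where `c` realizes the premise and `y` realizes `φ(m)`: the step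
  -- component of `c` is applied to `m`, and the result to `y`.
  have hstep : Computable S fun x z => ∃ f, Ev (snd (fst x)) (fst (snd x)) f ∧
      Ev f (snd (snd x)) z := by
    refine ((Rec.fst'.snd.computable.ap Rec.snd'.fst.computable).ap
      Rec.snd'.snd.computable).mono ?_
    rintro x z ⟨f, h₁, h₂⟩
    exact ⟨f, _, ⟨_, _, rfl, rfl, h₁⟩, rfl, h₂⟩
  obtain ⟨b, hb, hB⟩ := hstep
  obtain ⟨F, ⟨e, he, hE⟩, hF⟩ :=
    (Computable.of_mem (S := S) (pr_mem (tag_mem 6) (pr_mem ha hb))).curry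
  refine (Valid.of_mem he fun v c hc => ⟨F c, hE c, ?_⟩).alls
  obtain ⟨h₀, hs⟩ := hc
  rw [rz_inst, realize_tZero] at h₀
  have key : ∀ m : N, ∃ y, Ev (pr (tag 6) (pr a b)) (pr c m) y ∧ Rz φ y (Matrix.vecCons m v) := by
    have hd : Dfn fun w : ℕ → N => Rz φ (w 0) (Matrix.vecCons (w 1) v) := by
      have := Dfn.rz φ (fun w => w 0) (Matrix.vecCons (fun w => w 1) fun i _ => v i) inferInstance
        (Fin.cases (DTerm.var 1) fun i => DTerm.const (v i))
      refine Dfn.congr (fun w => iff_of_eq (congrArg _ (funext fun i => ?_))) (hQ := this)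
      refine Fin.cases rfl (fun i => rfl) i
    refine induct (P := fun m : N => ∃ y, Ev (pr (tag 6) (pr a b)) (pr c m) y ∧
      Rz φ y (Matrix.vecCons m v)) ⟨_, ev_prec_zero (hA c), h₀⟩ ?_
    rintro m ⟨y, hy, hy'⟩
    obtain ⟨f, hf, hf'⟩ := hs m
    obtain ⟨z, hz, hz'⟩ := hf' y hy'
    rw [rz_subst, Fml.realize_vecCons, realize_tSucc] at hz'
    refine ⟨z, ev_prec_succ hy (hB _ _ ⟨f, by simpa using hf, by simpa using hz⟩), ?_⟩
    rw [← succ_eq]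
    exact hz'
  intro m
  obtain ⟨y, hy, hr⟩ := key m
  exact ⟨y, hF _ _ _ hy, hr⟩

/-- Realizable almost negative formulas have canonical realizers. -/
theorem exists_canonical_realizer {n : ℕ} {φ : Fml Lpr n} (hφ : φ.IsAlmostNegative) :
    ∃ e ∈ S, ∀ v a, Rz φ a v → ∃ b, Ev e (code v) b ∧ Rz φ b v := by
  obtain ⟨e₀, he₀, hE₀⟩ := exists_index (S := S)
  induction φ with
  | falsum => exact ⟨0, zero_mem, fun v a h => h.elim⟩
  | eq s t => exact ⟨e₀, he₀, fun v a h => ⟨0, hE₀ _, h⟩⟩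
  | rel R ts => exact nomatch R
  | and φ ψ ih₁ ih₂ =>
    obtain ⟨e₁, he₁, h₁⟩ := ih₁ hφ.1
    obtain ⟨e₂, he₂, h₂⟩ := ih₂ hφ.2
    refine ⟨_, pr_mem (tag_mem 4) (pr_mem he₁ he₂), fun v a h => ?_⟩
    obtain ⟨b₁, hb₁, hr₁⟩ := h₁ v _ h.1
    obtain ⟨b₂, hb₂, hr₂⟩ := h₂ v _ h.2
    exact ⟨_, ev_pair hb₁ hb₂, by rwa [fst_pr], by rwa [snd_pr]⟩
  | or φ ψ ih₁ ih₂ => exact hφ.elim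
  | imp φ ψ ih₁ ih₂ =>
    obtain ⟨e₂, he₂, h₂⟩ := ih₂ hφ.2
    obtain ⟨F, ⟨e, he, hE⟩, hF⟩ := ((Computable.of_mem he₂).comp_rec Rec.fst').curry
    refine ⟨e, he, fun v a h => ⟨_, hE _, fun x hx => ?_⟩⟩
    -- The given realizer only shows that the conclusion is realizable; its value is discarded and
    -- replaced by the canonical one, which does not depend on `x`.
    obtain ⟨c, -, hc⟩ := h x hx
    obtain ⟨b, hb, hr⟩ := h₂ v c hc
    exact ⟨b, hF _ _ _ (by simpa using hb), hr⟩
  | all φ ih =>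
    obtain ⟨e₂, he₂, h₂⟩ := ih hφ
    obtain ⟨F, ⟨e, he, hE⟩, hF⟩ :=
      ((Computable.of_mem he₂).comp_rec (Rec.snd'.pair Rec.fst')).curry
    refine ⟨e, he, fun v a h => ⟨_, hE _, fun m => ?_⟩⟩
    obtain ⟨c, -, hc⟩ := h m
    obtain ⟨b, hb, hr⟩ := h₂ _ c hc
    exact ⟨b, hF _ _ _ (by simpa [code_vecCons] using hb), hr⟩
  | @ex n φ ih =>
    cases φ with
    | falsum => exact ⟨0, zero_mem, fun v a h => h.elim⟩
    | eq s t =>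
      have hG : ∀ i : Fin (n + 1), Rec S fun x : N => Matrix.vecCons (snd x) (dec (fst x)) i :=
        Fin.cases Rec.snd' fun i => Rec.fst'.dec i
      -- A witness of an atomic formula is found by search, which halts because some realizer
      -- supplies a witness.
      obtain ⟨e, he, hs⟩ := (Rec.fn2 PR.dist (Rec.realize s hG) (Rec.realize t hG)).search
      obtain ⟨d, hd, hD⟩ := (Rec.id' (S := S)).pair (Rec.const zero_mem)
      refine ⟨_, pr_mem (tag_mem 5) (pr_mem hd he), fun v a h => ?_⟩
      obtain ⟨y, hy, hy'⟩ := hs (code v) (fst a) (by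
        rw [fn_dist_eq_zero, fst_pr, snd_pr, dec_code]
        exact h)
      rw [fn_dist_eq_zero, fst_pr, snd_pr, dec_code] at hy'
      refine ⟨_, ev_comp hy (hD y), ?_⟩
      simp only [Rz, fst_pr]
      exact hy'
    | rel R ts => exact nomatch R
    | and φ ψ => exact hφ.elim
    | or φ ψ => exact hφ.elim
    | imp φ ψ => exact hφ.elim
    | all φ => exact hφ.elim
    | ex φ => exact hφ.elim

/-- A realizer `f` of the premise, fed with the canonical realizer of `φ(x)`, yields a witness as a
computable function of `x` alone. Its index is the required `z`, and `u` is found by searching for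
the computation. The realizer of `φ(x)` that is actually supplied can be ignored. -/
theorem valid_ectAxiom {n : ℕ} {φ : Fml Lpr (n + 1)} (hφ : φ.IsAlmostNegative)
    (ψ : Fml Lpr (n + 2)) : Valid S (ectAxiom φ ψ) := by
  obtain ⟨e, he, hcan⟩ := exists_canonical_realizer (S := S) hφ
  -- With `p = ⟨⟨v, f⟩, x⟩`: `g` is `{f}(x)`, `b` is the canonical realizer of `φ(x, v)`, and `w =
  -- {g}(b)` realizes `∃ y ψ`, with witness `fst w`.
  let W : N → N → Prop := fun p w => ∃ g b, Ev (snd (fst p)) (snd p) g ∧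
    Ev e (pr (snd p) (fst (fst p))) b ∧ Ev g b w
  have hW : Computable S W := by
    refine ((Rec.fst'.snd.computable.ap Rec.snd'.computable).ap
      ((Computable.of_mem he).comp_rec (Rec.snd'.pair Rec.fst'.fst))).mono ?_
    rintro p w ⟨g, b, h₁, h₂, h₃⟩
    exact ⟨g, b, ⟨_, _, rfl, rfl, h₁⟩, h₂, h₃⟩
  obtain ⟨Fz, hFz, hz⟩ := (Computable.rec_comp Rec.fst' hW).curry
  obtain ⟨es, hes, hs⟩ := Rec.search (S := S) (F := fun q : N => PR.kleeneT.fn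
    ![Fz (fst (fst q)), snd (fst q), snd q])
    (Rec.fn3 _ (hFz.comp Rec.fst'.fst) Rec.fst'.snd Rec.snd')
  -- From `p`, and whatever realizer of `φ` is given, `FB` outputs `⟨u, ⟨0, snd w⟩⟩`: the
  -- computation, a dummy realizer of `T = 0`, and the realizer of `ψ`. `FC` and `FD` then abstract
  -- over `x` and over `f`.
  obtain ⟨FB, hFB, hB⟩ := (((Computable.of_mem hes).comp_rec (Rec.fst' (S := S))).pair
    ((Rec.const (zero_mem (S := S))).computable.pair
      (Computable.rec_comp Rec.snd' (hW.comp_rec Rec.fst')))).curry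
  obtain ⟨FC, hFC, hC⟩ := hFB.computable.curry
  obtain ⟨FD, hFD, hD⟩ := (hFz.pair hFC).computable.curry
  refine (Valid.of_rec hFD fun v f hf => ⟨_, hD _ _ _ rfl, ?_⟩).alls
  intro x
  refine ⟨FB (pr (pr (code v) f) x), by rw [snd_pr]; exact hC _ _ _ rfl, fun a ha => ?_⟩
  rw [rz_subst, Fml.realize_vecCons] at ha
  obtain ⟨b, hb, hb'⟩ := hcan (Matrix.vecCons x v) a ha
  obtain ⟨g, hg, hg'⟩ := hf x
  obtain ⟨w, hw, hw'⟩ := hg' b hb'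
  have hWw : W (pr (pr (code v) f) x) w := by
    refine ⟨g, b, ?_, ?_, hw⟩
    · simpa using hg
    · simpa [code_vecCons] using hb
  have hev := hz _ _ _ ⟨w, hWw, rfl⟩
  obtain ⟨u₀, hu₀, hU₀⟩ := hev
  obtain ⟨u, hu, hu'⟩ := hs (pr (pr (code v) f) x) u₀ (by simpa using hu₀)
  simp only [fst_pr, snd_pr] at hu'
  -- The computation found by search need not be `u₀`, but it has the same value.
  have hU : PR.kleeneU.fn ![u] = fst w := Ev.unique ⟨u, hu', rfl⟩ ⟨u₀, hu₀, hU₀⟩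
  refine ⟨pr u (pr 0 (snd w)), hB _ _ _ ?_, ?_, ?_⟩
  · simp only [fst_pr, snd_pr]
    exact ⟨hu, trivial, w, hWw, rfl⟩
  · simp only [fst_pr]
    have : ∀ z : N, (PR.kleeneT.app ![tv 2, tv 1, tv 0] : Lpr.Term (Fin (n + 3))).realize
        (Matrix.vecCons u (Matrix.vecCons x (Matrix.vecCons z v))) =
          PR.kleeneT.fn ![z, x, u] := fun z => by
      rw [PR.realize_app]
      congr 1; funext i; fin_cases i <;> rfl
    change (PR.kleeneT.app _).realize _ = tZero.realize _
    rw [this, realize_tZero, hu']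
    rfl
  · simp only [fst_pr, snd_pr]
    rw [rz_subst, Fml.realize_vecCons, Fml.realize_vecCons]
    have : (PR.kleeneU.app ![tv 0] : Lpr.Term (Fin (n + 3))).realize
        (Matrix.vecCons u (Matrix.vecCons x (Matrix.vecCons (Fz (pr (code v) f)) v))) = fst w := by
      rw [← hU, PR.realize_app]
      congr 1; funext i; fin_cases i; rfl
    rw [this]
    exact hw'

end Validity

end PAModel

/-! ### Prime theories with Henkin witnesses -/

/-- Names for the elements of the domains of canonical models: the elements of `M`, and for every
level `j` a fresh name and a witness for every existential formula. -/
inductive Name (M : Type u) : Type u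
  | base (m : M) : Name M
  | fresh (j : ℕ) : Name M
  | wit (j : ℕ) {n : ℕ} (φ : Fml Lpr (n + 1)) (v : Fin n → Name M) : Name M

namespace Name

variable {M : Type u}

/-- The level at which a name is introduced. -/
def lvl : Name M → ℕ
  | base _ => 0
  | fresh j => j + 1
  | wit j _ _ => j + 1

/-- Names that do not denote an element of `M`. -/
def IsVar : Name M → Prop
  | base _ => False
  | _ => True

end Name

/-- A formula with names as parameters. -/
structure PF (M : Type u) where
  {n : ℕ}
  fml : Fml Lpr n
  par : Fin n → Name M

/-- All parameters of `p` are in `D`. -/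
def PF.Over {M : Type u} (p : PF M) (D : Set (Name M)) : Prop := ∀ i, p.par i ∈ D

/-- An interpretation of formulas with names in a preordered set `H` with implication, with a
uniform quantification `bind y` over the values of the name `y`, and with an existence predicate
`E`. -/
structure Doctrine (M : Type u) where
  H : Type u
  le : H → H → Prop
  top : H
  inf : H → H → H
  imp : H → H → H
  bind : Name M → H → H
  Indep : Name M → H → Prop
  E : Name M → H
  int : {n : ℕ} → Fml Lpr n → (Fin n → Name M) → H
  le_refl : ∀ P, le P P
  le_trans : ∀ {P Q R}, le P Q → le Q R → le P R
  le_top : ∀ P, le P top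
  inf_le_left : ∀ P Q, le (inf P Q) P
  inf_le_right : ∀ P Q, le (inf P Q) Q
  le_inf : ∀ {P Q R}, le P Q → le P R → le P (inf Q R)
  le_imp : ∀ {P Q R}, le (inf P Q) R → le P (imp Q R)
  imp_inf_le : ∀ P Q, le (inf (imp P Q) P) Q
  bind_mono : ∀ {y P Q}, y.IsVar → le P Q → le (bind y P) (bind y Q)
  le_bind : ∀ {y P}, y.IsVar → Indep y P → le P (bind y P)
  top_le_bind : ∀ y, le top (bind y top)
  bind_inf : ∀ {y} P Q, le (inf (bind y P) (bind y Q)) (bind y (inf P Q))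
  indep_int : ∀ {y n} (φ : Fml Lpr n) {v : Fin n → Name M}, (∀ i, v i ≠ y) → Indep y (int φ v)
  indep_E : ∀ {x y}, x ≠ y → Indep y (E x)
  falsum_le : ∀ {n m} (v : Fin n → Name M) (φ : Fml Lpr m) w, le (int .falsum v) (int φ w)
  and_le_left : ∀ {n} (φ ψ : Fml Lpr n) v, le (int (φ.and ψ) v) (int φ v)
  and_le_right : ∀ {n} (φ ψ : Fml Lpr n) v, le (int (φ.and ψ) v) (int ψ v)
  inf_le_and : ∀ {n} (φ ψ : Fml Lpr n) v, le (inf (int φ v) (int ψ v)) (int (φ.and ψ) v)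
  le_or_left : ∀ {n} (φ ψ : Fml Lpr n) v, le (int φ v) (int (φ.or ψ) v)
  le_or_right : ∀ {n} (φ ψ : Fml Lpr n) v, le (int ψ v) (int (φ.or ψ) v)
  or_le : ∀ {n} {φ ψ : Fml Lpr n} {v R}, le (int φ v) R → le (int ψ v) R → le (int (φ.or ψ) v) R
  imp_le : ∀ {n} (φ ψ : Fml Lpr n) v, le (int (φ.imp ψ) v) (imp (int φ v) (int ψ v))
  le_imp_int : ∀ {n} (φ ψ : Fml Lpr n) v, le (imp (int φ v) (int ψ v)) (int (φ.imp ψ) v)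
  all_elim : ∀ {n} (φ : Fml Lpr (n + 1)) v x,
    le (inf (int φ.all v) (E x)) (int φ (Matrix.vecCons x v))
  all_intro : ∀ {n} (φ : Fml Lpr (n + 1)) {v : Fin n → Name M} {y}, y.IsVar → (∀ i, v i ≠ y) →
    le (bind y (imp (E y) (int φ (Matrix.vecCons y v)))) (int φ.all v)
  ex_intro : ∀ {n} (φ : Fml Lpr (n + 1)) v x,
    le (inf (E x) (int φ (Matrix.vecCons x v))) (int φ.ex v)
  ex_elim : ∀ {n} (φ : Fml Lpr (n + 1)) {v : Fin n → Name M} {y Q}, y.IsVar → (∀ i, v i ≠ y) →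
    Indep y Q → le (bind y (imp (inf (E y) (int φ (Matrix.vecCons y v))) Q)) (imp (int φ.ex v) Q)
  int_subst_var : ∀ {n m} (φ : Fml Lpr n) (r : Fin n → Fin m) (v : Fin m → Name M),
    int (φ.subst fun i => Language.Term.var (r i)) v = int φ fun i => v (r i)
  eq_refl : ∀ {n} (t : Lpr.Term (Fin n)) v, le top (int (.eq t t) v)
  eq_subst : ∀ {n} (φ : Fml Lpr (n + 1)) (s t : Lpr.Term (Fin n)) v,
    le (inf (int (.eq s t) v) (int (φ.inst s) v)) (int (φ.inst t) v)
  exists_fn : ∀ {n} (f : PR n) v, le top (int (Fml.alls (Fml.ex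
    (.eq (Language.Term.var 0) (f.app fun i => Language.Term.var i.succ)))) v)
  eq_or_ne : ∀ v, le top (int (Fml.alls (n := 2)
    ((Fml.eq (Language.Term.var 0) (Language.Term.var 1)).or
      (Fml.eq (Language.Term.var 0) (Language.Term.var 1)).neg)) v)

namespace Doctrine

variable {M : Type u} (𝓓 : Doctrine M)

/-- Derivability from a set of assumptions. -/
inductive Der (G : Set 𝓓.H) : 𝓓.H → Prop
  | mem {P} : P ∈ G → Der G P
  | top : Der G 𝓓.top
  | le {P Q} : Der G P → 𝓓.le P Q → Der G Q
  | inf {P Q} : Der G P → Der G Q → Der G (𝓓.inf P Q)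

/-- The assumptions given by a set of formulas and a domain. -/
def gen (D : Set (Name M)) (Γ : Set (PF M)) : Set 𝓓.H :=
  {P | (∃ p ∈ Γ, P = 𝓓.int p.fml p.par) ∨ ∃ x ∈ D, P = 𝓓.E x}

variable {𝓓}

theorem Der.cut {G G' : Set 𝓓.H} (h : ∀ P ∈ G', 𝓓.Der G P) {P : 𝓓.H} (hP : 𝓓.Der G' P) :
    𝓓.Der G P := by
  induction hP with
  | mem hm => exact h _ hm
  | top => exact .top
  | le _ hl ih => exact ih.le hl
  | inf _ _ ih₁ ih₂ => exact ih₁.inf ih₂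

theorem Der.mono {G G' : Set 𝓓.H} (h : G' ⊆ G) {P : 𝓓.H} (hP : 𝓓.Der G' P) : 𝓓.Der G P :=
  hP.cut fun _ hm => .mem (h hm)

theorem Der.mp {G : Set 𝓓.H} {P Q : 𝓓.H} (h : 𝓓.Der G (𝓓.imp P Q)) (hP : 𝓓.Der G P) :
    𝓓.Der G Q :=
  (h.inf hP).le (𝓓.imp_inf_le P Q)

/-- A derivation only forms finite meets and passes to weaker elements, and both operations commute
with `imp P`. -/
theorem Der.deduct {G : Set 𝓓.H} {P Q : 𝓓.H} (h : 𝓓.Der (insert P G) Q) :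
    𝓓.Der G (𝓓.imp P Q) := by
  induction h with
  | mem hm =>
    rcases hm with rfl | hm
    · exact Der.top.le (𝓓.le_imp (𝓓.inf_le_right _ _))
    · exact (Der.mem hm).le (𝓓.le_imp (𝓓.inf_le_left _ _))
  | top => exact Der.top.le (𝓓.le_imp (𝓓.inf_le_left _ _))
  | le _ hl ih => exact ih.le (𝓓.le_imp (𝓓.le_trans (𝓓.imp_inf_le _ _) hl))
  | inf _ _ ih₁ ih₂ =>
    refine (ih₁.inf ih₂).le (𝓓.le_imp (𝓓.le_inf ?_ ?_))
    · exact 𝓓.le_trans (𝓓.le_inf (𝓓.le_trans (𝓓.inf_le_left _ _) (𝓓.inf_le_left _ _))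
        (𝓓.inf_le_right _ _)) (𝓓.imp_inf_le _ _)
    · exact 𝓓.le_trans (𝓓.le_inf (𝓓.le_trans (𝓓.inf_le_left _ _) (𝓓.inf_le_right _ _))
        (𝓓.inf_le_right _ _)) (𝓓.imp_inf_le _ _)

/-- Generalization over a name on which no assumption depends. -/
theorem Der.bind {G : Set 𝓓.H} {y : Name M} (hy : y.IsVar) (hG : ∀ P ∈ G, 𝓓.Indep y P)
    {P : 𝓓.H} (h : 𝓓.Der G P) : 𝓓.Der G (𝓓.bind y P) := by
  induction h with
  | mem hm => exact (Der.mem hm).le (𝓓.le_bind hy (hG _ hm))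
  | top => exact Der.top.le (𝓓.top_le_bind y)
  | le _ hl ih => exact ih.le (𝓓.bind_mono hy hl)
  | inf _ _ ih₁ ih₂ => exact (ih₁.inf ih₂).le (𝓓.bind_inf _ _)

theorem gen_mono {D D' : Set (Name M)} {Γ Γ' : Set (PF M)} (hD : D ⊆ D') (hΓ : Γ ⊆ Γ') :
    𝓓.gen D Γ ⊆ 𝓓.gen D' Γ' := by
  rintro P (⟨p, hp, rfl⟩ | ⟨x, hx, rfl⟩)
  · exact Or.inl ⟨p, hΓ hp, rfl⟩
  · exact Or.inr ⟨x, hD hx, rfl⟩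

theorem gen_insert (D : Set (Name M)) (Γ : Set (PF M)) (p : PF M) :
    𝓓.gen D (insert p Γ) = insert (𝓓.int p.fml p.par) (𝓓.gen D Γ) := by
  ext P
  simp only [gen, Set.mem_ofPred_eq, Set.mem_insert_iff, exists_eq_or_imp]
  exact or_assoc

theorem gen_insert_dom (D : Set (Name M)) (Γ : Set (PF M)) (x : Name M) :
    𝓓.gen (insert x D) Γ = insert (𝓓.E x) (𝓓.gen D Γ) := by
  ext P
  simp only [gen, Set.mem_ofPred_eq, Set.mem_insert_iff, exists_eq_or_imp]
  exact or_left_comm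

theorem indep_gen {D : Set (Name M)} {Γ : Set (PF M)} (hΓ : ∀ p ∈ Γ, p.Over D) {y : Name M}
    (hy : y ∉ D) : ∀ P ∈ 𝓓.gen D Γ, 𝓓.Indep y P := by
  rintro P (⟨p, hp, rfl⟩ | ⟨x, hx, rfl⟩)
  · exact 𝓓.indep_int _ fun i h => hy (h ▸ hΓ p hp i)
  · exact 𝓓.indep_E fun h => hy (h ▸ hx)

variable (𝓓) in
/-- A deductively closed consistent set of formulas over a domain that has the disjunction and the
existence property. -/
structure IsPrime (D : Set (Name M)) (Γ : Set (PF M)) : Prop where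
  par_mem : ∀ p ∈ Γ, p.Over D
  closed : ∀ p : PF M, p.Over D → 𝓓.Der (𝓓.gen D Γ) (𝓓.int p.fml p.par) → p ∈ Γ
  prime : ∀ {n : ℕ} (φ ψ : Fml Lpr n) v, ⟨φ.or ψ, v⟩ ∈ Γ → ⟨φ, v⟩ ∈ Γ ∨ ⟨ψ, v⟩ ∈ Γ
  sat : ∀ {n : ℕ} (φ : Fml Lpr (n + 1)) v, ⟨φ.ex, v⟩ ∈ Γ → ∃ x ∈ D, ⟨φ, Matrix.vecCons x v⟩ ∈ Γ
  cons : ∀ {n : ℕ} (v : Fin n → Name M), ⟨.falsum, v⟩ ∉ Γ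

/-- A pair of domain and theory that is maximal among those not deriving `q` is prime: every formula
outside it implies `q`, so a disjunction with both disjuncts outside would derive `q`. The witness
names of level `j` are absent at the start and may enter only together with the formula they
witness. -/
theorem exists_isPrime {D₀ : Set (Name M)} {Γ₀ : Set (PF M)} (hΓ₀ : ∀ p ∈ Γ₀, p.Over D₀) {j : ℕ}
    (hlvl : ∀ x ∈ D₀, x.lvl ≤ j + 1)
    (hwit : ∀ {n : ℕ} (φ : Fml Lpr (n + 1)) v, Name.wit j φ v ∉ D₀) {q : PF M} (hq : q.Over D₀)
    (hnot : ¬ 𝓓.Der (𝓓.gen D₀ Γ₀) (𝓓.int q.fml q.par)) :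
    ∃ D Γ, 𝓓.IsPrime D Γ ∧ D₀ ⊆ D ∧ Γ₀ ⊆ Γ ∧ (∀ x ∈ D, x.lvl ≤ j + 1) ∧ q ∉ Γ := by
  let s : Set (Set (Name M) × Set (PF M)) := {z | (∀ p ∈ z.2, p.Over z.1) ∧ D₀ ⊆ z.1 ∧ Γ₀ ⊆ z.2 ∧
    (∀ x ∈ z.1, x.lvl ≤ j + 1) ∧
    (∀ {n : ℕ} (φ : Fml Lpr (n + 1)) v, Name.wit j φ v ∈ z.1 →
      (⟨φ, Matrix.vecCons (Name.wit j φ v) v⟩ : PF M) ∈ z.2) ∧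
    ¬ 𝓓.Der (𝓓.gen z.1 z.2) (𝓓.int q.fml q.par)}
  obtain ⟨⟨D, Γ⟩, -, hmax⟩ := zorn_le_nonempty₀ s (by
    intro c hcs hc y hy
    refine ⟨(⋃ z ∈ c, z.1, ⋃ z ∈ c, z.2), ⟨?_, ?_, ?_, ?_, ?_, ?_⟩, fun z hz => ⟨?_, ?_⟩⟩
    · intro p hp i
      simp only [Set.mem_iUnion] at hp ⊢
      obtain ⟨z, hz, hp⟩ := hp
      exact ⟨z, hz, (hcs hz).1 p hp i⟩
    · exact (hcs hy).2.1.trans (Set.subset_biUnion_of_mem (u := fun z => z.1) hy)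
    · exact (hcs hy).2.2.1.trans (Set.subset_biUnion_of_mem (u := fun z => z.2) hy)
    · intro x hx
      simp only [Set.mem_iUnion] at hx
      obtain ⟨z, hz, hx⟩ := hx
      exact (hcs hz).2.2.2.1 x hx
    · intro n φ v hx
      simp only [Set.mem_iUnion] at hx ⊢
      obtain ⟨z, hz, hx⟩ := hx
      exact ⟨z, hz, (hcs hz).2.2.2.2.1 φ v hx⟩
    · intro h
      -- A derivation uses finitely many assumptions, so it already lives in one member of the
      -- chain.
      have key : ∃ z ∈ c, 𝓓.Der (𝓓.gen z.1 z.2) (𝓓.int q.fml q.par) := by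
        generalize 𝓓.int q.fml q.par = P at h
        induction h with
        | mem hm =>
          rcases hm with ⟨p, hp, rfl⟩ | ⟨x, hx, rfl⟩
          · simp only [Set.mem_iUnion] at hp
            obtain ⟨z, hz, hp⟩ := hp
            exact ⟨z, hz, .mem (Or.inl ⟨p, hp, rfl⟩)⟩
          · simp only [Set.mem_iUnion] at hx
            obtain ⟨z, hz, hx⟩ := hx
            exact ⟨z, hz, .mem (Or.inr ⟨x, hx, rfl⟩)⟩
        | top => exact ⟨y, hy, .top⟩
        | le _ hl ih =>
          obtain ⟨z, hz, ih⟩ := ih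
          exact ⟨z, hz, ih.le hl⟩
        | inf _ _ ih₁ ih₂ =>
          obtain ⟨z₁, hz₁, ih₁⟩ := ih₁
          obtain ⟨z₂, hz₂, ih₂⟩ := ih₂
          rcases hc.total hz₁ hz₂ with h | h
          · exact ⟨z₂, hz₂, (ih₁.mono (gen_mono h.1 h.2)).inf ih₂⟩
          · exact ⟨z₁, hz₁, ih₁.inf (ih₂.mono (gen_mono h.1 h.2))⟩
      obtain ⟨z, hz, h⟩ := key
      exact (hcs hz).2.2.2.2.2 h
    · exact Set.subset_biUnion_of_mem (u := fun z => z.1) hz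
    · exact Set.subset_biUnion_of_mem (u := fun z => z.2) hz)
    (D₀, Γ₀) ⟨hΓ₀, subset_rfl, subset_rfl, hlvl, fun φ v h => absurd h (hwit φ v), hnot⟩
  obtain ⟨⟨hover, hD, hΓ, hl, hw, hn⟩, hmax⟩ := hmax
  dsimp only at hover hD hΓ hl hw hn
  -- By maximality, adding `p` makes `q` derivable; then apply the deduction theorem.
  have hadd : ∀ p : PF M, p.Over D → p ∉ Γ →
      𝓓.Der (𝓓.gen D Γ) (𝓓.imp (𝓓.int p.fml p.par) (𝓓.int q.fml q.par)) := by
    intro p hp hpΓ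
    by_contra hc
    have hm : (D, insert p Γ) ∈ s := by
      refine ⟨?_, hD, hΓ.trans (Set.subset_insert _ _), hl,
        fun φ v h => Set.mem_insert_of_mem _ (hw φ v h), fun h => hc ?_⟩
      · rintro p' (rfl | h)
        · exact hp
        · exact hover p' h
      · dsimp only at h
        rw [gen_insert] at h
        exact h.deduct
    exact hpΓ ((hmax hm ⟨subset_rfl, Set.subset_insert _ _⟩).2 (Set.mem_insert _ _))
  have closed : ∀ p : PF M, p.Over D → 𝓓.Der (𝓓.gen D Γ) (𝓓.int p.fml p.par) → p ∈ Γ := by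
    intro p hp h
    by_contra hpΓ
    exact hn ((hadd p hp hpΓ).mp h)
  have hqΓ : q ∉ Γ := fun h => hn (.mem (Or.inl ⟨q, h, rfl⟩))
  refine ⟨D, Γ, ⟨hover, closed, ?_, ?_, ?_⟩, hD, hΓ, hl, hqΓ⟩
  · intro n φ ψ v h
    by_contra! hc
    have ho : ∀ i, v i ∈ D := hover _ h
    have h₁ := hadd ⟨φ, v⟩ ho hc.1
    have h₂ := hadd ⟨ψ, v⟩ ho hc.2
    have h₃ := 𝓓.or_le (φ := φ) (ψ := ψ) (v := v)
      (𝓓.le_imp (Q := 𝓓.inf (𝓓.imp (𝓓.int φ v) (𝓓.int q.fml q.par))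
        (𝓓.imp (𝓓.int ψ v) (𝓓.int q.fml q.par))) (R := 𝓓.int q.fml q.par)
        (𝓓.le_trans (𝓓.le_inf (𝓓.le_trans (𝓓.inf_le_right _ _) (𝓓.inf_le_left _ _))
          (𝓓.inf_le_left _ _)) (𝓓.imp_inf_le _ _)))
      (𝓓.le_imp (𝓓.le_trans (𝓓.le_inf (𝓓.le_trans (𝓓.inf_le_right _ _) (𝓓.inf_le_right _ _))
          (𝓓.inf_le_left _ _)) (𝓓.imp_inf_le _ _)))
    exact hn (((Der.mem (Or.inl ⟨_, h, rfl⟩)).le h₃).mp (h₁.inf h₂))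
  · intro n φ v h
    have ho : ∀ i, v i ∈ D := hover _ h
    by_cases hx : Name.wit j φ v ∈ D
    · exact ⟨_, hx, hw φ v hx⟩
    exfalso
    -- The witness name is new to `Γ` and to `q`, so existential elimination shows that adding it
    -- still does not derive `q`, contrary to maximality.
    have hm : (insert (Name.wit j φ v) D, insert ⟨φ, Matrix.vecCons (Name.wit j φ v) v⟩ Γ) ∈ s := by
      refine ⟨?_, hD.trans (Set.subset_insert _ _), hΓ.trans (Set.subset_insert _ _), ?_, ?_, ?_⟩
      · rintro p (rfl | hp) i
        · exact Fin.cases (Set.mem_insert _ _) (fun i => Set.mem_insert_of_mem _ (ho i)) i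
        · exact Set.mem_insert_of_mem _ (hover p hp i)
      · rintro x (rfl | hx)
        · exact le_rfl
        · exact hl x hx
      · intro n' φ' v' h'
        rcases h' with h' | h'
        · cases h'
          exact Set.mem_insert _ _
        · exact Set.mem_insert_of_mem _ (hw φ' v' h')
      · intro hd
        dsimp only at hd
        rw [gen_insert, gen_insert_dom] at hd
        have h₁ := hd.deduct.deduct
        have h₂ : 𝓓.Der (𝓓.gen D Γ) (𝓓.imp (𝓓.inf (𝓓.E (Name.wit j φ v))
            (𝓓.int φ (Matrix.vecCons (Name.wit j φ v) v))) (𝓓.int q.fml q.par)) := by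
          refine h₁.le (𝓓.le_imp (𝓓.le_trans (𝓓.le_inf (𝓓.le_trans (𝓓.le_inf (𝓓.inf_le_left _ _)
            (𝓓.le_trans (𝓓.inf_le_right _ _) (𝓓.inf_le_left _ _))) (𝓓.imp_inf_le _ _))
            (𝓓.le_trans (𝓓.inf_le_right _ _) (𝓓.inf_le_right _ _))) (𝓓.imp_inf_le _ _)))
        have hv : (Name.wit j φ v).IsVar := trivial
        have h₃ := (h₂.bind hv (indep_gen hover hx)).le
          (𝓓.ex_elim φ hv (fun i hi => hx (hi ▸ ho i))
            (𝓓.indep_int _ fun i hi => hx (hi ▸ hD (hq i))))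
        exact hn (h₃.mp (.mem (Or.inl ⟨_, h, rfl⟩)))
    exact hx ((hmax hm ⟨Set.subset_insert _ _, Set.subset_insert _ _⟩).1 (Set.mem_insert _ _))
  · intro n v h
    exact hqΓ (closed q (fun i => hD (hq i))
      ((Der.mem (Or.inl ⟨_, h, rfl⟩)).le (𝓓.falsum_le v q.fml q.par)))

end Doctrine

/-! ### Prime theories: connectives, substitution and equality. -/

namespace Doctrine

variable {M : Type u} {𝓓 : Doctrine M}

theorem Der.of_mem {D : Set (Name M)} {Γ : Set (PF M)} {n : ℕ} {φ : Fml Lpr n}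
    {v : Fin n → Name M} (hφ : ⟨φ, v⟩ ∈ Γ) :
    𝓓.Der (𝓓.gen D Γ) (𝓓.int φ v) :=
  .mem (Or.inl ⟨_, hφ, rfl⟩)

namespace IsPrime

variable {D : Set (Name M)} {Γ : Set (PF M)}

theorem mem_of_der (h : 𝓓.IsPrime D Γ) {n : ℕ} {φ : Fml Lpr n} {v : Fin n → Name M}
    (hv : ∀ i, v i ∈ D)
    (hd : 𝓓.Der (𝓓.gen D Γ) (𝓓.int φ v)) : ⟨φ, v⟩ ∈ Γ :=
  h.closed ⟨φ, v⟩ hv hd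

theorem mem_of_top_le (h : 𝓓.IsPrime D Γ) {n : ℕ} {φ : Fml Lpr n} {v : Fin n → Name M}
    (hv : ∀ i, v i ∈ D)
    (hd : 𝓓.le 𝓓.top (𝓓.int φ v)) : ⟨φ, v⟩ ∈ Γ :=
  h.mem_of_der hv (Der.top.le hd)

theorem mem_and (h : 𝓓.IsPrime D Γ) {n : ℕ} {φ ψ : Fml Lpr n} {v : Fin n → Name M} :
    ⟨φ.and ψ, v⟩ ∈ Γ ↔ ⟨φ, v⟩ ∈ Γ ∧ ⟨ψ, v⟩ ∈ Γ :=
  ⟨fun hm => ⟨h.mem_of_der (h.par_mem _ hm) ((Der.of_mem hm).le (𝓓.and_le_left φ ψ v)),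
    h.mem_of_der (h.par_mem _ hm) ((Der.of_mem hm).le (𝓓.and_le_right φ ψ v))⟩,
    fun hm => h.mem_of_der (h.par_mem _ hm.1)
      (((Der.of_mem hm.1).inf (Der.of_mem hm.2)).le (𝓓.inf_le_and φ ψ v))⟩

theorem mem_or (h : 𝓓.IsPrime D Γ) {n : ℕ} {φ ψ : Fml Lpr n} {v : Fin n → Name M} :
    ⟨φ.or ψ, v⟩ ∈ Γ ↔ ⟨φ, v⟩ ∈ Γ ∨ ⟨ψ, v⟩ ∈ Γ := by
  refine ⟨h.prime φ ψ v, ?_⟩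
  rintro (hm | hm)
  · exact h.mem_of_der (h.par_mem _ hm) ((Der.of_mem hm).le (𝓓.le_or_left φ ψ v))
  · exact h.mem_of_der (h.par_mem _ hm) ((Der.of_mem hm).le (𝓓.le_or_right φ ψ v))

theorem mp (h : 𝓓.IsPrime D Γ) {n : ℕ} {φ ψ : Fml Lpr n} {v : Fin n → Name M}
    (h₁ : ⟨φ.imp ψ, v⟩ ∈ Γ)
    (h₂ : ⟨φ, v⟩ ∈ Γ) : ⟨ψ, v⟩ ∈ Γ :=
  h.mem_of_der (h.par_mem _ h₂) (((Der.of_mem h₁).le (𝓓.imp_le φ ψ v)).mp (Der.of_mem h₂))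

theorem mem_all (h : 𝓓.IsPrime D Γ) {n : ℕ} {φ : Fml Lpr (n + 1)} {v : Fin n → Name M}
    (h₁ : ⟨φ.all, v⟩ ∈ Γ)
    {x : Name M} (hx : x ∈ D) : ⟨φ, Matrix.vecCons x v⟩ ∈ Γ :=
  h.mem_of_der (Fin.cases hx (h.par_mem _ h₁))
    (((Der.of_mem h₁).inf (.mem (Or.inr ⟨x, hx, rfl⟩))).le (𝓓.all_elim φ v x))

theorem mem_ex (h : 𝓓.IsPrime D Γ) {n : ℕ} {φ : Fml Lpr (n + 1)} {v : Fin n → Name M} :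
    ⟨φ.ex, v⟩ ∈ Γ ↔ ∃ x ∈ D, ⟨φ, Matrix.vecCons x v⟩ ∈ Γ := by
  refine ⟨h.sat φ v, ?_⟩
  rintro ⟨x, hx, hm⟩
  exact h.mem_of_der (fun i => h.par_mem _ hm i.succ)
    (((Der.mem (Or.inr ⟨x, hx, rfl⟩)).inf (Der.of_mem hm)).le (𝓓.ex_intro φ v x))

theorem mem_alls (h : 𝓓.IsPrime D Γ) {n : ℕ} {φ : Fml Lpr n} {w : Fin 0 → Name M}
    (hm : ⟨φ.alls, w⟩ ∈ Γ)
    {v : Fin n → Name M} (hv : ∀ i, v i ∈ D) : ⟨φ, v⟩ ∈ Γ := by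
  induction n with
  | zero => rwa [Subsingleton.elim v w]
  | succ n ih =>
    have := h.mem_all (ih (φ := φ.all) hm (v := fun i => v i.succ) fun i => hv _) (hv 0)
    have e : Matrix.vecCons (v 0) (fun i => v i.succ) = v := Matrix.cons_head_tail v
    rwa [e] at this

theorem mem_subst_var (h : 𝓓.IsPrime D Γ) {n m : ℕ} {φ : Fml Lpr n} {r : Fin n → Fin m}
    {v : Fin m → Name M}
    (hv : ∀ i, v i ∈ D) :
    ⟨φ.subst fun i => Language.Term.var (r i), v⟩ ∈ Γ ↔ ⟨φ, fun i => v (r i)⟩ ∈ Γ := by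
  constructor <;> intro hm
  · exact h.mem_of_der (fun i => hv _) (𝓓.int_subst_var φ r v ▸ Der.of_mem hm)
  · exact h.mem_of_der hv ((𝓓.int_subst_var φ r v).symm ▸ Der.of_mem hm)

theorem mem_inst_var (h : 𝓓.IsPrime D Γ) {n : ℕ} {φ : Fml Lpr (n + 1)} {j : Fin n}
    {v : Fin n → Name M}
    (hv : ∀ i, v i ∈ D) :
    ⟨φ.inst (Language.Term.var j), v⟩ ∈ Γ ↔ ⟨φ, Matrix.vecCons (v j) v⟩ ∈ Γ := by
  have e₁ : (Matrix.vecCons (Language.Term.var j) Language.Term.var : Fin (n + 1) →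
      Lpr.Term (Fin n)) = fun i => Language.Term.var (Matrix.vecCons j id i) := by
    funext i
    refine Fin.cases rfl (fun i => rfl) i
  have e₂ : (fun i => v (Matrix.vecCons j id i)) = Matrix.vecCons (v j) v := by
    funext i
    refine Fin.cases rfl (fun i => rfl) i
  rw [Fml.inst, e₁, h.mem_subst_var hv, e₂]

theorem eq_refl_mem (h : 𝓓.IsPrime D Γ) {n : ℕ} (t : Lpr.Term (Fin n)) {v : Fin n → Name M}
    (hv : ∀ i, v i ∈ D) :
    ⟨.eq t t, v⟩ ∈ Γ :=
  h.mem_of_top_le hv (𝓓.eq_refl t v)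

theorem eq_subst_mem (h : 𝓓.IsPrime D Γ) {n : ℕ} (φ : Fml Lpr (n + 1)) {s t : Lpr.Term (Fin n)}
    {v : Fin n → Name M} (h₁ : ⟨.eq s t, v⟩ ∈ Γ) (h₂ : ⟨φ.inst s, v⟩ ∈ Γ) : ⟨φ.inst t, v⟩ ∈ Γ :=
  h.mem_of_der (h.par_mem _ h₁) (((Der.of_mem h₁).inf (Der.of_mem h₂)).le (𝓓.eq_subst φ s t v))

theorem eq_symm_mem (h : 𝓓.IsPrime D Γ) {n : ℕ} {s t : Lpr.Term (Fin n)} {v : Fin n → Name M}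
    (h₁ : ⟨.eq s t, v⟩ ∈ Γ) : ⟨.eq t s, v⟩ ∈ Γ := by
  have e : ∀ t' : Lpr.Term (Fin n),
      (Fml.eq (Language.Term.var 0) (s.relabel Fin.succ) : Fml Lpr (n + 1)).inst t' =
        .eq t' s := fun t' => by
    rw [Fml.inst, Fml.subst, Fml.term_relabel_eq_subst, Fml.term_subst_subst]
    congr 1
    exact Fml.term_subst_var s
  have := h.eq_subst_mem (.eq (Language.Term.var 0) (s.relabel Fin.succ)) h₁
  rw [e, e] at this
  exact this (h.eq_refl_mem s (h.par_mem _ h₁))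

/-- Replacement of a variable by a term with the same value. -/
theorem mem_inst_iff (h : 𝓓.IsPrime D Γ) {n : ℕ} (φ : Fml Lpr (n + 1)) {j : Fin n}
    {t : Lpr.Term (Fin n)} {v : Fin n → Name M} (h₁ : ⟨.eq (Language.Term.var j) t, v⟩ ∈ Γ) :
    ⟨φ, Matrix.vecCons (v j) v⟩ ∈ Γ ↔ ⟨φ.inst t, v⟩ ∈ Γ := by
  rw [← h.mem_inst_var (h.par_mem _ h₁)]
  exact ⟨h.eq_subst_mem φ h₁, h.eq_subst_mem φ (h.eq_symm_mem h₁)⟩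

theorem mem_rename (h : 𝓓.IsPrime D Γ) {n m : ℕ} {s t : Lpr.Term (Fin n)} (r : Fin n → Fin m)
    {v : Fin m → Name M}
    (hv : ∀ i, v i ∈ D) :
    ⟨.eq (s.relabel r) (t.relabel r), v⟩ ∈ Γ ↔ ⟨.eq s t, fun i => v (r i)⟩ ∈ Γ := by
  rw [Fml.term_relabel_eq_subst, Fml.term_relabel_eq_subst]
  exact h.mem_subst_var (φ := .eq s t) hv

/-- Simultaneous replacement of variables by terms with the same values. -/
theorem mem_subst_iff (h : 𝓓.IsPrime D Γ) {c n : ℕ} (φ : Fml Lpr c) (σ : Fin c → Lpr.Term (Fin n))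
    {y : Fin c → Name M} {v : Fin n → Name M} (hv : ∀ i, v i ∈ D)
    (hy : ∀ i, ⟨.eq (Language.Term.var 0) ((σ i).relabel Fin.succ), Matrix.vecCons (y i) v⟩ ∈ Γ) :
    ⟨φ.subst σ, v⟩ ∈ Γ ↔ ⟨φ, y⟩ ∈ Γ := by
  have hyD : ∀ i, y i ∈ D := fun i => h.par_mem _ (hy i) 0
  have hw : ∀ i, Fin.append y v i ∈ D := fun i => by
    refine Fin.addCases (fun i => ?_) (fun i => ?_) i
    · simpa using hyD i
    · simpa using hv i
  have heq : ∀ i, ⟨.eq (Language.Term.var (Fin.castAdd n i)) ((σ i).relabel (Fin.natAdd c)),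
      Fin.append y v⟩ ∈ Γ := by
    intro i
    have e : (fun k => Fin.append y v (Matrix.vecCons (Fin.castAdd n i) (Fin.natAdd c) k)) =
        Matrix.vecCons (y i) v := by
      funext k
      refine Fin.cases ?_ (fun k => ?_) k <;> simp
    have := (h.mem_rename (s := Language.Term.var 0) (t := (σ i).relabel Fin.succ)
      (Matrix.vecCons (Fin.castAdd n i) (Fin.natAdd c)) hw).2 (by rw [e]; exact hy i)
    rw [Language.Term.relabel_relabel] at this
    exact this
  -- In `mix j` the first `j` variables are already replaced by their terms; they are exchanged one
  -- at a time in the common context of `y` and `v`.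
  let mix : ℕ → Fin c → Lpr.Term (Fin (c + n)) := fun j i =>
    if i.val < j then (σ i).relabel (Fin.natAdd c) else Language.Term.var (Fin.castAdd n i)
  have step : ∀ j ≤ c, ⟨φ.subst (mix j), Fin.append y v⟩ ∈ Γ ↔ ⟨φ, y⟩ ∈ Γ := by
    intro j
    induction j with
    | zero =>
      intro _
      have e : mix 0 = fun i => Language.Term.var (Fin.castAdd n i) := by
        funext i
        simp [mix]
      rw [e, h.mem_subst_var hw]
      simp
    | succ j ih =>
      intro hj
      rw [← ih (by omega)]
      -- The formula with a hole at position `j`: the two stages are its instances at the variable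
      -- and at the term.
      let φ' : Fml Lpr (c + n + 1) := φ.subst fun i =>
        if i.val = j then Language.Term.var 0 else (mix j i).relabel Fin.succ
      have e : ∀ t : Lpr.Term (Fin (c + n)), φ'.inst t =
          φ.subst fun i => if i.val = j then t else mix j i := fun t => by
        rw [Fml.inst, Fml.subst_subst]
        congr 1
        funext i
        split_ifs
        · rfl
        · rw [Fml.term_relabel_eq_subst, Fml.term_subst_subst]
          exact Fml.term_subst_var _
      have e₁ : φ.subst (mix (j + 1)) = φ'.inst ((σ ⟨j, hj⟩).relabel (Fin.natAdd c)) := by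
        rw [e]
        congr 1
        funext i
        by_cases hi : i.val = j
        · obtain rfl : i = ⟨j, hj⟩ := Fin.ext hi
          simp [mix]
        · have : i.val < j + 1 ↔ i.val < j := by omega
          simp [mix, hi, this]
      have e₂ : φ.subst (mix j) = φ'.inst (Language.Term.var (Fin.castAdd n ⟨j, hj⟩)) := by
        rw [e]
        congr 1
        funext i
        by_cases hi : i.val = j
        · obtain rfl : i = ⟨j, hj⟩ := Fin.ext hi
          simp [mix]
        · simp [hi]
      rw [e₁, e₂, h.mem_inst_var hw]
      exact (h.mem_inst_iff φ' (heq ⟨j, hj⟩)).symm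
  rw [← step c le_rfl]
  have e : φ.subst (mix c) = (φ.subst σ).subst fun i => Language.Term.var (Fin.natAdd c i) := by
    rw [Fml.subst_subst]
    congr 1
    funext i
    simp only [mix, i.isLt, if_true, Fml.term_relabel_eq_subst]
  rw [e, h.mem_subst_var hw]
  simp

/-- Equality of names. -/
theorem eq_var_iff (h : 𝓓.IsPrime D Γ) {n : ℕ} {i j : Fin n} {v : Fin n → Name M}
    (hv : ∀ i, v i ∈ D) :
    ⟨.eq (Language.Term.var i) (Language.Term.var j), v⟩ ∈ Γ ↔
      ⟨.eq (Language.Term.var 0) (Language.Term.var 1), ![v i, v j]⟩ ∈ Γ := by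
  have e : (fun k => v (![i, j] k)) = ![v i, v j] := by
    funext k
    fin_cases k <;> rfl
  have := h.mem_rename (s := Language.Term.var 0) (t := Language.Term.var 1) ![i, j] hv
  rwa [e] at this

theorem mem_congr (h : 𝓓.IsPrime D Γ) {n : ℕ} (φ : Fml Lpr n) {v w : Fin n → Name M}
    (hvw : ∀ i, ⟨.eq (Language.Term.var 0) (Language.Term.var 1), ![v i, w i]⟩ ∈ Γ) :
    ⟨φ, w⟩ ∈ Γ ↔ ⟨φ, v⟩ ∈ Γ := by
  have hw : ∀ i, w i ∈ D := fun i => h.par_mem _ (hvw i) 1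
  have hv : ∀ i, v i ∈ D := fun i => h.par_mem _ (hvw i) 0
  rw [← h.mem_subst_iff φ Language.Term.var (y := v) hw, Fml.subst_var]
  intro i
  refine (h.eq_var_iff (j := i.succ) (Fin.cases (hv i) hw)).2 ?_
  simpa using hvw i

theorem eq_or_ne_mem (h : 𝓓.IsPrime D Γ) {x y : Name M} (hx : x ∈ D) (hy : y ∈ D) :
    ⟨.eq (Language.Term.var 0) (Language.Term.var 1), ![x, y]⟩ ∈ Γ ∨
      ⟨(Fml.eq (Language.Term.var 0) (Language.Term.var 1)).neg, ![x, y]⟩ ∈ Γ :=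
  h.prime _ _ _ (h.mem_alls
    (h.mem_of_top_le (v := fun i : Fin 0 => i.elim0) (fun i => i.elim0) (𝓓.eq_or_ne _))
    (fun i => by fin_cases i <;> assumption))

theorem exists_fn_mem (h : 𝓓.IsPrime D Γ) {n : ℕ} (f : PR n) {v : Fin n → Name M}
    (hv : ∀ i, v i ∈ D) :
    ∃ x ∈ D, ⟨.eq (Language.Term.var 0) (f.app fun i => Language.Term.var i.succ),
      Matrix.vecCons x v⟩ ∈ Γ :=
  h.sat _ _ (h.mem_alls
    (h.mem_of_top_le (v := fun i : Fin 0 => i.elim0) (fun i => i.elim0) (𝓓.exists_fn f _)) hv)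

theorem eq_symm_var (h : 𝓓.IsPrime D Γ) {x y : Name M}
    (h₁ : ⟨.eq (Language.Term.var 0) (Language.Term.var 1), ![x, y]⟩ ∈ Γ) :
    ⟨.eq (Language.Term.var 0) (Language.Term.var 1), ![y, x]⟩ ∈ Γ := by
  have hv : ∀ i, ![x, y] i ∈ D := h.par_mem _ h₁
  have := (h.eq_var_iff (i := 1) (j := 0) hv).1 (h.eq_symm_mem h₁)
  simpa using this

theorem eq_trans_var (h : 𝓓.IsPrime D Γ) {x y z : Name M}
    (h₁ : ⟨.eq (Language.Term.var 0) (Language.Term.var 1), ![x, y]⟩ ∈ Γ)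
    (h₂ : ⟨.eq (Language.Term.var 0) (Language.Term.var 1), ![y, z]⟩ ∈ Γ) :
    ⟨.eq (Language.Term.var 0) (Language.Term.var 1), ![x, z]⟩ ∈ Γ := by
  have hx : x ∈ D := h.par_mem _ h₁ 0
  refine (h.mem_congr _ (v := ![x, y]) fun i => ?_).2 h₁
  fin_cases i
  · exact (h.eq_var_iff (i := (0 : Fin 1)) (j := 0) (v := fun _ => x) fun _ => hx).1
      (h.eq_refl_mem _ fun _ => hx)
  · exact h₂

end IsPrime

end Doctrine

/-! ### Worlds: prime theories with literal equality, and their structures. -/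

namespace Doctrine

variable {M : Type u}

/-- The equation between two names. -/
abbrev eqPF (x y : Name M) : PF M := ⟨.eq (Language.Term.var 0) (Language.Term.var 1), ![x, y]⟩

/-- A prime theory over a domain of bounded level in which different names denote different
objects. -/
structure World (𝓓 : Doctrine M) where
  D : Set (Name M)
  Γ : Set (PF M)
  isPrime : 𝓓.IsPrime D Γ
  exact_eq : ∀ {x y}, eqPF x y ∈ Γ → x = y
  bdd : ∃ j, ∀ x ∈ D, x.lvl ≤ j

variable {𝓓 : Doctrine M}

/-- Passes to the quotient by provable equality, realized by representatives so that the domain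
remains a set of names. Names in `D₀` represent themselves, as no two of them are provably equal. -/
theorem exists_world_of_isPrime {D D₀ : Set (Name M)} {Γ : Set (PF M)} (h : 𝓓.IsPrime D Γ)
    (hD : D₀ ⊆ D) (hne : ∀ x ∈ D₀, ∀ y ∈ D₀, eqPF x y ∈ Γ → x = y) {j : ℕ}
    (hj : ∀ x ∈ D, x.lvl ≤ j) :
    ∃ (W : World 𝓓) (r : Name M → Name M), (∀ x ∈ D₀, r x = x) ∧ (∀ x ∈ D, r x ∈ W.D) ∧
      ∀ {n : ℕ} (φ : Fml Lpr n) (v : Fin n → Name M), (∀ i, v i ∈ D) →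
        (⟨φ, fun i => r (v i)⟩ ∈ W.Γ ↔ ⟨φ, v⟩ ∈ Γ) := by
  classical
  have refl : ∀ x ∈ D, eqPF x x ∈ Γ := fun x hx =>
    (h.eq_var_iff (i := (0 : Fin 1)) (j := 0) (v := fun _ => x) fun _ => hx).1
      (h.eq_refl_mem _ fun _ => hx)
  -- The chosen property depends only on the equality class of `x`, so equal names receive the same
  -- representative; members of `D₀` are preferred.
  let r : Name M → Name M := fun x =>
    @Classical.epsilon _ ⟨x⟩ fun z => (z ∈ D₀ ∨ ∀ y ∈ D₀, eqPF y x ∉ Γ) ∧ eqPF z x ∈ Γ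
  have hr : ∀ x ∈ D, (r x ∈ D₀ ∨ ∀ y ∈ D₀, eqPF y x ∉ Γ) ∧ eqPF (r x) x ∈ Γ := by
    intro x hx
    refine Classical.epsilon_spec
      (p := fun z => (z ∈ D₀ ∨ ∀ y ∈ D₀, eqPF y x ∉ Γ) ∧ eqPF z x ∈ Γ) ?_
    by_cases hc : ∃ y ∈ D₀, eqPF y x ∈ Γ
    · obtain ⟨y, hy, hyx⟩ := hc
      exact ⟨y, Or.inl hy, hyx⟩
    · push Not at hc
      exact ⟨x, Or.inr hc, refl x hx⟩
  have hrD : ∀ x ∈ D, r x ∈ D := fun x hx => h.par_mem _ (hr x hx).2 0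
  have hcongr : ∀ {x y}, eqPF x y ∈ Γ → r x = r y := by
    intro x y hxy
    have key : ∀ z, eqPF z x ∈ Γ ↔ eqPF z y ∈ Γ := fun z =>
      ⟨fun hz => h.eq_trans_var hz hxy, fun hz => h.eq_trans_var hz (h.eq_symm_var hxy)⟩
    have : (fun z => (z ∈ D₀ ∨ ∀ y ∈ D₀, eqPF y x ∉ Γ) ∧ eqPF z x ∈ Γ) =
        fun z => (z ∈ D₀ ∨ ∀ w ∈ D₀, eqPF w y ∉ Γ) ∧ eqPF z y ∈ Γ := by
      funext z
      simp only [key]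
    simp only [r]
    rw [this]
  have hiff : ∀ {n : ℕ} (φ : Fml Lpr n) (v : Fin n → Name M), (∀ i, v i ∈ D) →
      (⟨φ, fun i => r (v i)⟩ ∈ Γ ↔ ⟨φ, v⟩ ∈ Γ) := fun φ v hv =>
    h.mem_congr φ fun i => h.eq_symm_var (hr _ (hv i)).2
  refine ⟨⟨r '' D, {p | p ∈ Γ ∧ p.Over (r '' D)}, ⟨fun p hp => hp.2, ?_, ?_, ?_, ?_⟩, ?_, ?_⟩,
    r, ?_, ?_, ?_⟩
  · intro p hp hd
    refine ⟨h.closed p (fun i => ?_) (hd.mono (gen_mono ?_ fun _ h => h.1)), hp⟩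
    · obtain ⟨x, hx, e⟩ := hp i
      exact e ▸ hrD x hx
    · rintro _ ⟨x, hx, rfl⟩
      exact hrD x hx
  · intro n φ ψ v hm
    exact (h.prime φ ψ v hm.1).imp (fun h' => ⟨h', hm.2⟩) fun h' => ⟨h', hm.2⟩
  · intro n φ v hm
    obtain ⟨x, hx, hx'⟩ := h.sat φ v hm.1
    have hv : ∀ i, v i ∈ D := fun i => h.par_mem _ hm.1 i
    refine ⟨r x, ⟨x, hx, rfl⟩, (h.mem_congr φ (Fin.cases ?_ fun i => ?_)).2 hx',
      Fin.cases ⟨x, hx, rfl⟩ hm.2⟩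
    · exact h.eq_symm_var (hr x hx).2
    · exact refl _ (hv i)
  · exact fun v hm => h.cons v hm.1
  · intro x y hm
    obtain ⟨x', hx', hxe⟩ := hm.2 0
    obtain ⟨y', hy', hye⟩ := hm.2 1
    change r x' = x at hxe
    change r y' = y at hye
    subst hxe hye
    exact hcongr (h.eq_trans_var (h.eq_symm_var (hr x' hx').2)
      (h.eq_trans_var hm.1 (hr y' hy').2))
  · refine ⟨j, ?_⟩
    rintro _ ⟨x, hx, rfl⟩
    exact hj _ (hrD x hx)
  · intro x hx
    obtain ⟨h₁ | h₁, h₂⟩ := hr x (hD hx)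
    · exact hne _ h₁ _ hx h₂
    · exact absurd (refl x (hD hx)) (h₁ x hx)
  · exact fun x hx => ⟨x, hx, rfl⟩
  · intro n φ v hv
    rw [← hiff φ v hv]
    exact ⟨fun h' => h'.1, fun h' => ⟨h', fun i => ⟨_, hv i, rfl⟩⟩⟩

/-- The inequalities in `Γ₀` keep the names of `D₀` distinct in every consistent extension; this
lets extensions of a world keep its names literally. -/
theorem exists_world {D₀ D₁ : Set (Name M)} {Γ₀ : Set (PF M)} (hΓ₀ : ∀ p ∈ Γ₀, p.Over D₁)
    (hD : D₀ ⊆ D₁) {j : ℕ} (hlvl : ∀ x ∈ D₁, x.lvl ≤ j + 1)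
    (hwit : ∀ {n : ℕ} (φ : Fml Lpr (n + 1)) v, Name.wit j φ v ∉ D₁)
    (hne : ∀ x ∈ D₀, ∀ y ∈ D₀, x ≠ y →
      ⟨(Fml.eq (Language.Term.var 0) (Language.Term.var 1)).neg, ![x, y]⟩ ∈ Γ₀)
    {m : ℕ} {χ : Fml Lpr m} {w : Fin m → Name M} (hw : ∀ i, w i ∈ D₁)
    (hnot : ¬ 𝓓.Der (𝓓.gen D₁ Γ₀) (𝓓.int χ w)) :
    ∃ (W : World 𝓓) (r : Name M → Name M), (∀ x ∈ D₀, r x = x) ∧ (∀ x ∈ D₁, r x ∈ W.D) ∧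
      (∀ {n : ℕ} (φ : Fml Lpr n) (v : Fin n → Name M), ⟨φ, v⟩ ∈ Γ₀ →
        ⟨φ, fun i => r (v i)⟩ ∈ W.Γ) ∧ ⟨χ, fun i => r (w i)⟩ ∉ W.Γ := by
  obtain ⟨D, Γ, h, hD₁, hΓ, hl, hq⟩ := exists_isPrime hΓ₀ hlvl hwit (q := ⟨χ, w⟩) hw hnot
  obtain ⟨W, r, h₁, h₂, h₃⟩ := exists_world_of_isPrime h (hD.trans hD₁) (fun x hx y hy he => by
    by_contra hxy
    exact h.cons _ (h.mp (hΓ (hne x hx y hy hxy)) he)) hl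
  exact ⟨W, r, h₁, fun x hx => h₂ x (hD₁ hx),
    fun φ v hm => (h₃ φ v fun i => hD₁ (hΓ₀ _ hm i)).2 (hΓ hm),
    fun hm => hq ((h₃ χ w fun i => hD₁ (hw i)).1 hm)⟩

namespace World

variable (W : World 𝓓)

theorem exists_fn {k : ℕ} (f : PR k) (v : Fin k → W.D) :
    ∃ d : W.D, ⟨.eq (Language.Term.var 0) (f.app fun i => Language.Term.var i.succ),
      Matrix.vecCons (d : Name M) fun i => v i⟩ ∈ W.Γ := by
  obtain ⟨x, hx, h⟩ := W.isPrime.exists_fn_mem f (v := fun i => (v i : Name M)) fun i => (v i).2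
  exact ⟨⟨x, hx⟩, h⟩

noncomputable instance : Lpr.Structure W.D where
  funMap f v := (W.exists_fn f v).choose
  RelMap R := nomatch R

theorem funMap_mem {k : ℕ} (f : PR k) (v : Fin k → W.D) :
    ⟨.eq (Language.Term.var 0) (f.app fun i => Language.Term.var i.succ),
      Matrix.vecCons ((f.fn v : W.D) : Name M) fun i => v i⟩ ∈ W.Γ :=
  (W.exists_fn f v).choose_spec

theorem eq_var_self {n : ℕ} (x : W.D) {v : Fin n → Name M} (hv : ∀ i, v i ∈ W.D) (j : Fin n)
    (hj : v j = x) :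
    ⟨.eq (Language.Term.var 0) (Language.Term.var j.succ),
      Matrix.vecCons (x : Name M) v⟩ ∈ W.Γ := by
  refine (W.isPrime.eq_var_iff (i := 0) (j := j.succ) (Fin.cases x.2 hv)).2 ?_
  have := (W.isPrime.eq_var_iff (i := j) (j := j) hv).1 (W.isPrime.eq_refl_mem _ hv)
  rw [hj] at this
  simpa [hj] using this

theorem mem_eq_weaken {n : ℕ} {t : Lpr.Term (Fin n)} {y x : Name M} (hx : x ∈ W.D)
    {v : Fin n → Name M}
    (hm : ⟨.eq (Language.Term.var 0) (t.relabel Fin.succ), Matrix.vecCons y v⟩ ∈ W.Γ) :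
    ⟨.eq (Language.Term.var 0) ((t.relabel Fin.succ).relabel Fin.succ),
      Matrix.vecCons y (Matrix.vecCons x v)⟩ ∈ W.Γ := by
  have h := W.isPrime
  have e : (fun i : Fin (n + 1) => Matrix.vecCons y (Matrix.vecCons x v)
      ((Matrix.vecCons 0 fun i => i.succ.succ : Fin (n + 1) → Fin (n + 2)) i)) =
      Matrix.vecCons y v := by
    funext i
    refine Fin.cases rfl (fun i => rfl) i
  have := (h.mem_rename (s := Language.Term.var 0) (t := t.relabel Fin.succ)
    (Matrix.vecCons 0 fun i => i.succ.succ) (v := Matrix.vecCons y (Matrix.vecCons x v))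
    (Fin.cases (h.par_mem _ hm 0) (Fin.cases hx fun i => h.par_mem _ hm i.succ))).2
    (by rw [e]; exact hm)
  rw [Language.Term.relabel_relabel] at this ⊢
  exact this

theorem eq_of_mem {x y : Name M} {n : ℕ} {t : Lpr.Term (Fin n)} {v : Fin n → Name M}
    (h₁ : ⟨.eq (Language.Term.var 0) (t.relabel Fin.succ), Matrix.vecCons x v⟩ ∈ W.Γ)
    (h₂ : ⟨.eq (Language.Term.var 0) (t.relabel Fin.succ), Matrix.vecCons y v⟩ ∈ W.Γ) :
    x = y := by
  have h := W.isPrime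
  have hx : x ∈ W.D := h.par_mem _ h₁ 0
  have hv : ∀ i, v i ∈ W.D := fun i => h.par_mem _ h₁ i.succ
  refine W.exact_eq ((h.mem_subst_iff (.eq (Language.Term.var 0) (Language.Term.var 1))
    (![Language.Term.var 0, t.relabel Fin.succ]) (y := ![x, y])
    (v := Matrix.vecCons x v) (Fin.cases hx hv) (Fin.cases ?_
      (Fin.cases ?_ fun i => i.elim0))).1 h₁)
  · exact W.eq_var_self ⟨x, hx⟩ (Fin.cases hx hv) 0 rfl
  · exact W.mem_eq_weaken hx h₂

/-- The theory proves that the name denoted by a term equals that term, by induction through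
function application. This ties the term structure of the world to its theory. -/
theorem realize_mem {n : ℕ} (t : Lpr.Term (Fin n)) (v : Fin n → W.D) :
    ⟨.eq (Language.Term.var 0) (t.relabel Fin.succ),
      Matrix.vecCons ((t.realize v : W.D) : Name M) fun i => v i⟩ ∈ W.Γ := by
  have h := W.isPrime
  have hv : ∀ i, (v i : Name M) ∈ W.D := fun i => (v i).2
  induction t with
  | var i => exact W.eq_var_self (v i) hv i rfl
  | @func k f ts ih =>
    have hd := (Language.Term.realize v (Language.Term.func f ts)).2
    exact (h.mem_subst_iff (.eq (Language.Term.var 0)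
      (PR.app f fun i => Language.Term.var i.succ))
      (Matrix.vecCons (Language.Term.var 0) fun i => (ts i).relabel Fin.succ)
      (y := Matrix.vecCons ((PR.fn f fun i => (ts i).realize v : W.D) : Name M)
        fun i => (((ts i).realize v : W.D) : Name M))
      (v := Matrix.vecCons ((Language.Term.realize v (Language.Term.func f ts) : W.D) : Name M)
        fun i => v i)
      (Fin.cases hd hv) (Fin.cases (W.eq_var_self ⟨_, hd⟩ (Fin.cases hd hv) 0 rfl)
        fun i => W.mem_eq_weaken hd (ih i))).2 (W.funMap_mem f fun i => (ts i).realize v)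

theorem mem_eq_iff {n : ℕ} (s t : Lpr.Term (Fin n)) (v : Fin n → W.D) :
    ⟨.eq s t, fun i => (v i : Name M)⟩ ∈ W.Γ ↔ s.realize v = t.realize v := by
  have h := W.isPrime
  have h₁ := h.mem_subst_iff (.eq (Language.Term.var 0) (Language.Term.var 1)) ![s, t]
    (y := ![((s.realize v : W.D) : Name M), ((t.realize v : W.D) : Name M)])
    (v := fun i => (v i : Name M)) (fun i => (v i).2)
    (Fin.cases (W.realize_mem s v) (Fin.cases (W.realize_mem t v) fun i => i.elim0))
  refine h₁.trans ⟨fun he => Subtype.ext (W.exact_eq he), fun he => ?_⟩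
  rw [he]
  exact (h.eq_var_iff (i := (0 : Fin 1)) (j := 0) (v := fun _ => _) fun _ => (t.realize v).2).1
    (h.eq_refl_mem _ fun _ => (t.realize v).2)

theorem nonempty_dom : W.D.Nonempty :=
  ⟨_, (PR.zero.fn (fun i => i.elim0) : W.D).2⟩

theorem fn_eq_iff {k : ℕ} (f : PR k) (v : Fin k → W.D) (d : W.D) :
    f.fn v = d ↔ ⟨.eq (Language.Term.var 0) (f.app fun i => Language.Term.var i.succ),
      Matrix.vecCons (d : Name M) fun i => v i⟩ ∈ W.Γ := by
  constructor
  · rintro rfl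
    exact W.funMap_mem f v
  · intro hm
    exact Subtype.ext (W.eq_of_mem (t := f.app Language.Term.var) (W.funMap_mem f v) hm)

end World

end Doctrine

namespace Name

variable {M : Type u} {A : Type*}

theorem update_base {ρ : Name M → A} {ι : M → A} (hρ : ∀ m, ρ (.base m) = ι m) {y : Name M}
    (hy : y.IsVar)
    (n : A) [DecidableEq (Name M)] (m : M) : Function.update ρ y n (.base m) = ι m := by
  rw [Function.update_of_ne, hρ]
  rintro rfl
  exact hy

theorem update_comp {ρ : Name M → A} {k : ℕ} {v : Fin k → Name M} {y : Name M}
    (hv : ∀ i, v i ≠ y) (n : A) [DecidableEq (Name M)] :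
    (fun i => Function.update ρ y n (v i)) = fun i => ρ (v i) :=
  funext fun i => Function.update_of_ne (hv i) _ _

theorem update_vecCons {ρ : Name M → A} {k : ℕ} {v : Fin k → Name M} {y : Name M}
    (hv : ∀ i, v i ≠ y) (n : A) [DecidableEq (Name M)] :
    (fun i => Function.update ρ y n (Matrix.vecCons y v i)) =
      Matrix.vecCons n fun i => ρ (v i) := by
  funext i
  refine Fin.cases ?_ (fun i => ?_) i
  · exact Function.update_self _ _ _
  · exact Function.update_of_ne (hv i) _ _

theorem comp_vecCons {ρ : Name M → A} {k : ℕ} {v : Fin k → Name M} {y : Name M} :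
    (fun i => ρ (Matrix.vecCons y v i)) = Matrix.vecCons (ρ y) fun i => ρ (v i) := by
  funext i
  refine Fin.cases rfl (fun i => rfl) i

end Name

/-! ### The realizability interpretation. -/

namespace PAModel

variable {M N : Type u} [Lpr.Structure N]

/-- Uniform realizability of the implication from `P` to `Q`, for all interpretations of the names
that extend `ι`. -/
def RzLe (S : Lpr.Substructure N) (ι : M → N) (P Q : (Name M → N) → N → Prop) : Prop :=
  ∃ R, Computable S R ∧ ∀ ρ : Name M → N, (∀ m, ρ (.base m) = ι m) → ∀ a, P ρ a →
    ∃ b, R a b ∧ Q ρ b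

variable {S : Lpr.Substructure N} {ι : M → N}

theorem RzLe.of_rec {P Q : (Name M → N) → N → Prop} {F : N → N} (hF : Rec S F)
    (h : ∀ ρ : Name M → N, (∀ m, ρ (.base m) = ι m) → ∀ a, P ρ a → Q ρ (F a)) :
    RzLe S ι P Q :=
  ⟨_, hF.computable, fun ρ hρ a ha => ⟨_, rfl, h ρ hρ a ha⟩⟩

variable [PAModel N]

/-- Definition by cases. -/
theorem Computable.cases {R R' : N → N → Prop} (hR : Computable S R) (hR' : Computable S R') :
    Computable S fun x z => (fst x = 0 ∧ R (snd x) z) ∨ (¬ fst x = 0 ∧ R' (snd x) z) := by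
  obtain ⟨e, he, hR⟩ := hR
  obtain ⟨d, hd, hR'⟩ := hR'
  refine ((Rec.fn3 PR.cond Rec.fst' (Rec.const he) (Rec.const hd)).computable.ap
    Rec.snd'.computable).mono ?_
  rintro x z (⟨h, h'⟩ | ⟨h, h'⟩)
  · exact ⟨_, _, rfl, rfl, by simpa [fn_cond, h] using hR _ _ h'⟩
  · exact ⟨_, _, rfl, rfl, by simpa [fn_cond, h] using hR' _ _ h'⟩

theorem RzLe.of_imp {P Q : (Name M → N) → N → Prop} (h : ∀ ρ a, P ρ a → Q ρ a) :
    RzLe S ι P Q :=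
  .of_rec Rec.id' fun ρ _ a ha => h ρ a ha

theorem RzLe.of_valid {φ : Fml Lpr 0} (h : Valid S φ) (P : (Name M → N) → N → Prop)
    (v : Fin 0 → Name M) : RzLe S ι P fun ρ a => Rz φ a fun i => ρ (v i) := by
  obtain ⟨e, he, h⟩ := h
  refine ⟨_, (Computable.of_mem he).comp_rec (Rec.const zero_mem), fun ρ _ a _ => ?_⟩
  exact h _

open Classical in
/-- The realizability interpretation with realizers of uniform implications in `S`. -/
noncomputable def rzDoctrine (S : Lpr.Substructure N) (ι : M → N) : Doctrine M where
  H := (Name M → N) → N → Prop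
  le := RzLe S ι
  top := fun _ _ => True
  inf P Q := fun ρ a => P ρ (fst a) ∧ Q ρ (snd a)
  imp P Q := fun ρ a => ∀ b, P ρ b → ∃ c, Ev a b c ∧ Q ρ c
  bind y P := fun ρ a => ∀ n, P (Function.update ρ y n) a
  Indep y P := ∀ ρ n, P (Function.update ρ y n) = P ρ
  E x := fun ρ a => a = ρ x
  int φ v := fun ρ a => Rz φ a fun i => ρ (v i)
  le_refl P := .of_imp fun _ _ h => h
  le_trans := by
    rintro P Q R ⟨R₁, h₁, h₁'⟩ ⟨R₂, h₂, h₂'⟩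
    refine ⟨_, h₂.comp h₁, fun ρ hρ a ha => ?_⟩
    obtain ⟨b, hb, hb'⟩ := h₁' ρ hρ a ha
    obtain ⟨c, hc, hc'⟩ := h₂' ρ hρ b hb'
    exact ⟨c, ⟨b, hb, hc⟩, hc'⟩
  le_top P := .of_imp fun _ _ _ => trivial
  inf_le_left P Q := .of_rec Rec.fst' fun _ _ _ h => h.1
  inf_le_right P Q := .of_rec Rec.snd' fun _ _ _ h => h.2
  le_inf := by
    rintro P Q R ⟨R₁, h₁, h₁'⟩ ⟨R₂, h₂, h₂'⟩
    refine ⟨_, h₁.pair h₂, fun ρ hρ a ha => ?_⟩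
    obtain ⟨b, hb, hb'⟩ := h₁' ρ hρ a ha
    obtain ⟨c, hc, hc'⟩ := h₂' ρ hρ a ha
    exact ⟨pr b c, by simpa using ⟨hb, hc⟩, by simpa using ⟨hb', hc'⟩⟩
  le_imp := by
    rintro P Q R ⟨R₁, h₁, h₁'⟩
    obtain ⟨F, hF, h⟩ := h₁.curry
    refine .of_rec hF fun ρ hρ a ha b hb => ?_
    obtain ⟨c, hc, hc'⟩ := h₁' ρ hρ (pr a b) (by simpa using ⟨ha, hb⟩)
    exact ⟨c, h _ _ _ hc, hc'⟩
  imp_inf_le P Q := by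
    refine ⟨_, Rec.fst'.computable.ap Rec.snd'.computable, fun ρ _ a ha => ?_⟩
    obtain ⟨c, hc, hc'⟩ := ha.1 _ ha.2
    exact ⟨c, ⟨_, _, rfl, rfl, hc⟩, hc'⟩
  bind_mono := by
    rintro y P Q hy ⟨R, ⟨e, he, hR⟩, h⟩
    refine ⟨_, Computable.of_mem he, fun ρ hρ a ha => ?_⟩
    -- An element of `bind y P` realizes `P` for all values of `y` at once. Its image must again be
    -- one number for all values, and this follows from uniqueness of the value of `e` at `a`.
    have key : ∀ n, ∃ b, Ev e a b ∧ Q (Function.update ρ y n) b := fun n => by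
      obtain ⟨b, hb, hb'⟩ := h _ (Name.update_base hρ hy n) a (ha n)
      exact ⟨b, hR _ _ hb, hb'⟩
    obtain ⟨b, hb, -⟩ := key 0
    refine ⟨b, hb, fun n => ?_⟩
    obtain ⟨c, hc, hc'⟩ := key n
    rwa [hb.unique hc]
  le_bind := by
    intro y P hy hP
    refine .of_imp fun ρ a h n => ?_
    rwa [hP]
  top_le_bind y := .of_imp fun _ _ _ _ => trivial
  bind_inf P Q := .of_imp fun _ _ h n => ⟨h.1 n, h.2 n⟩
  indep_int φ v hv ρ n := by
    funext a
    dsimp only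
    rw [Name.update_comp hv]
  indep_E := by
    intro x y hxy ρ n
    funext a
    dsimp only
    rw [Function.update_of_ne hxy]
  falsum_le v φ w := .of_imp fun _ _ h => h.elim
  and_le_left φ ψ v := .of_rec Rec.fst' fun _ _ _ h => h.1
  and_le_right φ ψ v := .of_rec Rec.snd' fun _ _ _ h => h.2
  inf_le_and φ ψ v := .of_imp fun _ _ h => h
  le_or_left φ ψ v := .of_rec ((Rec.const zero_mem).pair Rec.id') fun _ _ _ h =>
    Or.inl ⟨fst_pr _ _, by rwa [snd_pr]⟩
  le_or_right φ ψ v := .of_rec ((Rec.const (tag_mem 1)).pair Rec.id') fun _ _ _ h =>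
    Or.inr ⟨by rw [fst_pr]; exact pos_iff_exists.2 ⟨0, rfl⟩, by rwa [snd_pr]⟩
  or_le := by
    rintro n φ ψ v R ⟨R₁, h₁, h₁'⟩ ⟨R₂, h₂, h₂'⟩
    refine ⟨_, h₁.cases h₂, fun ρ hρ a ha => ?_⟩
    rcases ha with ⟨h, ha⟩ | ⟨h, ha⟩
    · obtain ⟨b, hb, hb'⟩ := h₁' ρ hρ _ ha
      exact ⟨b, Or.inl ⟨h, hb⟩, hb'⟩
    · obtain ⟨b, hb, hb'⟩ := h₂' ρ hρ _ ha
      exact ⟨b, Or.inr ⟨h, hb⟩, hb'⟩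
  imp_le φ ψ v := .of_imp fun _ _ h => h
  le_imp_int φ ψ v := .of_imp fun _ _ h => h
  all_elim φ v x := by
    refine ⟨_, Rec.fst'.computable.ap Rec.snd'.computable, fun ρ _ a ha => ?_⟩
    obtain ⟨c, hc, hc'⟩ := ha.1 (snd a)
    refine ⟨c, ⟨_, _, rfl, rfl, hc⟩, ?_⟩
    dsimp only
    rw [Name.comp_vecCons, ← show snd a = ρ x from ha.2]
    exact hc'
  all_intro := by
    intro n φ v y hy hv
    refine .of_imp fun ρ a ha m => ?_
    -- The existence predicate of a name is realized by its value, so `m` is both the value given to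
    -- `y` and the realizer of its existence.
    obtain ⟨c, hc, hc'⟩ := ha m m (by rw [Function.update_self])
    rw [Name.update_vecCons hv] at hc'
    exact ⟨c, hc, hc'⟩
  ex_intro φ v x := by
    refine .of_imp fun ρ a ha => ?_
    obtain ⟨h₁, h₂⟩ := ha
    rw [Name.comp_vecCons, ← h₁] at h₂
    exact h₂
  ex_elim := by
    intro n φ v y Q hy hv hQ
    refine .of_imp fun ρ a ha b hb => ?_
    -- A realizer of an existential is literally a pair of an existence realizer and a realizer of
    -- the instance; `y` takes the value `fst b`.
    obtain ⟨c, hc, hc'⟩ := ha (fst b) b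
      ⟨by dsimp only; rw [Function.update_self], by dsimp only; rw [Name.update_vecCons hv]; exact
        hb⟩
    rw [hQ] at hc'
    exact ⟨c, hc, hc'⟩
  int_subst_var φ r v := by
    funext ρ a
    rw [rz_subst]
    rfl
  eq_refl t v := .of_imp fun _ _ _ => rfl
  eq_subst φ s t v := by
    refine .of_rec Rec.snd' fun ρ _ a ha => ?_
    obtain ⟨h₁, h₂⟩ := ha
    rw [rz_inst] at h₂ ⊢
    rwa [← show s.realize _ = t.realize _ from h₁]
  exists_fn f v := .of_valid (valid_exists_fn f).alls _ v
  eq_or_ne v := .of_valid valid_eq_or_ne.alls _ v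

end PAModel

/-! ### The canonical Kripke model. -/

namespace Doctrine

variable {M : Type u} {𝓓 : Doctrine M}

namespace World

theorem eq_of_dom_eq {W W' : World 𝓓} (hD : W.D = W'.D) (hΓ : W.Γ = W'.Γ) : W = W' := by
  cases W
  cases W'
  cases hD
  cases hΓ
  rfl

instance : PartialOrder (World 𝓓) :=
  PartialOrder.lift (fun W => (W.D, W.Γ)) fun _ _ h =>
    eq_of_dom_eq (congrArg Prod.fst h) (congrArg Prod.snd h)

theorem ne_mem (W : World 𝓓) {x y : Name M} (hx : x ∈ W.D) (hy : y ∈ W.D) (hxy : x ≠ y) :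
    ⟨(Fml.eq (Language.Term.var 0) (Language.Term.var 1)).neg, ![x, y]⟩ ∈ W.Γ :=
  (W.isPrime.eq_or_ne_mem hx hy).resolve_left fun h => hxy (W.exact_eq h)

/-- Extension of a world, with new assumptions, that avoids a given formula. -/
theorem exists_ge (W : World 𝓓) {D₁ : Set (Name M)} {Γ₀ : Set (PF M)} (hΓ : W.Γ ⊆ Γ₀)
    (hΓ₀ : ∀ p ∈ Γ₀, p.Over D₁) (hD : W.D ⊆ D₁) {j : ℕ} (hlvl : ∀ x ∈ D₁, x.lvl ≤ j + 1)
    (hwit : ∀ {n : ℕ} (φ : Fml Lpr (n + 1)) v, Name.wit j φ v ∉ D₁)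
    {m : ℕ} {χ : Fml Lpr m} {w : Fin m → Name M} (hw : ∀ i, w i ∈ D₁)
    (hnot : ¬ 𝓓.Der (𝓓.gen D₁ Γ₀) (𝓓.int χ w)) :
    ∃ W' : World 𝓓, W ≤ W' ∧ ∃ r : Name M → Name M, (∀ x ∈ W.D, r x = x) ∧
      (∀ x ∈ D₁, r x ∈ W'.D) ∧ (∀ {n : ℕ} (φ : Fml Lpr n) (v : Fin n → Name M), ⟨φ, v⟩ ∈ Γ₀ →
        ⟨φ, fun i => r (v i)⟩ ∈ W'.Γ) ∧ ⟨χ, fun i => r (w i)⟩ ∉ W'.Γ := by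
  obtain ⟨W', r, h₁, h₂, h₃, h₄⟩ := exists_world hΓ₀ hD hlvl hwit
    (fun x hx y hy hxy => hΓ (W.ne_mem hx hy hxy)) hw hnot
  refine ⟨W', ⟨fun x hx => ?_, fun p hp => ?_⟩, r, h₁, h₂, h₃, h₄⟩
  · have := h₂ x (hD hx)
    rwa [h₁ x hx] at this
  · have := h₃ p.fml p.par (hΓ hp)
    rwa [show (fun i => r (p.par i)) = p.par from
      funext fun i => h₁ _ (W.isPrime.par_mem p hp i)] at this

/-- If the implication is not in the theory, adding `φ` does not derive `ψ`, and some world above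
refutes `ψ`. -/
theorem mem_imp (W : World 𝓓) {n : ℕ} {φ ψ : Fml Lpr n} {v : Fin n → Name M}
    (hv : ∀ i, v i ∈ W.D) (h : ∀ W' : World 𝓓, W ≤ W' → ⟨φ, v⟩ ∈ W'.Γ → ⟨ψ, v⟩ ∈ W'.Γ) :
    ⟨φ.imp ψ, v⟩ ∈ W.Γ := by
  by_contra hn
  obtain ⟨j, hj⟩ := W.bdd
  obtain ⟨W', hW, r, h₁, -, h₃, h₄⟩ := W.exists_ge (Γ₀ := insert ⟨φ, v⟩ W.Γ)
    (Set.subset_insert _ _) (by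
      rintro p (rfl | hp)
      · exact hv
      · exact W.isPrime.par_mem p hp) subset_rfl (fun x hx => (hj x hx).trans (Nat.le_succ j))
    (fun φ v hx => Nat.not_succ_le_self j (hj _ hx)) (χ := ψ) hv (fun hd => by
      rw [gen_insert] at hd
      exact hn (W.isPrime.mem_of_der hv (hd.deduct.le (𝓓.le_imp_int φ ψ v))))
  have e : (fun i => r (v i)) = v := funext fun i => h₁ _ (hv i)
  have h₅ := h₃ φ v (Set.mem_insert _ _)
  rw [e] at h₄ h₅
  exact h₄ (h W' hW h₅)

/-- A fresh name serves as a generic element: a derivation of its instance would generalize. The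
bound on levels guarantees that a fresh name exists. -/
theorem mem_all (W : World 𝓓) {n : ℕ} {φ : Fml Lpr (n + 1)} {v : Fin n → Name M}
    (hv : ∀ i, v i ∈ W.D)
    (h : ∀ W' : World 𝓓, W ≤ W' → ∀ x ∈ W'.D, ⟨φ, Matrix.vecCons x v⟩ ∈ W'.Γ) :
    ⟨φ.all, v⟩ ∈ W.Γ := by
  by_contra hn
  obtain ⟨j, hj⟩ := W.bdd
  have hf : Name.fresh j ∉ W.D := fun hx => Nat.not_succ_le_self j (hj _ hx)
  have hvar : (Name.fresh j : Name M).IsVar := trivial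
  obtain ⟨W', hW, r, h₁, h₂, -, h₄⟩ := W.exists_ge (D₁ := insert (Name.fresh j) W.D) subset_rfl
    (fun p hp i => Set.mem_insert_of_mem _ (W.isPrime.par_mem p hp i)) (Set.subset_insert _ _)
    (by
      rintro x (rfl | hx)
      · exact le_rfl
      · exact (hj x hx).trans (Nat.le_succ j))
    (by
      rintro n φ v (hx | hx)
      · cases hx
      · exact Nat.not_succ_le_self j (hj _ hx)) (χ := φ) (w := Matrix.vecCons (Name.fresh j) v)
    (Fin.cases (Set.mem_insert _ _) fun i => Set.mem_insert_of_mem _ (hv i)) (fun hd => by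
      rw [gen_insert_dom] at hd
      exact hn (W.isPrime.mem_of_der hv
        ((hd.deduct.bind hvar (indep_gen W.isPrime.par_mem hf)).le
          (𝓓.all_intro φ hvar fun i hi => hf (hi ▸ hv i)))))
  apply h₄
  have e : (fun i => r (Matrix.vecCons (Name.fresh j) v i)) =
      Matrix.vecCons (r (Name.fresh j)) v := by
    rw [Name.comp_vecCons]
    congr 1
    exact funext fun i => h₁ _ (hv i)
  rw [e]
  exact h W' hW _ (h₂ _ (Set.mem_insert _ _))

end World

/-- The canonical model on the worlds above a given world. -/
noncomputable def canonicalModel (W₀ : World 𝓓) : KripkeModel.{u} Lpr where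
  Node := {W : World 𝓓 // W₀ ≤ W}
  Ambient := Name M
  nonempty_node := ⟨⟨W₀, le_rfl⟩⟩
  dom W := W.1.D
  str W := inferInstanceAs (Lpr.Structure W.1.D)
  nonempty_dom W := W.1.nonempty_dom
  dom_mono {W W'} h := (show W.1.D ⊆ W'.1.D ∧ W.1.Γ ⊆ W'.1.Γ from h).1
  map_fun {W W'} h n f a := by
    refine ((W'.1.fn_eq_iff f _ _).2 ?_).symm
    exact (show W.1.D ⊆ W'.1.D ∧ W.1.Γ ⊆ W'.1.Γ from h).2 (W.1.funMap_mem f a)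
  map_rel _ _ R := nomatch R

theorem mem_coe_vecCons {D : Set (Name M)} {Γ : Set (PF M)} {n : ℕ} (φ : Fml Lpr (n + 1)) (a : D)
    (v : Fin n → D) : ⟨φ, fun i => (Matrix.vecCons a v i).1⟩ ∈ Γ ↔
      ⟨φ, Matrix.vecCons a.1 fun i => (v i).1⟩ ∈ Γ := by
  have e : (fun i => (Matrix.vecCons a v i).1) = Matrix.vecCons a.1 fun i => (v i).1 := by
    funext i
    refine Fin.cases rfl (fun i => rfl) i
  rw [e]

/-- The truth lemma. Disjunction and existence properties settle `∨` and `∃`; the extension theorems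
for worlds settle `→` and `∀`. -/
theorem forces_canonicalModel (W₀ : World 𝓓) {n : ℕ} (φ : Fml Lpr n)
    (W : (canonicalModel W₀).Node) (v : Fin n → (canonicalModel W₀).dom W) :
    (canonicalModel W₀).Forces φ W v ↔ ⟨φ, fun i => (v i).1⟩ ∈ W.1.Γ := by
  induction φ generalizing W with
  | falsum => exact ⟨fun h => h.elim, fun h => W.1.isPrime.cons _ h⟩
  | eq s t => exact (W.1.mem_eq_iff s t v).symm
  | rel R ts => exact nomatch R
  | and φ ψ ih₁ ih₂ => exact (and_congr (ih₁ W v) (ih₂ W v)).trans W.1.isPrime.mem_and.symm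
  | or φ ψ ih₁ ih₂ => exact (or_congr (ih₁ W v) (ih₂ W v)).trans W.1.isPrime.mem_or.symm
  | imp φ ψ ih₁ ih₂ =>
    constructor
    · intro h
      refine W.1.mem_imp (fun i => (v i).2) fun W' hW hφ => ?_
      exact (ih₂ ⟨W', W.2.trans hW⟩ _).1 (h ⟨W', W.2.trans hW⟩ hW ((ih₁ _ _).2 hφ))
    · intro h W' hW hφ
      exact (ih₂ _ _).2 (W'.1.isPrime.mp (hW.2 h) ((ih₁ _ _).1 hφ))
  | all φ ih =>
    constructor
    · intro h
      refine W.1.mem_all (fun i => (v i).2) fun W' hW x hx => ?_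
      exact (mem_coe_vecCons φ _ _).1
        ((ih ⟨W', W.2.trans hW⟩ _).1 (h ⟨W', W.2.trans hW⟩ hW ⟨x, hx⟩))
    · intro h W' hW a
      exact (ih _ _).2 ((mem_coe_vecCons φ a _).2 (W'.1.isPrime.mem_all (hW.2 h) a.2))
  | ex φ ih =>
    refine Iff.trans ⟨?_, ?_⟩ W.1.isPrime.mem_ex.symm
    · rintro ⟨a, ha⟩
      exact ⟨a.1, a.2, (mem_coe_vecCons φ a _).1 ((ih _ _).1 ha)⟩
    · rintro ⟨x, hx, hm⟩
      exact ⟨⟨x, hx⟩, (ih _ _).2 ((mem_coe_vecCons φ ⟨x, hx⟩ _).2 hm)⟩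

theorem forcesTheory_canonicalModel (W₀ : World 𝓓) {T : Set (Fml Lpr 0)}
    (h : ∀ φ ∈ T, ∀ v, 𝓓.le 𝓓.top (𝓓.int φ v)) : (canonicalModel W₀).ForcesTheory T :=
  fun φ hφ W => (forces_canonicalModel W₀ φ W _).2
    (W.1.isPrime.mem_of_top_le (fun i => i.elim0) (h φ hφ _))

end Doctrine

/-! ### The root: formulas realized in `M`. -/

namespace PAModel

variable {M N : Type u} [Lpr.Structure M] [Lpr.Structure N]

theorem map_fn (ι : M ↪[Lpr] N) {n : ℕ} (f : PR n) (v : Fin n → M) :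
    ι (f.fn v) = f.fn fun i => ι (v i) :=
  ι.map_fun f v

variable [PAModel N]

/-- Halting computations of `N` on arguments in `M` already halt in `M`. -/
def ReflectsHalting (ι : M ↪[Lpr] N) : Prop :=
  ∀ e x : M, (∃ u : N, PR.kleeneT.fn ![ι e, ι x, u] = 0) →
    ∃ u : M, PR.kleeneT.fn ![ι e, ι x, ι u] = 0

/-- A halting computation is found already inside `M`, and values are unique, so the value is
obtained from an element of `M` by the result-extracting function. -/
theorem Ev.mem {ι : M ↪[Lpr] N} (hι : ReflectsHalting ι) {e x y : N} (he : e ∈ ι.toHom.range)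
    (hx : x ∈ ι.toHom.range) (h : Ev e x y) : y ∈ ι.toHom.range := by
  obtain ⟨e, rfl⟩ := he
  obtain ⟨x, rfl⟩ := hx
  obtain ⟨u, hu, hy⟩ := h
  obtain ⟨w, hw⟩ := hι e x ⟨u, hu⟩
  have : Ev (ι e) (ι x) (PR.kleeneU.fn ![ι w]) := ⟨_, hw, rfl⟩
  rw [Ev.unique (e := ι e) (x := ι x) ⟨u, hu, hy⟩ this]
  exact fn_mem _ fun i => by fin_cases i; exact ⟨w, rfl⟩

/-- The formulas with parameters in `M` that have a realizer in `M`. -/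
def rootTheory (ι : M ↪[Lpr] N) : Set (PF M) :=
  {p | ∃ m : Fin p.n → M, p.par = (fun i => Name.base (m i)) ∧
    ∃ e ∈ ι.toHom.range, Rz p.fml e fun i => ι (m i)}

/-- The world of the formulas that have a realizer in `M`. -/
noncomputable def rootWorld {ι : M ↪[Lpr] N} (hι : ReflectsHalting ι) :
    Doctrine.World (rzDoctrine ι.toHom.range ι) where
  D := Set.range Name.base
  Γ := rootTheory ι
  isPrime := by
    refine ⟨?_, ?_, ?_, ?_, ?_⟩
    · rintro p ⟨m, hm, -⟩ i
      rw [hm]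
      exact ⟨m i, rfl⟩
    · intro p hp hd
      choose m hm using hp
      -- Only base names occur in the domain of the root; the default value `0` of the others is
      -- immaterial.
      let ρ : Name M → N := fun x => match x with
        | .base m => ι m
        | _ => 0
      have key : ∀ P, (rzDoctrine ι.toHom.range ι).Der
          ((rzDoctrine ι.toHom.range ι).gen (Set.range Name.base) (rootTheory ι)) P →
          ∃ a ∈ ι.toHom.range, P ρ a := by
        intro P hP
        induction hP with
        | mem h =>
          rcases h with ⟨q, ⟨m, hq, e, he, hr⟩, rfl⟩ | ⟨_, ⟨m, rfl⟩, rfl⟩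
          · refine ⟨e, he, ?_⟩
            change Rz q.fml e fun i => ρ (q.par i)
            rw [hq]
            exact hr
          · exact ⟨ι m, ⟨m, rfl⟩, rfl⟩
        | top => exact ⟨0, zero_mem, trivial⟩
        | le _ hl ih =>
          obtain ⟨a, ha, hP⟩ := ih
          obtain ⟨R, ⟨e, he, hR⟩, h⟩ := hl
          obtain ⟨b, hb, hQ⟩ := h ρ (fun _ => rfl) a hP
          -- Consequence is witnessed by an index in `M`, and its value at a realizer in `M` stays
          -- in `M` because halting is reflected.
          exact ⟨b, (hR _ _ hb).mem hι he ha, hQ⟩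
        | inf _ _ ih₁ ih₂ =>
          obtain ⟨a, ha, hP⟩ := ih₁
          obtain ⟨b, hb, hQ⟩ := ih₂
          refine ⟨pr a b, pr_mem ha hb, ?_, ?_⟩
          · rwa [fst_pr]
          · rwa [snd_pr]
      obtain ⟨a, ha, hr⟩ := key _ hd
      refine ⟨m, funext fun i => (hm i).symm, a, ha, ?_⟩
      change Rz p.fml a fun i => ρ (p.par i) at hr
      simp only [← hm] at hr
      exact hr
    · rintro n φ ψ v ⟨m, hm, e, he, ⟨-, h⟩ | ⟨-, h⟩⟩
      · exact Or.inl ⟨m, hm, _, snd_mem he, h⟩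
      · exact Or.inr ⟨m, hm, _, snd_mem he, h⟩
    · rintro n φ v ⟨m, hm, e, he, h⟩
      -- The witness is a component of a realizer in `M`, so it belongs to `M` and has a base name.
      obtain ⟨a, ha⟩ := fst_mem he
      refine ⟨Name.base a, ⟨a, rfl⟩, Matrix.vecCons a m, ?_, _, snd_mem he, ?_⟩
      · change Matrix.vecCons (Name.base a) v = _
        rw [show v = _ from hm]
        funext i
        refine Fin.cases rfl (fun i => rfl) i
      · change Rz φ (snd e) (Matrix.vecCons (fst e) fun i => ι (m i)) at h
        rw [← ha] at h
        convert h using 1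
        funext i
        refine Fin.cases rfl (fun i => rfl) i
    · rintro n v ⟨m, hm, e, he, h⟩
      exact h
  exact_eq := by
    rintro x y ⟨m, hm, e, he, h⟩
    rw [show x = Name.base (m 0) from congrFun hm 0, show y = Name.base (m 1) from congrFun hm 1,
      ι.injective h]
  bdd := ⟨0, by
    rintro _ ⟨m, rfl⟩
    exact le_rfl⟩

/-- The root structure is isomorphic to `M`. -/
noncomputable def rootEquiv {ι : M ↪[Lpr] N} (hι : ReflectsHalting ι) :
    M ≃[Lpr] (rootWorld hι).D where
  toEquiv := Equiv.ofInjective Name.base fun _ _ h => by cases h; rfl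
  map_fun' {n} f v := by
    refine (((rootWorld hι).fn_eq_iff f _ _).2 ⟨Matrix.vecCons
      (PR.fn f v) v, ?_, 0, zero_mem, ?_⟩).symm
    · funext i
      refine Fin.cases rfl (fun i => rfl) i
    · exact map_fn ι f v
  map_rel' R := nomatch R

theorem exists_kripkeModel {ι : M ↪[Lpr] N} (hι : ReflectsHalting ι) :
    ∃ (K : KripkeModel.{u} Lpr) (r : K.Node), K.IsRoot r ∧ K.ForcesTheory (HA ∪ ECT0) ∧
      Nonempty (M ≃[Lpr] K.dom r) := by
  refine ⟨Doctrine.canonicalModel (rootWorld hι), ⟨rootWorld hι, le_rfl⟩, fun W => W.2,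
    Doctrine.forcesTheory_canonicalModel _ fun φ hφ v => .of_valid ?_ _ v, ⟨rootEquiv hι⟩⟩
  rcases hφ with (h | h | ⟨n, φ, rfl⟩) | ⟨n, φ, ψ, hφ, rfl⟩
  · exact valid_axQ h
  · exact valid_axPR h
  · exact valid_indAxiom φ
  · exact valid_ectAxiom hφ ψ

end PAModel

/-! ### Derived rules of the classical calculus. -/

namespace ProvableC

variable {L : FirstOrder.Language} {T : Set (Fml L 0)}

theorem subst {n m : ℕ} {φ : Fml L n} (h : ProvableC T φ) (σ : Fin n → L.Term (Fin m)) :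
    ProvableC T (φ.subst σ) := by
  induction h generalizing m with
  | ax hφ =>
    rw [Fml.ofSentence, Fml.subst_subst]
    convert ProvableC.ax (n := m) hφ using 1
    rw [Fml.ofSentence]
    congr 1
    exact funext fun i => i.elim0
  | mp _ _ ih₁ ih₂ => exact (ih₁ σ).mp (ih₂ σ)
  | imp_K φ ψ => exact imp_K _ _
  | imp_S φ ψ χ => exact imp_S _ _ _
  | and_intro φ ψ => exact and_intro _ _
  | and_left φ ψ => exact and_left _ _
  | and_right φ ψ => exact and_right _ _
  | or_inl φ ψ => exact or_inl _ _
  | or_inr φ ψ => exact or_inr _ _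
  | or_elim φ ψ χ => exact or_elim _ _ _
  | exfalso φ => exact exfalso _
  | dne φ => exact dne _
  | all_elim φ t =>
    rw [Fml.subst, Fml.inst_subst]
    exact all_elim _ _
  | ex_intro φ t =>
    rw [Fml.subst, Fml.inst_subst]
    exact ex_intro _ _
  | all_rule _ ih =>
    have := ih (Fml.up σ)
    rw [Fml.subst, Fml.weaken_subst] at this
    exact all_rule this
  | ex_rule _ ih =>
    have := ih (Fml.up σ)
    rw [Fml.subst, Fml.weaken_subst] at this
    exact ex_rule this
  | nonempty => exact nonempty
  | eq_refl t => exact eq_refl _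
  | eq_subst φ s t =>
    rw [Fml.subst, Fml.subst, Fml.subst, Fml.inst_subst, Fml.inst_subst]
    exact eq_subst _ _ _

variable {n : ℕ} {φ ψ χ : Fml L n}

theorem imp_of (h : ProvableC T ψ) (φ : Fml L n) : ProvableC T (φ.imp ψ) :=
  (imp_K ψ φ).mp h

theorem imp_mp (h₁ : ProvableC T (χ.imp (φ.imp ψ))) (h₂ : ProvableC T (χ.imp φ)) :
    ProvableC T (χ.imp ψ) :=
  ((imp_S χ φ ψ).mp h₁).mp h₂

theorem imp_refl (φ : Fml L n) : ProvableC T (φ.imp φ) :=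
  imp_mp (imp_K φ (φ.imp φ)) (imp_K φ φ)

theorem imp_trans (h₁ : ProvableC T (φ.imp ψ)) (h₂ : ProvableC T (ψ.imp χ)) :
    ProvableC T (φ.imp χ) :=
  imp_mp (h₂.imp_of φ) h₁

theorem imp_and (h₁ : ProvableC T (χ.imp φ)) (h₂ : ProvableC T (χ.imp ψ)) :
    ProvableC T (χ.imp (φ.and ψ)) :=
  imp_mp (imp_trans h₁ (and_intro φ ψ)) h₂

theorem curry (h : ProvableC T ((φ.and ψ).imp χ)) : ProvableC T (φ.imp (ψ.imp χ)) :=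
  imp_trans (and_intro φ ψ) ((imp_S _ _ _).mp (h.imp_of ψ))

theorem uncurry (h : ProvableC T (φ.imp (ψ.imp χ))) : ProvableC T ((φ.and ψ).imp χ) :=
  imp_mp (imp_trans (and_left φ ψ) h) (and_right φ ψ)

theorem imp_swap (h : ProvableC T (φ.imp (ψ.imp χ))) : ProvableC T (ψ.imp (φ.imp χ)) :=
  curry (imp_trans (imp_and (and_right ψ φ) (and_left ψ φ)) h.uncurry)

theorem contrapose (h : ProvableC T (φ.imp ψ)) : ProvableC T (ψ.neg.imp φ.neg) :=
  imp_swap (imp_trans h (imp_swap (imp_refl ψ.neg)))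

theorem em (φ : Fml L n) : ProvableC T (φ.or φ.neg) := by
  refine (dne _).mp ?_
  have h₁ : ProvableC T ((φ.or φ.neg).neg.imp φ.neg) := contrapose (or_inl φ φ.neg)
  have h₂ : ProvableC T ((φ.or φ.neg).neg.imp φ.neg.neg) := contrapose (or_inr φ φ.neg)
  exact imp_mp h₂ h₁

theorem all_weaken_imp (φ : Fml L (n + 1)) : ProvableC T (φ.all.weaken.imp φ) := by
  have := all_elim (T := T) (φ.subst (Fml.up fun i => Language.Term.var i.succ))
    (Language.Term.var 0)
  rwa [Fml.weaken_all_inst] at this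

theorem imp_ex_weaken (φ : Fml L (n + 1)) : ProvableC T (φ.imp φ.ex.weaken) := by
  have := ex_intro (T := T) (φ.subst (Fml.up fun i => Language.Term.var i.succ))
    (Language.Term.var 0)
  rwa [Fml.weaken_all_inst] at this

theorem all_mono {φ ψ : Fml L (n + 1)} (h : ProvableC T (φ.imp ψ)) :
    ProvableC T (φ.all.imp ψ.all) :=
  all_rule (imp_trans (all_weaken_imp φ) h)

theorem not_ex_not_imp_all (φ : Fml L (n + 1)) : ProvableC T (φ.neg.ex.neg.imp φ.all) :=
  all_rule (imp_trans (contrapose (imp_ex_weaken φ.neg)) (dne φ))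

theorem ex_not_of_not_all {φ : Fml L (n + 1)} (h : ProvableC T φ.all.neg) :
    ProvableC T φ.neg.ex :=
  (dne _).mp (imp_trans (not_ex_not_imp_all φ) h)

theorem alls {n : ℕ} {φ : Fml L n} (h : ProvableC T φ) : ProvableC T φ.alls := by
  induction n with
  | zero => exact h
  | succ n ih =>
    have h₁ : ProvableC T ((Fml.imp .falsum .falsum : Fml L n).imp φ.all) :=
      all_rule (h.imp_of _)
    exact ih (h₁.mp (imp_refl _))

theorem exists_eq {n : ℕ} (t : L.Term (Fin n)) :
    ProvableC T (Fml.ex (Fml.eq (Language.Term.var 0) (t.relabel Fin.succ))) := by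
  have h := ex_intro (T := T) (Fml.eq (Language.Term.var 0) (t.relabel Fin.succ)) t
  refine h.mp ?_
  have e : (Fml.eq (Language.Term.var 0) (t.relabel Fin.succ) : Fml L (n + 1)).inst t =
      .eq t t := by
    rw [Fml.inst, Fml.subst, Fml.term_relabel_eq_subst, Fml.term_subst_subst]
    congr 1
    exact Fml.term_subst_var t
  rw [e]
  exact eq_refl t

end ProvableC

/-! ### Classical completeness, and the embedding into a model of `PA`. -/

section Classical

open ProvableC

variable {M : Type u}

/-- A family of formulas indexed by the substitutions of terms for names. -/
abbrev Fam (M : Type u) : Type u := ∀ n : ℕ, (Name M → Lpr.Term (Fin n)) → Fml Lpr n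

open Classical in
/-- The substitution, extended to a scope of a quantifier that binds the name `y`. -/
noncomputable def Name.upd {n : ℕ} (ρ : Name M → Lpr.Term (Fin n)) (y : Name M) :
    Name M → Lpr.Term (Fin (n + 1)) :=
  Function.update (fun x => (ρ x).relabel Fin.succ) y (Language.Term.var 0)

theorem Name.upd_comp {n k : ℕ} {ρ : Name M → Lpr.Term (Fin n)} {v : Fin k → Name M} {y : Name M}
    (hv : ∀ i, v i ≠ y) : (fun i => Name.upd ρ y (v i)) = fun i => (ρ (v i)).relabel Fin.succ :=
  by classical exact Name.update_comp hv _

theorem Name.upd_vecCons {n k : ℕ} {ρ : Name M → Lpr.Term (Fin n)} {v : Fin k → Name M}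
    {y : Name M} (hv : ∀ i, v i ≠ y) :
    (fun i => Name.upd ρ y (Matrix.vecCons y v i)) = Fml.up fun i => ρ (v i) :=
  by classical exact Name.update_vecCons hv _

theorem Fml.isQF_eq {n : ℕ} (s t : Lpr.Term (Fin n)) : (Fml.eq s t).IsQF := by
  rw [Fml.IsQF]
  trivial

theorem Fml.isQF_neg {n : ℕ} {φ : Fml Lpr n} (h : φ.IsQF) : φ.neg.IsQF := by
  rw [Fml.neg, Fml.IsQF, Fml.IsQF]
  exact ⟨h, trivial⟩

theorem Fml.weaken_subst_eq {n k : ℕ} (φ : Fml Lpr k) (σ : Fin k → Lpr.Term (Fin n)) :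
    (φ.subst σ).weaken = φ.subst fun i => (σ i).relabel Fin.succ := by
  rw [Fml.weaken, Fml.subst_subst]
  simp only [Fml.term_relabel_eq_subst]

/-- The interpretation by provability in a classical theory. -/
noncomputable def provDoctrine (M : Type u) (T : Set (Fml Lpr 0)) : Doctrine M where
  H := Fam M
  le P Q := ∀ n ρ, ProvableC T ((P n ρ).imp (Q n ρ))
  top := fun _ _ => Fml.falsum.imp .falsum
  inf P Q := fun n ρ => (P n ρ).and (Q n ρ)
  imp P Q := fun n ρ => (P n ρ).imp (Q n ρ)
  bind y P := fun n ρ => .all (P (n + 1) (Name.upd ρ y))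
  Indep y P := ∀ n ρ, (P n ρ).weaken = P (n + 1) (Name.upd ρ y)
  -- Classically every name denotes, so existence is trivially true; `bind` already quantifies over
  -- all values.
  E _ := fun _ _ => Fml.falsum.imp .falsum
  int φ v := fun _ ρ => φ.subst fun i => ρ (v i)
  le_refl P n ρ := imp_refl _
  le_trans h₁ h₂ n ρ := imp_trans (h₁ n ρ) (h₂ n ρ)
  le_top P n ρ := (imp_refl _).imp_of _
  inf_le_left P Q n ρ := and_left _ _
  inf_le_right P Q n ρ := and_right _ _
  le_inf h₁ h₂ n ρ := imp_and (h₁ n ρ) (h₂ n ρ)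
  le_imp h n ρ := (h n ρ).curry
  imp_inf_le P Q n ρ := (imp_refl _).uncurry
  bind_mono _ h n ρ := all_mono (h _ _)
  le_bind {y P} _ hP n ρ := all_rule (by rw [hP]; exact imp_refl _)
  top_le_bind y n ρ := all_rule (imp_refl _)
  bind_inf P Q n ρ := all_rule (imp_and (imp_trans (and_left _ _) (all_weaken_imp _))
    (imp_trans (and_right _ _) (all_weaken_imp _)))
  indep_int φ v hv n ρ := by
    dsimp only
    rw [Fml.weaken_subst_eq, Name.upd_comp hv]
  indep_E _ _ _ := rfl
  falsum_le v φ w n ρ := exfalso _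
  and_le_left φ ψ v n ρ := and_left _ _
  and_le_right φ ψ v n ρ := and_right _ _
  inf_le_and φ ψ v n ρ := imp_refl _
  le_or_left φ ψ v n ρ := or_inl _ _
  le_or_right φ ψ v n ρ := or_inr _ _
  or_le h₁ h₂ n ρ := ((or_elim _ _ _).mp (h₁ n ρ)).mp (h₂ n ρ)
  imp_le φ ψ v n ρ := imp_refl _
  le_imp_int φ ψ v n ρ := imp_refl _
  all_elim φ v x n ρ := by
    refine imp_trans (and_left _ _) ?_
    dsimp only
    rw [Name.comp_vecCons, ← Fml.subst_up_inst]
    exact all_elim _ _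
  all_intro φ v y _ hv n ρ := by
    refine all_mono ?_
    dsimp only
    rw [Name.upd_vecCons hv]
    exact imp_mp (imp_refl _) ((imp_refl _).imp_of _)
  ex_intro φ v x n ρ := by
    refine imp_trans (and_right _ _) ?_
    dsimp only
    rw [Name.comp_vecCons, ← Fml.subst_up_inst]
    exact ex_intro _ _
  ex_elim φ v y Q _ hv hQ n ρ := by
    dsimp only
    rw [Name.upd_vecCons hv, ← hQ]
    refine imp_swap (ex_rule (imp_swap (imp_trans (all_weaken_imp _) ?_)))
    exact imp_swap (imp_trans (imp_and ((imp_refl _).imp_of _) (imp_refl _))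
      (imp_swap (imp_refl _)))
  int_subst_var φ r v := by
    funext n ρ
    dsimp only
    rw [Fml.subst_subst]
    rfl
  eq_refl t v n ρ := (eq_refl _).imp_of _
  eq_subst φ s t v n ρ := by
    dsimp only
    rw [Fml.inst_subst, Fml.inst_subst]
    exact (eq_subst _ _ _).uncurry
  exists_fn f v n ρ := ((exists_eq (f.app Language.Term.var)).alls.subst _).imp_of _
  eq_or_ne v n ρ := ((ProvableC.em _).alls.subst _).imp_of _

namespace Doctrine

variable {T : Set (Fml Lpr 0)}

theorem IsPrime.mem_of_provable {D : Set (Name M)} {Γ : Set (PF M)}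
    (h : (provDoctrine M T).IsPrime D Γ) {n : ℕ} {φ : Fml Lpr n} (hφ : ProvableC T φ)
    {v : Fin n → Name M} (hv : ∀ i, v i ∈ D) : ⟨φ, v⟩ ∈ Γ :=
  h.mem_of_top_le hv fun _ _ => (hφ.subst _).imp_of _

theorem IsPrime.mem_of_provable_imp {D : Set (Name M)} {Γ : Set (PF M)}
    (h : (provDoctrine M T).IsPrime D Γ) {n : ℕ} {φ ψ : Fml Lpr n} (hφ : ProvableC T (φ.imp ψ))
    {v : Fin n → Name M} (hm : ⟨φ, v⟩ ∈ Γ) : ⟨ψ, v⟩ ∈ Γ :=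
  h.mp (h.mem_of_provable hφ (h.par_mem _ hm)) hm

theorem IsPrime.mem_or_neg_mem {D : Set (Name M)} {Γ : Set (PF M)}
    (h : (provDoctrine M T).IsPrime D Γ) {n : ℕ} (φ : Fml Lpr n)
    {v : Fin n → Name M} (hv : ∀ i, v i ∈ D) : ⟨φ, v⟩ ∈ Γ ∨ ⟨φ.neg, v⟩ ∈ Γ :=
  h.prime _ _ _ (h.mem_of_provable (ProvableC.em φ) hv)

/-- The classical truth lemma. Excluded middle makes a prime theory complete, so truth in this
single structure suffices and no extensions are consulted. -/
theorem World.realize_iff (W : World (provDoctrine M T)) {n : ℕ} (φ : Fml Lpr n)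
    (v : Fin n → W.D) : φ.Realize W.D v ↔ ⟨φ, fun i => (v i).1⟩ ∈ W.Γ := by
  have h := W.isPrime
  induction φ with
  | falsum => exact ⟨fun hf => hf.elim, fun hm => h.cons _ hm⟩
  | eq s t => exact (W.mem_eq_iff s t v).symm
  | rel R ts => exact nomatch R
  | and φ ψ ih₁ ih₂ => exact (and_congr (ih₁ v) (ih₂ v)).trans h.mem_and.symm
  | or φ ψ ih₁ ih₂ => exact (or_congr (ih₁ v) (ih₂ v)).trans h.mem_or.symm
  | imp φ ψ ih₁ ih₂ =>
    refine (imp_congr (ih₁ v) (ih₂ v)).trans ⟨fun hi => ?_, h.mp⟩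
    rcases h.mem_or_neg_mem φ fun i => (v i).2 with hm | hm
    · exact h.mem_of_provable_imp (imp_K _ _) (hi hm)
    · exact h.mem_of_provable_imp ((imp_S _ _ _).mp ((exfalso ψ).imp_of φ)) hm
  | all φ ih =>
    constructor
    · intro hr
      rcases h.mem_or_neg_mem φ.neg.ex fun i => (v i).2 with hm | hm
      · obtain ⟨x, hx, hm⟩ := h.sat _ _ hm
        exact absurd (h.mp hm ((mem_coe_vecCons φ ⟨x, hx⟩ v).1 ((ih _).1 (hr ⟨x, hx⟩)))) (h.cons _)
      · exact h.mem_of_provable_imp (not_ex_not_imp_all φ) hm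
    · intro hm a
      exact (ih _).2 ((mem_coe_vecCons φ a v).2 (h.mem_all hm a.2))
  | ex φ ih =>
    refine Iff.trans ⟨?_, ?_⟩ h.mem_ex.symm
    · rintro ⟨a, ha⟩
      exact ⟨a.1, a.2, (mem_coe_vecCons φ a v).1 ((ih _).1 ha)⟩
    · rintro ⟨x, hx, hm⟩
      exact ⟨⟨x, hx⟩, (ih _).2 ((mem_coe_vecCons φ ⟨x, hx⟩ v).2 hm)⟩

theorem World.modelsTheory (W : World (provDoctrine M T)) : ModelsTheory W.D T := fun φ hφ => by
  refine (W.realize_iff φ _).2 (W.isPrime.mem_of_provable ?_ fun i => i.elim0)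
  convert ProvableC.ax (n := 0) hφ using 1
  conv_lhs => rw [← Fml.subst_var φ]
  rw [Fml.ofSentence]
  congr 1
  exact funext fun i => i.elim0

/-- The universal theory of `M` with names for the elements of `M`. -/
def univTheory (M : Type u) [Lpr.Structure M] : Set (PF M) :=
  {p | ∃ (k : ℕ) (θ : Fml Lpr (k + 1)) (m : Fin k → M), θ.IsQF ∧ θ.all.Realize M m ∧
    p = ⟨θ.all, fun i => .base (m i)⟩}

variable [Lpr.Structure M]

/-- The universal formulas true in `M` are closed under conjunction, by sharing the quantified
variable and concatenating parameters, so one of them carries any derivation. -/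
theorem exists_le_of_der {P : (provDoctrine M T).H}
    (h : (provDoctrine M T).Der ((provDoctrine M T).gen (Set.range Name.base) (univTheory M)) P) :
    ∃ (k : ℕ) (θ : Fml Lpr (k + 1)) (m : Fin k → M), θ.IsQF ∧ θ.all.Realize M m ∧
      (provDoctrine M T).le ((provDoctrine M T).int θ.all fun i => .base (m i)) P := by
  have htop : ∃ (k : ℕ) (θ : Fml Lpr (k + 1)) (m : Fin k → M), θ.IsQF ∧ θ.all.Realize M m ∧
      (provDoctrine M T).le ((provDoctrine M T).int θ.all fun i => .base (m i))
        (provDoctrine M T).top :=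
    ⟨0, Fml.falsum.imp .falsum, fun i => i.elim0, ⟨trivial, trivial⟩, fun _ h => h,
      (provDoctrine M T).le_top _⟩
  induction h with
  | mem hm =>
    rcases hm with ⟨_, ⟨k, θ, m, hθ, hr, rfl⟩, rfl⟩ | ⟨x, hx, rfl⟩
    · exact ⟨k, θ, m, hθ, hr, (provDoctrine M T).le_refl _⟩
    · exact htop
  | top => exact htop
  | le _ hl ih =>
    obtain ⟨k, θ, m, hθ, hr, h⟩ := ih
    exact ⟨k, θ, m, hθ, hr, (provDoctrine M T).le_trans h hl⟩
  | inf _ _ ih₁ ih₂ =>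
    obtain ⟨k₁, θ₁, m₁, hθ₁, hr₁, h₁⟩ := ih₁
    obtain ⟨k₂, θ₂, m₂, hθ₂, hr₂, h₂⟩ := ih₂
    let τ₁ : Fin (k₁ + 1) → Lpr.Term (Fin (k₁ + k₂ + 1)) :=
      Fml.up fun i => Language.Term.var (Fin.castAdd k₂ i)
    let τ₂ : Fin (k₂ + 1) → Lpr.Term (Fin (k₁ + k₂ + 1)) :=
      Fml.up fun i => Language.Term.var (Fin.natAdd k₁ i)
    refine ⟨k₁ + k₂, (θ₁.subst τ₁).and (θ₂.subst τ₂), Fin.append m₁ m₂,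
      ⟨Fml.isQF_subst hθ₁ _, Fml.isQF_subst hθ₂ _⟩, fun a => ⟨?_, ?_⟩, ?_⟩
    · rw [Fml.realize_subst, Fml.realize_up]
      simpa using hr₁ a
    · rw [Fml.realize_subst, Fml.realize_up]
      simpa using hr₂ a
    · refine (provDoctrine M T).le_inf ((provDoctrine M T).le_trans (fun n ρ => ?_) h₁)
        ((provDoctrine M T).le_trans (fun n ρ => ?_) h₂)
      · have e : θ₁.subst (Fml.up fun i => ρ (.base (m₁ i))) =
            (θ₁.subst τ₁).subst (Fml.up fun i => ρ (.base (Fin.append m₁ m₂ i))) := by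
          rw [Fml.subst_subst, Fml.up_subst_up]
          simp [Language.Term.subst]
        change ProvableC T (Fml.imp (Fml.all (Fml.and _ _)) (Fml.all _))
        rw [e]
        exact all_mono (and_left _ _)
      · have e : θ₂.subst (Fml.up fun i => ρ (.base (m₂ i))) =
            (θ₂.subst τ₂).subst (Fml.up fun i => ρ (.base (Fin.append m₁ m₂ i))) := by
          rw [Fml.subst_subst, Fml.up_subst_up]
          simp [Language.Term.subst]
        change ProvableC T (Fml.imp (Fml.all (Fml.and _ _)) (Fml.all _))
        rw [e]
        exact all_mono (and_right _ _)

/-- If a true universal formula `∀ x θ(x, m)` were refuted by `T`, its parameters could be read as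
variables, and `T` would prove the `Π₂` sentence `∀ y ∃ x ¬θ(x, y)`, which fails in `M` at `m`. -/
theorem not_der_falsum (hM : ModelsTheory M (ThPi2 T)) (w : Fin 0 → Name M) :
    ¬ (provDoctrine M T).Der ((provDoctrine M T).gen (Set.range Name.base) (univTheory M))
      ((provDoctrine M T).int .falsum w) := by
  classical
  intro hd
  obtain ⟨k, θ, m, hθ, hr, h⟩ := exists_le_of_der hd
  -- Repeated entries of `m` share one name, hence one variable, the chosen index; this is harmless,
  -- as all these positions have the same value under `m`.
  let ρ : Name M → Lpr.Term (Fin k) := fun x =>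
    if hx : ∃ i, Name.base (m i) = x then Language.Term.var hx.choose else tZero
  have hρ : ∀ i, (ρ (.base (m i))).realize m = m i := by
    intro i
    have hx : ∃ j, Name.base (m j) = .base (m i) := ⟨i, rfl⟩
    have := hx.choose_spec
    simp only [ρ, dif_pos hx, Language.Term.realize_var]
    exact Name.base.inj this
  have hp : ProvableC T (θ.subst (Fml.up fun i => ρ (.base (m i)))).neg.ex.alls :=
    (ex_not_of_not_all (h k ρ)).alls
  have h₁ := hM _ ⟨Fml.isPi2_alls (.sigma (.ex (.qf (Fml.isQF_neg (Fml.isQF_subst hθ _))))), hp⟩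
  rw [Fml.realize_alls] at h₁
  obtain ⟨a, ha⟩ := h₁ m
  refine ha ?_
  rw [Fml.realize_subst, Fml.realize_up]
  simp only [hρ]
  exact hr a

/-- A model of `Th_{Π₂}(T)` embeds into a model of `T` in such a way that universal formulas are
preserved. -/
theorem exists_world_of_modelsTheory (hM : ModelsTheory M (ThPi2 T)) :
    ∃ (W : World (provDoctrine M T)) (ι : M → W.D), ∀ {k : ℕ} (θ : Fml Lpr (k + 1)) (m : Fin k → M),
      θ.IsQF → θ.all.Realize M m → θ.all.Realize W.D fun i => ι (m i) := by
  obtain ⟨D, Γ, h, hD, hΓ, hl, -⟩ := exists_isPrime (𝓓 := provDoctrine M T)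
    (D₀ := Set.range Name.base) (Γ₀ := univTheory M) (j := 0)
    (by
      rintro _ ⟨k, θ, m, -, -, rfl⟩ i
      exact ⟨m i, rfl⟩)
    (by
      rintro _ ⟨m, rfl⟩
      exact Nat.zero_le _)
    (by
      rintro n φ v ⟨m, hm⟩
      cases hm)
    (q := ⟨.falsum, fun i : Fin 0 => i.elim0⟩) (fun i => i.elim0) (not_der_falsum hM _)
  -- No name has to be kept literally: `M` is mapped to the representatives of its names.
  obtain ⟨W, r, -, h₂, h₃⟩ := exists_world_of_isPrime h (D₀ := ∅) (Set.empty_subset _)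
    (fun x hx => hx.elim) hl
  refine ⟨W, fun m => ⟨r (.base m), h₂ _ (hD ⟨m, rfl⟩)⟩, fun {k} θ m hθ hr => ?_⟩
  refine (W.realize_iff _ _).2 ((h₃ θ.all _ fun i => hD ⟨m i, rfl⟩).2 (hΓ ⟨k, θ, m, hθ, hr, rfl⟩))

end Doctrine

/-- Preservation of universal formulas covers quantifier-free ones, so the map is an embedding, and
it covers `∀ u ¬T(e, x, u)`: a computation that does not halt in `M` does not halt in `N`. -/
theorem exists_embedding_paModel [Lpr.Structure M] (hM : ModelsTheory M (ThPi2 PA)) :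
    ∃ (N : Type u) (_ : Lpr.Structure N) (_ : PAModel N) (ι : M ↪[Lpr] N),
      PAModel.ReflectsHalting ι := by
  obtain ⟨W, ι, hι⟩ := Doctrine.exists_world_of_modelsTheory hM
  have hq : ∀ {k : ℕ} (φ : Fml Lpr k) (m : Fin k → M), φ.IsQF → φ.Realize M m →
      φ.Realize W.D fun i => ι (m i) := by
    intro k φ m hφ hr
    -- A quantifier-free formula is made universal by a dummy quantifier.
    have := hι φ.weaken m (Fml.isQF_subst hφ _) fun a => by
      rw [Fml.weaken, Fml.realize_subst]
      exact hr
    have h₁ := this ⟨_, W.nonempty_dom.some_mem⟩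
    rw [Fml.weaken, Fml.realize_subst] at h₁
    exact h₁
  have hfn : ∀ {k : ℕ} (f : PR k) (m : Fin k → M), ι (f.fn m) = f.fn fun i => ι (m i) := by
    intro k f m
    let φ : Fml Lpr (k + 1) :=
      .eq (Language.Term.var 0) (f.app fun i => Language.Term.var i.succ)
    have h₁ : φ.Realize M (Matrix.vecCons (f.fn m) m) := by
      simp only [φ, Fml.Realize]
      rfl
    have h₂ := hq φ _ (Fml.isQF_eq _ _) h₁
    simp only [φ, Fml.Realize] at h₂
    exact h₂
  have hne : ∀ a b : M, a ≠ b → ι a ≠ ι b := by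
    intro a b hab
    let φ : Fml Lpr 2 := (Fml.eq (Language.Term.var 0) (Language.Term.var 1)).neg
    have h₁ : φ.Realize M ![a, b] := by
      simp only [φ, Fml.neg, Fml.Realize]
      exact hab
    have h₂ := hq φ _ (Fml.isQF_neg (Fml.isQF_eq _ _)) h₁
    simp only [φ, Fml.neg, Fml.Realize] at h₂
    exact h₂
  have : PAModel W.D := ⟨W.modelsTheory⟩
  refine ⟨W.D, inferInstance, this, ⟨⟨ι, fun a b hab => ?_⟩, fun f m => hfn f m,
    fun R => nomatch R⟩,
    fun e x hu => ?_⟩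
  · by_contra hc
    exact hne a b hc hab
  · by_contra! hc
    obtain ⟨u, hu⟩ := hu
    let φ : Fml Lpr 3 := (Fml.eq (PR.kleeneT.app ![tv 1, tv 2, tv 0]) tZero).neg
    have hφ : ∀ {A : Type u} [Lpr.Structure A] (b : A) (w : Fin 2 → A),
        φ.Realize A (Matrix.vecCons b w) ↔
          PR.kleeneT.fn ![w 0, w 1, b] ≠ PR.zero.fn fun i => i.elim0 := by
      intro A _ b w
      have e : (PR.kleeneT.app ![tv 1, tv 2, tv 0] : Lpr.Term (Fin 3)).realize
          (Matrix.vecCons b w) = PR.kleeneT.fn ![w 0, w 1, b] := by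
        rw [PR.realize_app]
        congr 1
        funext i
        fin_cases i <;> rfl
      simp only [φ, Fml.neg, Fml.Realize, e, realize_tZero]
      rfl
    have h₁ : φ.all.Realize M ![e, x] := by
      rw [Fml.Realize]
      refine fun a => (hφ a _).2 fun ha => hc a ?_
      have h₂ := congrArg ι ha
      rw [hfn, hfn] at h₂
      convert h₂ using 2
      · funext i
        fin_cases i <;> rfl
      · exact congrArg PR.zero.fn (funext fun i => Fin.elim0 i)
    have h₂ := hι φ _ (Fml.isQF_neg (Fml.isQF_eq _ _)) h₁
    rw [Fml.Realize] at h₂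
    exact (hφ u _).1 (h₂ u) hu

end Classical

/-! ### The characterization of root structures. -/

theorem mainTheorem2 (M : Type u) [Lpr.Structure M] :
    (∃ (K : KripkeModel.{u} Lpr) (r : K.Node),
        K.IsRoot r ∧ K.ForcesTheory (HA ∪ ECT0) ∧ Nonempty (M ≃[Lpr] K.dom r)) ↔
      ModelsTheory M (ThPi2 PA) := by
  constructor
  · rintro ⟨K, r, hr, hK, ⟨e⟩⟩ φ hφ
    rw [← Fml.realize_equiv e]
    exact K.realize_root_of_isPi2 (fun φ hφ => hK φ (Or.inl hφ)) hr hφ _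
  · intro hM
    obtain ⟨N, _, _, ι, hι⟩ := exists_embedding_paModel hM
    exact PAModel.exists_kripkeModel hι
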